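/- Let $\beta>3$, $0<r<\tfrac23$ and $\tfrac{1-r}{2}<q\le \beta-r$ be fixed. For every $n\in\mathbb N$ let $(X,\mu)=(X_n,\mu_n)$ be a probability space, let $d=n^\beta$ and $p=n^r$ (rounded to integers, up or down), and let $v_1,\dots,v_d:X\to\mathbb R$ be measurable functions that are orthonormal in $L_2(X,\mu)$. Everything may depend on $n$. Let $\mathcal H$ be the reproducing kernel Hilbert space on $X$ with kernel $$k(x,x')=\sum_{\ell=1}^d\lambda_\ell v_\ell(x)v_\ell(x'),\qquad \lambda_\ell=1\ \text{ for } \ell\le p,\qquad \lambda_\ell=n^{-\beta+r+q}\ \text{ for } p<\ell\le d .$$ Suppose that there are constants $C,C'$, not depending on $n$, such that for $\mu$-almost every $x$ $$\sum_{\ell=1}^p v_\ell(x)^2\le C\,p\qquad\text{and}\qquad \Bigl|\sum_{\ell>p}\bigl(v_\ell(x)^2-1\bigr)\Bigr|\le C'\,n^{\beta/2+1}$$ (the first holds in particular if $|v_\ell|\le\sqrt C$ for all $\ell$). Let $\eta^*\in G:=\operatorname{span}(v_1,\dots,v_p)$, and let $(x_1,y_1),\dots,(x_n,y_n)$ be i.i.d.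 copies of a random pair $(x,y)$ with $x\sim\mu$, $y\in\{-1,1\}$ and $\mathbb E[y\mid x]=\eta^*(x)$. Then, as $n\to\infty$, support vector proliferation occurs with probability tending to $1$; that is, the probability of the following event tends to $1$: the minimum-norm interpolation problem $$\min_{\eta\in\mathcal H}\|\eta\|_{\mathcal H}\quad\text{subject to}\quad \eta(x_i)=y_i\quad (i=1,\dots,n)$$ and the hard-margin kernel SVM problem $$\min_{\eta\in\mathcal H}\|\eta\|_{\mathcal H}\quad\text{subject to}\quad y_i\,\eta(x_i)\ge 1\quad (i=1,\dots,n)$$ both have a unique solution, and the two solutions coincide. -/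

import Mathlib

open MeasureTheory ProbabilityTheory Filter Topology

/-- The bi-level ensemble with parameters `(n, β, q, r)` over the probability space `(X, μ)`:
`d = n ^ β` real features `v ℓ`, orthonormal in `L²(μ)`, of which the first `p = n ^ r` are the
leading ones. The powers `n ^ β` and `n ^ r` are rounded to integers, up or down. -/
structure BilevelEnsemble (n : ℕ) (β q r : ℝ) {X : Type*} [MeasurableSpace X]
    (μ : Measure X) where
  /-- number of features -/
  d : ℕ
  /-- number of leading features -/
  p : ℕ
  d_round : |(d : ℝ) - (n : ℝ) ^ β| < 1
  p_round : |(p : ℝ) - (n : ℝ) ^ r| < 1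
  /-- the features, that is, the eigenfunctions of the kernel integral operator -/
  v : Fin d → X → ℝ
  measurable_v : ∀ ℓ, Measurable (v ℓ)
  orthonormal_v : ∀ ℓ m, ∫ x, v ℓ x * v m x ∂μ = if ℓ = m then 1 else 0

namespace BilevelEnsemble

variable {n : ℕ} {β q r : ℝ} {X : Type*} [MeasurableSpace X] {μ : Measure X}

/-- The eigenvalues: `1` for the first `p` features and `n ^ (-β + r + q)` for the others. -/
noncomputable def eigenvalue (E : BilevelEnsemble n β q r μ) (ℓ : Fin E.d) : ℝ :=
  if (ℓ : ℕ) < E.p then 1 else (n : ℝ) ^ (-β + r + q)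

/-- The kernel `k(x, x') = ∑ ℓ, λ_ℓ v_ℓ(x) v_ℓ(x')`. -/
noncomputable def kernel (E : BilevelEnsemble n β q r μ) (x x' : X) : ℝ :=
  ∑ ℓ, E.eigenvalue ℓ * E.v ℓ x * E.v ℓ x'

/-- The span `G` of the first `p` eigenfunctions. -/
def G (E : BilevelEnsemble n β q r μ) : Submodule ℝ (X → ℝ) :=
  Submodule.span ℝ (E.v '' {ℓ : Fin E.d | (ℓ : ℕ) < E.p})

/-- Bounded orthonormal system on `G`, with constant `C`: `∑_{ℓ ≤ p} v_ℓ(x)² ≤ C p` almost surely.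
Uniformly bounded features, `|v_ℓ| ≤ √C`, have this property. -/
def IsBOS (E : BilevelEnsemble n β q r μ) (C : ℝ) : Prop :=
  ∀ᵐ x ∂μ,
    ∑ ℓ ∈ Finset.univ.filter (fun ℓ : Fin E.d => (ℓ : ℕ) < E.p), E.v ℓ x ^ 2 ≤ C * E.p

/-- The thin-shell condition with constant `C`: for almost all `x`,
`|∑_{ℓ > p} (v_ℓ(x)² - 1)| ≤ C n ^ (β / 2 + 1)`. -/
def ThinShell (E : BilevelEnsemble n β q r μ) (C : ℝ) : Prop :=
  ∀ᵐ x ∂μ,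
    |∑ ℓ ∈ Finset.univ.filter (fun ℓ : Fin E.d => E.p ≤ (ℓ : ℕ)), (E.v ℓ x ^ 2 - 1)| ≤
      C * (n : ℝ) ^ (β / 2 + 1)

end BilevelEnsemble

/-- `(x i, y i)`, `i = 1, …, n`, are i.i.d. copies of a pair with `x ∼ μ`, `y ∈ {-1, 1}` and
`E[y | x] = η(x)`. -/
structure IsLabeledSample {Ω : Type*} [MeasurableSpace Ω] (P : Measure Ω)
    {X : Type*} [MeasurableSpace X] (μ : Measure X) (η : X → ℝ)
    {n : ℕ} (x : Fin n → Ω → X) (y : Fin n → Ω → ℝ) : Prop where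
  measurable_x : ∀ i, Measurable (x i)
  measurable_y : ∀ i, Measurable (y i)
  indep : iIndepFun (fun i ω => (x i ω, y i ω)) P
  law_x : ∀ i, P.map (x i) = μ
  label : ∀ i, ∀ᵐ ω ∂P, y i ω = 1 ∨ y i ω = -1
  regression : ∀ i,
    P[y i | MeasurableSpace.comap (x i) inferInstance] =ᵐ[P] fun ω => η (x i ω)

section SVP

variable {X H : Type*} [NormedAddCommGroup H] [InnerProductSpace ℝ H] [RKHS ℝ H X ℝ] {n : ℕ}

/-- `f` solves the minimum-norm interpolation problem for the data `(x i, y i)`. -/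
def IsMinNormInterpolant (x : Fin n → X) (y : Fin n → ℝ) (f : H) : Prop :=
  (∀ i, f (x i) = y i) ∧ ∀ g : H, (∀ i, g (x i) = y i) → ‖f‖ ≤ ‖g‖

/-- `f` solves the hard-margin kernel support vector machine problem for the data `(x i, y i)`. -/
def IsHardMarginSVM (x : Fin n → X) (y : Fin n → ℝ) (f : H) : Prop :=
  (∀ i, 1 ≤ y i * f (x i)) ∧ ∀ g : H, (∀ i, 1 ≤ y i * g (x i)) → ‖f‖ ≤ ‖g‖

variable (H) in
/-- Support vector proliferation: both problems have a unique solution in `H`, and the two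
solutions coincide. -/
def SupportVectorProliferation (x : Fin n → X) (y : Fin n → ℝ) : Prop :=
  ∃ f : H, {g : H | IsMinNormInterpolant x y g} = {f} ∧ {g : H | IsHardMarginSVM x y g} = {f}

end SVP

/-!
# Support vector proliferation for bi-level ensembles

Both problems are governed by the kernel matrix `M i j = k (x i, x j)` of the sample. If `M α = y`
and `y i * α i ≥ 0` for all `i`, then by weak duality `f = ∑ i, α i k (x i, ·)` has the smallest
norm among all functions with margins at least `1`, and it is the only one of that norm; since `f`
interpolates, it also solves the interpolation problem
(`supportVectorProliferation_of_dual`). So all that is needed is that the dual coefficients have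
the signs of the labels.

Let `φ` be the vector of the `p` leading features, so that `η = ⟪θ, φ⟫`, let `D = d - p` and
`s = n ^ (-β + r + q) * D`. The trailing features contribute a nearly diagonal matrix:
`M = Φ Φᵀ + s (1 + N)` with a small `N`. For `N = 0`, the vector `s α` is the residual of the ridge
regression of `y` on `φ` with penalty `s`. As the scatter operator `∑ i, φ (x i) φ (x i)ᵀ` is close
to `n`, the fit is approximately `n / (n + s) * η (x i)`, and the residual is approximately
`y i - (1 - γ) η (x i)` with `γ = s / (n + s)`. Because `|η| ≤ 1`, this has the sign of `y i`, with
margin at least `γ`. It remains to bound three errors, at all sample points simultaneously, by a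
fraction of `γ` (`exists_dual_sign`):

* The bias: the deviation of the fit of `η` from `(1 - γ) η`, relative to `γ`. It is of order
  `√(p / n) + p ^ (3 / 2) / n` up to logarithms, hence small for `r < 2 / 3`. It is estimated by one
  step of the Neumann series of the inverse scatter operator
  (`abs_inner_inverse_ridgeOp_le`, `measure_not_isGoodDesign_le`).
* The noise: the ridge fit of `y - η`, conditionally on the inputs a weighted sum of independent
  centred variables with total squared weight at most of order `p / (n + s)`
  (`measure_noise_ge_le`). It is below `γ` if `q > (1 - r) / 2`.
* The perturbation: the `ℓ^∞` operator norm of `N`, times that of the ridge smoother, of order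
  `√p`. The diagonal of `N` is controlled by the thin-shell condition. A row of off-diagonal entries
  sums to about `n √D / D` in absolute value, since a kernel `R` of orthonormal features satisfies
  `E |R (a, x)| ≤ √(R (a, a))` (`measure_row_sum_ge_le`). This is small enough for `β > 3`,
  given the condition on `q`.

The scatter operator is bounded below through the fourth moment
`E tr (∑ i, (φ (x i) φ (x i)ᵀ - 1))⁴`, which is of order `n² p³` (`measure_scatter_lt_le`). The
concentration of vector valued sums comes from the moment generating function `E cosh ‖∑ z‖` in a
Hilbert space, which is multiplied by at most `1 + E ‖z‖²` with each further independent centred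
summand `z` with `‖z‖ ≤ 1` (`cosh_norm_add_le`, `measure_norm_sum_ge_le`). Both arguments add one
sample point at a time and integrate out its coordinate in the product measure.
-/

/-! ### Ridge regression and the signs of the dual coefficients -/

section Ridge

variable {κ E : Type*} [Fintype κ] [NormedAddCommGroup E] [InnerProductSpace ℝ E]

/-- The regularized scatter operator `v ↦ s v + ∑ j, ⟪φ j, v⟫ φ j` of ridge regression with
feature vectors `φ j` and penalty `s`. -/
noncomputable def ridgeOp (s : ℝ) (φ : κ → E) : E →L[ℝ] E :=
  s • ContinuousLinearMap.id ℝ E + ∑ j, (innerSL ℝ (φ j)).smulRight (φ j)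

/-- The entry `(i, j)` of the smoother (hat) matrix of ridge regression: the fitted value at `φ i`
is `∑ j, ridgeWeight s φ i j * y j` when the responses are `y`. -/
noncomputable def ridgeWeight (s : ℝ) (φ : κ → E) (i j : κ) : ℝ :=
  inner ℝ (φ i) (Ring.inverse (ridgeOp s φ) (φ j))

lemma ridgeOp_apply (s : ℝ) (φ : κ → E) (v : E) :
    ridgeOp s φ v = s • v + ∑ j, inner ℝ (φ j) v • φ j := by
  simp [ridgeOp]

lemma ridgeOp_symm (s : ℝ) (φ : κ → E) (v w : E) :
    inner ℝ (ridgeOp s φ v) w = inner ℝ v (ridgeOp s φ w) := by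
  simp only [ridgeOp_apply, inner_add_left, inner_add_right, sum_inner, inner_sum,
    real_inner_smul_left, real_inner_smul_right]
  congr 1
  refine Finset.sum_congr rfl fun j _ => ?_
  rw [real_inner_comm v (φ j)]
  ring

lemma inner_ridgeOp_self (s : ℝ) (φ : κ → E) (v : E) :
    inner ℝ v (ridgeOp s φ v) = s * ‖v‖ ^ 2 + ∑ j, inner ℝ (φ j) v ^ 2 := by
  simp only [ridgeOp_apply, inner_add_right, inner_sum, real_inner_smul_right,
    real_inner_self_eq_norm_sq]
  congr 1
  refine Finset.sum_congr rfl fun j _ => ?_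
  rw [real_inner_comm v (φ j)]
  ring

lemma sum_ridgeWeight_mul (s : ℝ) (φ : κ → E) (i : κ) (f : κ → ℝ) :
    ∑ j, ridgeWeight s φ i j * f j =
      inner ℝ (φ i) (Ring.inverse (ridgeOp s φ) (∑ j, f j • φ j)) := by
  simp only [ridgeWeight, map_sum, map_smul, inner_sum, real_inner_smul_right]
  exact Finset.sum_congr rfl fun j _ => mul_comm _ _

variable [FiniteDimensional ℝ E]

lemma isUnit_ridgeOp {s : ℝ} (hs : 0 < s) (φ : κ → E) : IsUnit (ridgeOp s φ) := by
  have hinj : Function.Injective (ridgeOp s φ).toLinearMap := by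
    refine (injective_iff_map_eq_zero _).2 fun v hv => ?_
    have h1 := inner_ridgeOp_self s φ v
    have h2 : ridgeOp s φ v = 0 := hv
    rw [h2, inner_zero_right] at h1
    have h3 : 0 ≤ ∑ j, inner ℝ (φ j) v ^ 2 := Finset.sum_nonneg fun _ _ => sq_nonneg _
    have h4 : s * ‖v‖ ^ 2 = 0 := le_antisymm (by linarith) (by positivity)
    simpa [hs.ne'] using h4
  let e := (LinearEquiv.ofInjectiveEndo _ hinj).toContinuousLinearEquiv
  have he : (e : E →L[ℝ] E) = ridgeOp s φ := by ext; rfl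
  rw [← he]
  exact ⟨(ContinuousLinearEquiv.unitsEquiv ℝ E).symm e, rfl⟩

lemma ridgeOp_inverse {s : ℝ} (hs : 0 < s) (φ : κ → E) (v : E) :
    ridgeOp s φ (Ring.inverse (ridgeOp s φ) v) = v := by
  have := Ring.mul_inverse_cancel _ (isUnit_ridgeOp hs φ)
  simpa using congrArg (fun T : E →L[ℝ] E => T v) this

lemma inverse_ridgeOp {s : ℝ} (hs : 0 < s) (φ : κ → E) (v : E) :
    Ring.inverse (ridgeOp s φ) (ridgeOp s φ v) = v := by
  have := Ring.inverse_mul_cancel _ (isUnit_ridgeOp hs φ)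
  simpa using congrArg (fun T : E →L[ℝ] E => T v) this

lemma inverse_ridgeOp_symm {s : ℝ} (hs : 0 < s) (φ : κ → E) (v w : E) :
    inner ℝ (Ring.inverse (ridgeOp s φ) v) w = inner ℝ v (Ring.inverse (ridgeOp s φ) w) := by
  conv_lhs => rw [← ridgeOp_inverse hs φ w]
  rw [← ridgeOp_symm, ridgeOp_inverse hs]

lemma ridgeWeight_eq {s : ℝ} (hs : 0 < s) (φ : κ → E) (i j : κ) :
    ridgeWeight s φ i j = inner ℝ (φ j) (Ring.inverse (ridgeOp s φ) (φ i)) := by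
  rw [ridgeWeight, ← inverse_ridgeOp_symm hs, real_inner_comm]

lemma norm_inverse_ridgeOp_le {s c : ℝ} (hs : 0 < s) (hc : 0 < c) {φ : κ → E}
    (h : ∀ v, (c - s) * ‖v‖ ^ 2 ≤ ∑ j, inner ℝ (φ j) v ^ 2) (v : E) :
    ‖Ring.inverse (ridgeOp s φ) v‖ ≤ ‖v‖ / c := by
  set a := Ring.inverse (ridgeOp s φ) v
  have h1 := inner_ridgeOp_self s φ a
  rw [ridgeOp_inverse hs] at h1
  have h2 := real_inner_le_norm a v
  have h3 := h a
  have h4 : c * ‖a‖ ^ 2 ≤ ‖a‖ * ‖v‖ := by nlinarith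
  rw [le_div_iff₀ hc]
  rcases (norm_nonneg a).eq_or_lt with h0 | h0
  · rw [← h0]; simp
  · nlinarith

/-- The squared weights of one fitted value sum to at most its leverage. -/
lemma sum_ridgeWeight_sq_le {s c : ℝ} (hs : 0 < s) (hc : 0 < c) {φ : κ → E}
    (h : ∀ v, (c - s) * ‖v‖ ^ 2 ≤ ∑ j, inner ℝ (φ j) v ^ 2) (i : κ) :
    ∑ j, ridgeWeight s φ i j ^ 2 ≤ ‖φ i‖ ^ 2 / c := by
  have h1 := inner_ridgeOp_self s φ (Ring.inverse (ridgeOp s φ) (φ i))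
  rw [ridgeOp_inverse hs] at h1
  have h2 : ∑ j, ridgeWeight s φ i j ^ 2 =
      ∑ j, inner ℝ (φ j) (Ring.inverse (ridgeOp s φ) (φ i)) ^ 2 :=
    Finset.sum_congr rfl fun j _ => by rw [ridgeWeight_eq hs]
  have h3 := real_inner_le_norm (Ring.inverse (ridgeOp s φ) (φ i)) (φ i)
  have h4 := norm_inverse_ridgeOp_le hs hc h (φ i)
  have h5 : 0 ≤ s * ‖Ring.inverse (ridgeOp s φ) (φ i)‖ ^ 2 := by positivity
  calc _ ≤ ‖Ring.inverse (ridgeOp s φ) (φ i)‖ * ‖φ i‖ := by linarith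
    _ ≤ ‖φ i‖ / c * ‖φ i‖ := by gcongr
    _ = _ := by ring

/-- A solution `α` of `(Φ Φᵀ + s) α = f` is, up to the factor `s`, the residual of the ridge fit
to the responses `f`. -/
lemma mul_eq_sub_sum_ridgeWeight {s : ℝ} (hs : 0 < s) (φ : κ → E) {f α : κ → ℝ}
    (h : ∀ i, ∑ j, inner ℝ (φ i) (φ j) * α j + s * α i = f i) (i : κ) :
    s * α i = f i - ∑ j, ridgeWeight s φ i j * f j := by
  have key : ∑ j, f j • φ j = ridgeOp s φ (∑ j, α j • φ j) := by
    rw [ridgeOp_apply, Finset.smul_sum, ← Finset.sum_add_distrib]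
    refine Finset.sum_congr rfl fun j _ => ?_
    rw [← h j, smul_smul, ← add_smul, inner_sum, add_comm]
    simp only [real_inner_smul_right]
    simp only [mul_comm]
  rw [sum_ridgeWeight_mul, key, inverse_ridgeOp hs, ← h i, inner_sum]
  simp only [real_inner_smul_right]
  simp only [mul_comm (α _)]
  ring

/-- Bias of ridge regression when the responses are linear in the features: up to the error term
`⟪φ i, A⁻¹ u⟫`, the fit shrinks the responses by the factor `m / (m + s)`. -/
lemma sum_ridgeWeight_linear {s m : ℝ} (hs : 0 < s) (hm : 0 ≤ m) (φ : κ → E) (θ : E) (i : κ) :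
    ∑ j, ridgeWeight s φ i j * inner ℝ θ (φ j) =
      m / (m + s) * inner ℝ θ (φ i) + s / (m + s) *
        inner ℝ (φ i) (Ring.inverse (ridgeOp s φ) (∑ j, inner ℝ θ (φ j) • φ j - m • θ)) := by
  have hms : m + s ≠ 0 := by positivity
  have h1 : ridgeOp s φ θ = s • θ + ∑ j, inner ℝ θ (φ j) • φ j := by
    rw [ridgeOp_apply]
    simp only [real_inner_comm]
  have h2 := inverse_ridgeOp hs φ θ
  rw [h1, map_add, map_smul] at h2
  have h3 := congrArg (inner ℝ (φ i)) h2
  rw [inner_add_right, real_inner_smul_right, real_inner_comm] at h3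
  rw [sum_ridgeWeight_mul, map_sub, map_smul, inner_sub_right, real_inner_smul_right]
  rw [real_inner_comm] at h3
  rw [real_inner_comm (φ i) θ, ← h3]
  field_simp
  ring

/-- One step of the Neumann expansion of `A⁻¹` around `(m + s)⁻¹`. -/
lemma abs_inner_inverse_ridgeOp_le {s m c : ℝ} (hs : 0 < s) (hm : 0 ≤ m) (hc : 0 < c) {φ : κ → E}
    (h : ∀ v, (c - s) * ‖v‖ ^ 2 ≤ ∑ j, inner ℝ (φ j) v ^ 2) (v u : E) :
    |inner ℝ v (Ring.inverse (ridgeOp s φ) u)| ≤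
      (|inner ℝ v u| + ‖∑ j, inner ℝ (φ j) v • φ j - m • v‖ * (‖u‖ / c)) / (m + s) := by
  have hms : 0 < m + s := by positivity
  set a := Ring.inverse (ridgeOp s φ) u with ha
  have h1 : inner ℝ (ridgeOp s φ v) a = inner ℝ v u := by
    rw [ridgeOp_symm, ha, ridgeOp_inverse hs]
  have h2 : ridgeOp s φ v = (m + s) • v + (∑ j, inner ℝ (φ j) v • φ j - m • v) := by
    rw [ridgeOp_apply, add_smul]; abel
  set z := ∑ j, inner ℝ (φ j) v • φ j - m • v
  rw [h2, inner_add_left, real_inner_smul_left] at h1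
  have h3 : (m + s) * inner ℝ v a = inner ℝ v u - inner ℝ z a := by linarith
  have h4 : |inner ℝ z a| ≤ ‖z‖ * (‖u‖ / c) :=
    (abs_real_inner_le_norm z a).trans
      (mul_le_mul_of_nonneg_left (norm_inverse_ridgeOp_le hs hc h u) (norm_nonneg _))
  rw [le_div_iff₀ hms, ← abs_of_pos hms, ← abs_mul, mul_comm, h3]
  exact (abs_sub _ _).trans (by gcongr)

/-- The deterministic heart of the argument. Under a lower bound on the scatter operator, small
bias, small noise and a kernel matrix `Φ Φᵀ + s (1 + N)` with `N` small in the `ℓ^∞` operator norm,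
the dual coefficients of the labels have the signs of the labels. -/
theorem exists_dual_sign {s ρ B : ℝ} (hs : 0 < s) (hB : 0 ≤ B) {φ : κ → E} {θ : E} {y : κ → ℝ}
    {N : κ → κ → ℝ} (hy : ∀ i, y i = 1 ∨ y i = -1) (hη : ∀ i, |inner ℝ θ (φ i)| ≤ 1)
    (hφ : ∀ i, ‖φ i‖ ^ 2 ≤ B)
    (hgram : ∀ v, (Fintype.card κ / 2 : ℝ) * ‖v‖ ^ 2 ≤ ∑ j, inner ℝ (φ j) v ^ 2)
    (hbias : ∀ i, |inner ℝ (φ i) (Ring.inverse (ridgeOp s φ)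
      (∑ j, inner ℝ θ (φ j) • φ j - (Fintype.card κ : ℝ) • θ))| ≤ 1 / 4)
    (hnoise : ∀ i, |∑ j, ridgeWeight s φ i j * (y j - inner ℝ θ (φ j))| ≤
      s / (4 * (Fintype.card κ + s)))
    (hN : ∀ i, ∑ j, |N i j| ≤ ρ)
    (hρ : (1 + √(2 * B)) * ρ ≤ s / (12 * (Fintype.card κ + s))) :
    ∃ α : κ → ℝ, (∀ i, ∑ j, (inner ℝ (φ i) (φ j) + s * N i j) * α j + s * α i = y i) ∧
      ∀ i, 0 ≤ y i * α i := by
  set m : ℝ := (Fintype.card κ : ℝ) with hm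
  have hm0 : 0 ≤ m := by positivity
  have hms : 0 < m + s := by positivity
  -- the shrinkage factor, the scale on which all errors are measured
  set γ := s / (m + s) with hγ
  have hγ0 : 0 < γ := by positivity
  have hγ1 : γ ≤ 1 := by rw [hγ, div_le_one hms]; linarith
  have hγm : m / (m + s) = 1 - γ := by rw [hγ]; field_simp; ring
  have hγ4 : s / (4 * (m + s)) = γ / 4 := by rw [hγ]; field_simp
  have hγ12 : s / (12 * (m + s)) = γ / 12 := by rw [hγ]; field_simp
  rw [hγ12] at hρ
  have hgram' : ∀ v, ((m + s) / 2 - s) * ‖v‖ ^ 2 ≤ ∑ j, inner ℝ (φ j) v ^ 2 := fun v => by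
    have := hgram v
    nlinarith [sq_nonneg ‖v‖]
  -- the smoother has `ℓ^∞` operator norm at most `√(2 B)`
  have hw : ∀ (f : κ → ℝ) (i : κ), |∑ j, ridgeWeight s φ i j * f j| ≤ √(2 * B) * ‖f‖ := by
    intro f i
    have h1 := Finset.sum_mul_sq_le_sq_mul_sq Finset.univ (ridgeWeight s φ i) f
    have h2 := sum_ridgeWeight_sq_le hs (by positivity : 0 < (m + s) / 2) hgram' i
    have h3 : ∑ j, f j ^ 2 ≤ m * ‖f‖ ^ 2 := by
      calc ∑ j, f j ^ 2 ≤ ∑ _j : κ, ‖f‖ ^ 2 := Finset.sum_le_sum fun j _ => by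
            have := norm_le_pi_norm f j
            rw [← sq_abs, ← Real.norm_eq_abs]
            gcongr
        _ = _ := by simp [hm]
    have h4 : ‖φ i‖ ^ 2 / ((m + s) / 2) ≤ 2 * B / (m + s) := by
      rw [div_le_div_iff₀ (by positivity) hms]
      nlinarith [hφ i]
    have h5 : 2 * B / (m + s) * (m * ‖f‖ ^ 2) ≤ 2 * B * ‖f‖ ^ 2 := by
      have : m / (m + s) ≤ 1 := by rw [hγm]; linarith
      calc 2 * B / (m + s) * (m * ‖f‖ ^ 2) = m / (m + s) * (2 * B * ‖f‖ ^ 2) := by ring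
        _ ≤ 1 * (2 * B * ‖f‖ ^ 2) := by gcongr
        _ = _ := one_mul _
    refine abs_le_of_sq_le_sq ?_ (by positivity)
    rw [mul_pow, Real.sq_sqrt (by positivity)]
    refine h1.trans (le_trans ?_ h5)
    have h6 : 0 ≤ ∑ j, f j ^ 2 := Finset.sum_nonneg fun _ _ => sq_nonneg _
    exact mul_le_mul (h2.trans h4) h3 h6 (by positivity)
  -- the perturbation `N` moves a solution by at most `γ / 12` of its size
  have hpert : ∀ b α : κ → ℝ,
      (∀ i, ∑ j, (inner ℝ (φ i) (φ j) + s * N i j) * α j + s * α i = b i) →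
      ∀ i, |s * α i - (b i - ∑ j, ridgeWeight s φ i j * b j)| ≤ γ / 12 * (s * ‖α‖) := by
    intro b α h i
    set g : κ → ℝ := fun i => ∑ j, s * N i j * α j with hg
    have hgi : ∀ i, |g i| ≤ ρ * (s * ‖α‖) := fun i => by
      calc |g i| ≤ ∑ j, |s * N i j * α j| := Finset.abs_sum_le_sum_abs _ _
        _ ≤ ∑ j, |N i j| * (s * ‖α‖) := Finset.sum_le_sum fun j _ => by
            rw [abs_mul, abs_mul, abs_of_pos hs]
            have : |α j| ≤ ‖α‖ := norm_le_pi_norm α j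
            calc s * |N i j| * |α j| ≤ s * |N i j| * ‖α‖ := by gcongr
              _ = _ := by ring
        _ ≤ ρ * (s * ‖α‖) := by
            rw [← Finset.sum_mul]
            exact mul_le_mul_of_nonneg_right (hN i) (by positivity)
    have hρ0 : 0 ≤ ρ := (Finset.sum_nonneg fun j _ => abs_nonneg (N i j)).trans (hN i)
    have hgn : ‖g‖ ≤ ρ * (s * ‖α‖) :=
      (pi_norm_le_iff_of_nonneg (by positivity)).2 hgi
    have h1 : ∀ i, ∑ j, inner ℝ (φ i) (φ j) * α j + s * α i = b i - g i := fun i => by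
      rw [← h i, hg]
      simp only [add_mul, Finset.sum_add_distrib]
      ring
    have h2 := mul_eq_sub_sum_ridgeWeight hs φ h1 i
    have h3 : s * α i - (b i - ∑ j, ridgeWeight s φ i j * b j) =
        -(g i) + ∑ j, ridgeWeight s φ i j * g j := by
      rw [h2]
      simp only [mul_sub, Finset.sum_sub_distrib]
      ring
    rw [h3]
    calc |-(g i) + ∑ j, ridgeWeight s φ i j * g j|
        ≤ |-(g i)| + |∑ j, ridgeWeight s φ i j * g j| := abs_add_le _ _
      _ ≤ ρ * (s * ‖α‖) + √(2 * B) * (ρ * (s * ‖α‖)) := by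
          rw [abs_neg]
          refine add_le_add (hgi i) ((hw g i).trans ?_)
          gcongr
      _ = (1 + √(2 * B)) * ρ * (s * ‖α‖) := by ring
      _ ≤ _ := mul_le_mul_of_nonneg_right hρ (by positivity)
  -- hence the kernel matrix is invertible
  let T : (κ → ℝ) →ₗ[ℝ] (κ → ℝ) :=
    { toFun := fun α i => ∑ j, (inner ℝ (φ i) (φ j) + s * N i j) * α j + s * α i
      map_add' := fun α β => by
        ext i
        simp only [Pi.add_apply, mul_add, Finset.sum_add_distrib]
        ring
      map_smul' := fun c α => by
        ext i
        simp only [Pi.smul_apply, smul_eq_mul, RingHom.id_apply, mul_add, Finset.mul_sum]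
        congr 1
        · exact Finset.sum_congr rfl fun j _ => by ring
        · ring }
  have hinj : Function.Injective T := by
    refine (injective_iff_map_eq_zero _).2 fun α hα => ?_
    have h1 := hpert 0 α fun i => congrFun hα i
    have h2 : ‖α‖ ≤ ‖α‖ / 12 := by
      refine (pi_norm_le_iff_of_nonneg (by positivity)).2 fun i => ?_
      have h3 := h1 i
      simp only [Pi.zero_apply, mul_zero, Finset.sum_const_zero, sub_zero, abs_mul,
        abs_of_pos hs] at h3
      rw [Real.norm_eq_abs]
      have h4 : s * |α i| ≤ s * (‖α‖ / 12) := by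
        calc s * |α i| ≤ γ / 12 * (s * ‖α‖) := h3
          _ ≤ 1 / 12 * (s * ‖α‖) := by gcongr
          _ = _ := by ring
      exact le_of_mul_le_mul_left h4 hs
    exact norm_le_zero_iff.1 (by linarith [norm_nonneg α])
  obtain ⟨α, hα⟩ := LinearMap.injective_iff_surjective.1 hinj y
  have hα' : ∀ i, ∑ j, (inner ℝ (φ i) (φ j) + s * N i j) * α j + s * α i = y i :=
    fun i => congrFun hα i
  refine ⟨α, hα', ?_⟩
  have hp := hpert y α hα'
  -- the ridge fit of the labels
  have hfit : ∀ i, ∃ δ, |δ| ≤ γ / 2 ∧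
      ∑ j, ridgeWeight s φ i j * y j = (1 - γ) * inner ℝ θ (φ i) + δ := fun i => by
    have h1 := sum_ridgeWeight_linear hs hm0 φ θ i
    rw [hγm, ← hγ] at h1
    refine ⟨γ * inner ℝ (φ i) (Ring.inverse (ridgeOp s φ)
      (∑ j, inner ℝ θ (φ j) • φ j - m • θ)) +
      ∑ j, ridgeWeight s φ i j * (y j - inner ℝ θ (φ j)), ?_, ?_⟩
    · refine (abs_add_le _ _).trans ?_
      rw [abs_mul, abs_of_pos hγ0]
      have h2 := hnoise i
      rw [hγ4] at h2
      have h3 := mul_le_mul_of_nonneg_left (hbias i) hγ0.le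
      linarith
    · rw [← add_assoc, ← h1, ← Finset.sum_add_distrib]
      exact Finset.sum_congr rfl fun j _ => by ring
  -- the residual of the ridge fit has the sign of the label, with margin `γ / 2`
  have hres : ∀ i, |y i - ∑ j, ridgeWeight s φ i j * y j| ≤ 3 ∧
      γ / 2 ≤ y i * (y i - ∑ j, ridgeWeight s φ i j * y j) := fun i => by
    obtain ⟨δ, hδ, h⟩ := hfit i
    rw [h]
    have h1 := abs_le.1 hδ
    have h2 := abs_le.1 (hη i)
    rw [abs_le]
    rcases hy i with h3 | h3 <;> rw [h3] <;> refine ⟨⟨?_, ?_⟩, ?_⟩ <;> nlinarith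
  -- so the perturbation error is at most `γ / 3`, which is below the margin
  have hnorm : s * ‖α‖ ≤ 4 := by
    have h1 : ‖α‖ ≤ (3 + s * ‖α‖ / 12) / s := by
      refine (pi_norm_le_iff_of_nonneg (by positivity)).2 fun i => ?_
      rw [le_div_iff₀ hs, Real.norm_eq_abs, mul_comm]
      nth_rewrite 1 [← abs_of_pos hs]
      rw [← abs_mul]
      have h2 := abs_sub_abs_le_abs_sub (s * α i) (y i - ∑ j, ridgeWeight s φ i j * y j)
      have h3 : γ / 12 * (s * ‖α‖) ≤ 1 / 12 * (s * ‖α‖) := by gcongr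
      linarith [hp i, (hres i).1]
    rw [le_div_iff₀ hs] at h1
    have : 0 ≤ s * ‖α‖ := by positivity
    nlinarith
  intro i
  have h1 := abs_le.1 (hp i)
  have h2 := (hres i).2
  have h3 : γ / 12 * (s * ‖α‖) ≤ γ / 12 * 4 := by gcongr
  have h4 : 0 ≤ s * (y i * α i) := by
    rcases hy i with h5 | h5 <;> rw [h5] at h2 ⊢ <;> nlinarith
  exact (mul_nonneg_iff_of_pos_left hs).1 h4

end Ridge

/-! ### The dual certificate -/

/-- Nonnegative dual coefficients certify support vector proliferation: if `α` solves the kernel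
system for the labels and `y i * α i ≥ 0` for all `i`, then `∑ i, α i k(x i, ·)` is the unique
solution of both problems. -/
theorem supportVectorProliferation_of_dual {X H : Type*} [NormedAddCommGroup H]
    [InnerProductSpace ℝ H] [CompleteSpace H] [RKHS ℝ H X ℝ] {n : ℕ} {x : Fin n → X}
    {y : Fin n → ℝ} (hy : ∀ i, y i = 1 ∨ y i = -1) {α : Fin n → ℝ}
    (hα : ∀ i, ∑ j, RKHS.kernel H (x i) (x j) 1 * α j = y i) (hpos : ∀ i, 0 ≤ y i * α i) :
    SupportVectorProliferation H x y := by
  have hyy : ∀ i, y i * y i = 1 := fun i => by rcases hy i with h | h <;> rw [h] <;> norm_num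
  set f : H := ∑ j, α j • RKHS.kerFun H (x j) (1 : ℝ) with hf
  have hinner : ∀ g : H, inner ℝ f g = ∑ j, α j * g (x j) := fun g => by
    rw [hf, sum_inner]
    simp [real_inner_smul_left]
  have hfx : ∀ i, f (x i) = y i := fun i => by
    have h1 : f (x i) = inner ℝ f (RKHS.kerFun H (x i) (1 : ℝ)) := by simp
    rw [h1, hf, sum_inner, ← hα i]
    refine Finset.sum_congr rfl fun j _ => ?_
    rw [real_inner_smul_left, RKHS.inner_kerFun, RKHS.kerFun_apply, mul_comm]
    simp
  have hff : ‖f‖ ^ 2 = ∑ j, α j * y j := by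
    rw [← real_inner_self_eq_norm_sq, hinner]
    simp only [hfx]
  -- weak duality
  have hle : ∀ g : H, (∀ i, 1 ≤ y i * g (x i)) → ‖f‖ ^ 2 ≤ inner ℝ f g := fun g hg => by
    rw [hff, hinner]
    refine Finset.sum_le_sum fun j _ => ?_
    have h1 := mul_le_mul_of_nonneg_left (hg j) (hpos j)
    have h2 : y j * α j * (y j * g (x j)) = y j * y j * (α j * g (x j)) := by ring
    rw [h2, hyy j, one_mul, mul_one] at h1
    linarith
  have hnorm : ∀ g : H, (∀ i, 1 ≤ y i * g (x i)) → ‖f‖ ≤ ‖g‖ := fun g hg => by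
    have h1 := (hle g hg).trans (real_inner_le_norm f g)
    rcases (norm_nonneg f).eq_or_lt with h0 | h0
    · rw [← h0]; exact norm_nonneg g
    · nlinarith
  have huniq : ∀ g : H, (∀ i, 1 ≤ y i * g (x i)) → ‖g‖ ≤ ‖f‖ → g = f := fun g hg hgf => by
    have h1 := norm_sub_sq_real g f
    rw [real_inner_comm] at h1
    have h2 := hle g hg
    have h3 : ‖g‖ ^ 2 ≤ ‖f‖ ^ 2 := by gcongr
    have h4 : ‖g - f‖ ^ 2 ≤ 0 := by linarith
    have h5 : ‖g - f‖ = 0 := by nlinarith [norm_nonneg (g - f)]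
    exact sub_eq_zero.1 (norm_eq_zero.1 h5)
  have hfeas : ∀ g : H, (∀ i, g (x i) = y i) → ∀ i, 1 ≤ y i * g (x i) := fun g hg i => by
    rw [hg i, hyy i]
  refine ⟨f, Set.eq_singleton_iff_unique_mem.2 ⟨⟨hfx, fun g hg => hnorm g (hfeas g hg)⟩, ?_⟩,
    Set.eq_singleton_iff_unique_mem.2 ⟨⟨hfeas f hfx, hnorm⟩, ?_⟩⟩
  · rintro g ⟨hg, hmin⟩
    exact huniq g (hfeas g hg) (hmin f hfx)
  · rintro g ⟨hg, hmin⟩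
    exact huniq g hg (hmin f (hfeas f hfx))

/-! ### Exponential and second moments on product spaces -/

section Tools

lemma sinh_le_mul_cosh {a : ℝ} (ha : 0 ≤ a) : Real.sinh a ≤ a * Real.cosh a := by
  have hd : ∀ t, HasDerivAt (fun t => t * Real.cosh t - Real.sinh t) (t * Real.sinh t) t :=
    fun t => by
      exact (((hasDerivAt_id t).mul (Real.hasDerivAt_cosh t)).sub
        (Real.hasDerivAt_sinh t)).congr_deriv (by simp)
  have hm : MonotoneOn (fun t => t * Real.cosh t - Real.sinh t) (Set.Ici 0) := by
    refine monotoneOn_of_deriv_nonneg (convex_Ici 0)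
      (fun t _ => (hd t).continuousAt.continuousWithinAt)
      (fun t _ => (hd t).differentiableAt.differentiableWithinAt) fun t ht => ?_
    rw [interior_Ici] at ht
    rw [(hd t).deriv]
    exact mul_nonneg (le_of_lt ht) (Real.sinh_nonneg_iff.2 (le_of_lt ht))
  have := hm (Set.self_mem_Ici) ha ha
  simp at this
  linarith

lemma cosh_sub_one_le_sq {t : ℝ} (ht : |t| ≤ 1) : Real.cosh t - 1 ≤ t ^ 2 := by
  have h1 := (abs_le.1 (Real.abs_exp_sub_one_sub_id_le ht)).2
  have h2 := (abs_le.1 (Real.abs_exp_sub_one_sub_id_le (by rwa [abs_neg] : |-t| ≤ 1))).2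
  rw [Real.cosh_eq]
  nlinarith

/-- Smoothness of the Hilbert space norm, in exponential form: besides a relative error `‖z‖²`, the
right-hand side is linear in `z`, so that a centred random `z` raises the mean of `cosh ‖S‖` by a
factor of at most `1 + E ‖z‖²`. -/
lemma cosh_norm_add_le {V : Type*} [NormedAddCommGroup V] [InnerProductSpace ℝ V] (S z : V)
    (hz : ‖z‖ ≤ 1) : Real.cosh ‖S + z‖ ≤
      Real.cosh ‖S‖ * (1 + ‖z‖ ^ 2) + Real.sinh ‖S‖ / ‖S‖ * inner ℝ S z := by
  rcases eq_or_ne S 0 with rfl | hS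
  · have := cosh_sub_one_le_sq (by rwa [abs_norm] : |‖z‖| ≤ 1)
    simp
    linarith
  have ha : 0 < ‖S‖ := norm_pos_iff.2 hS
  have hb := norm_add_sq_real S z
  obtain ⟨t, ht⟩ : ∃ t, ‖S + z‖ = ‖S‖ + t := ⟨‖S + z‖ - ‖S‖, by ring⟩
  have htz : |t| ≤ ‖z‖ := by
    have h1 := norm_add_le S z
    have h2 := norm_sub_le (S + z) z
    rw [add_sub_cancel_right] at h2
    rw [abs_le]; constructor <;> linarith
  have ht1 : |t| ≤ 1 := htz.trans hz
  have hts : t ^ 2 ≤ ‖z‖ ^ 2 := by rw [← sq_abs]; gcongr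
  rw [ht] at hb ⊢
  have hc : 0 < Real.cosh ‖S‖ := Real.cosh_pos _
  have hs : 0 ≤ Real.sinh ‖S‖ := Real.sinh_nonneg_iff.2 ha.le
  have hsc : Real.sinh ‖S‖ ≤ Real.cosh ‖S‖ := (Real.sinh_lt_cosh _).le
  -- second order remainder of the hyperbolic cosine
  have hrem : Real.cosh ‖S‖ * (Real.cosh t - 1) + Real.sinh ‖S‖ * (Real.sinh t - t) ≤
      Real.cosh ‖S‖ * t ^ 2 := by
    rcases le_total 0 t with h0 | h0
    · have h1 := (abs_le.1 (Real.abs_exp_sub_one_sub_id_le ht1)).2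
      rw [← Real.cosh_add_sinh] at h1
      have h2 : 0 ≤ Real.sinh t - t := sub_nonneg.2 (Real.self_le_sinh_iff.2 h0)
      nlinarith
    · have h1 := cosh_sub_one_le_sq ht1
      have h2 : Real.sinh t - t ≤ 0 := sub_nonpos.2 (Real.sinh_le_self_iff.2 h0)
      nlinarith
  have hst : Real.sinh ‖S‖ * t =
      Real.sinh ‖S‖ / ‖S‖ * inner ℝ S z + Real.sinh ‖S‖ / ‖S‖ * ((‖z‖ ^ 2 - t ^ 2) / 2) := by
    have : ‖S‖ * t = inner ℝ S z + (‖z‖ ^ 2 - t ^ 2) / 2 := by nlinarith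
    rw [← mul_add, ← this]
    field_simp
  have hq : Real.sinh ‖S‖ / ‖S‖ ≤ Real.cosh ‖S‖ := by
    rw [div_le_iff₀ ha, mul_comm]
    exact sinh_le_mul_cosh ha.le
  have h3 : Real.sinh ‖S‖ / ‖S‖ * ((‖z‖ ^ 2 - t ^ 2) / 2) ≤
      Real.cosh ‖S‖ * ((‖z‖ ^ 2 - t ^ 2) / 2) :=
    mul_le_mul_of_nonneg_right hq (by linarith)
  rw [Real.cosh_add]
  nlinarith

lemma exp_le_add_exp_sq (x : ℝ) : Real.exp x ≤ x + Real.exp (x ^ 2) := by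
  have h2 := Real.add_one_le_exp (x ^ 2)
  rcases le_or_gt |x| 1 with h | h
  · have h1 := (abs_le.1 (Real.abs_exp_sub_one_sub_id_le h)).2
    linarith
  · rcases lt_abs.1 h with h | h
    · have : Real.exp x ≤ Real.exp (x ^ 2) := Real.exp_le_exp.2 (by nlinarith)
      linarith
    · have : Real.exp x ≤ 1 := Real.exp_le_one_iff.2 (by linarith)
      nlinarith

variable {ι X : Type*} [Fintype ι] [DecidableEq ι] [MeasurableSpace X]

/-- To compare two integrals over a product space it is enough to integrate out one coordinate. -/
lemma lintegral_pi_le_of_update {μ : ι → Measure X} [∀ i, SigmaFinite (μ i)]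
    {F G : (ι → X) → ENNReal} (hF : Measurable F) (hG : Measurable G) (k : ι)
    (h : ∀ x, ∫⁻ a, F (Function.update x k a) ∂μ k ≤ ∫⁻ a, G (Function.update x k a) ∂μ k) :
    ∫⁻ x, F x ∂Measure.pi μ ≤ ∫⁻ x, G x ∂Measure.pi μ := by
  refine lintegral_le_of_lmarginal_le {k} hF hG ?_
  rw [lmarginal_singleton, lmarginal_singleton]
  exact h

lemma lintegral_ofReal_le_of_le_integral {Y : Type*} [MeasurableSpace Y] {ν : Measure Y}
    {f g : Y → ℝ} (hg : Integrable g ν) (hg0 : 0 ≤ᵐ[ν] g) (hfg : f ≤ᵐ[ν] g) :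
    ∫⁻ a, ENNReal.ofReal (f a) ∂ν ≤ ENNReal.ofReal (∫ a, g a ∂ν) := by
  rw [ofReal_integral_eq_lintegral_ofReal hg hg0]
  exact lintegral_mono_ae (hfg.mono fun a h => ENNReal.ofReal_le_ofReal h)

variable {μ : ι → Measure X} [∀ i, IsProbabilityMeasure (μ i)]

/-- Exponential moment of a sum of bounded Hilbert space valued summands, each of which is centred
in its own coordinate when the others are frozen. -/
theorem lintegral_cosh_norm_sum_le {V : Type*} [NormedAddCommGroup V] [InnerProductSpace ℝ V]
    [MeasurableSpace V] [BorelSpace V] [SecondCountableTopology V] (S : Finset ι)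
    {z : ι → (ι → X) → V} {v : ℝ} (hz : ∀ k, Measurable (z k))
    (hb : ∀ k x, ‖z k x‖ ≤ 1)
    (hdep : ∀ k ∈ S, ∀ j ∈ S, j ≠ k → ∀ x a, z j (Function.update x k a) = z j x)
    (hmean : ∀ k ∈ S, ∀ x w, ∫ a, inner ℝ w (z k (Function.update x k a)) ∂μ k = 0)
    (hvar : ∀ k ∈ S, ∀ x, ∫ a, ‖z k (Function.update x k a)‖ ^ 2 ∂μ k ≤ v) :
    ∫⁻ x, ENNReal.ofReal (Real.cosh ‖∑ k ∈ S, z k x‖) ∂Measure.pi μ ≤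
      ENNReal.ofReal (Real.exp (S.card * v)) := by
  induction S using Finset.induction_on with
  | empty => simp
  | insert k S hk ih =>
    have ih := ih (fun k hk j hj => hdep k (Finset.mem_insert_of_mem hk) j
      (Finset.mem_insert_of_mem hj)) (fun k hk => hmean k (Finset.mem_insert_of_mem hk))
      (fun k hk => hvar k (Finset.mem_insert_of_mem hk))
    have hmS : Measurable fun x => ∑ j ∈ S, z j x := Finset.measurable_sum _ fun j _ => hz j
    have hmcosh : ∀ T : Finset ι,
        Measurable fun x => ENNReal.ofReal (Real.cosh ‖∑ j ∈ T, z j x‖) := fun T =>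
      ENNReal.measurable_ofReal.comp (Real.continuous_cosh.measurable.comp
        (Finset.measurable_sum _ fun j _ => hz j).norm)
    have step : ∫⁻ x, ENNReal.ofReal (Real.cosh ‖∑ j ∈ insert k S, z j x‖) ∂Measure.pi μ ≤
        ∫⁻ x, ENNReal.ofReal (Real.exp v) * ENNReal.ofReal (Real.cosh ‖∑ j ∈ S, z j x‖)
          ∂Measure.pi μ := by
      refine lintegral_pi_le_of_update (hmcosh _) ((hmcosh _).const_mul _) k fun x => ?_
      have hfix : ∀ a, ∑ j ∈ S, z j (Function.update x k a) = ∑ j ∈ S, z j x := fun a =>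
        Finset.sum_congr rfl fun j hj => hdep k (Finset.mem_insert_self _ _) j
          (Finset.mem_insert_of_mem hj) (ne_of_mem_of_not_mem hj hk) x a
      simp only [Finset.sum_insert hk, hfix]
      rw [lintegral_const, measure_univ, mul_one, ← ENNReal.ofReal_mul (Real.exp_pos _).le]
      set s := ∑ j ∈ S, z j x
      have hmz : Measurable fun a => z k (Function.update x k a) :=
        (hz k).comp (measurable_update x)
      have hi1 : Integrable (fun a => ‖z k (Function.update x k a)‖ ^ 2) (μ k) :=
        Integrable.of_bound (hmz.norm.pow_const 2).aestronglyMeasurable 1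
          (ae_of_all _ fun a => by
            rw [Real.norm_eq_abs, abs_of_nonneg (by positivity)]
            exact pow_le_one₀ (norm_nonneg _) (hb k _))
      have hi2 : Integrable (fun a => inner ℝ s (z k (Function.update x k a))) (μ k) :=
        Integrable.of_bound (hmz.const_inner (c := s)).aestronglyMeasurable ‖s‖
          (ae_of_all _ fun a => (norm_inner_le_norm _ _).trans
            (mul_le_of_le_one_right (norm_nonneg _) (hb k _)))
      have hi3 : Integrable (fun a => 1 + ‖z k (Function.update x k a)‖ ^ 2) (μ k) :=
        (integrable_const 1).add hi1
      have hle : ∀ a, Real.cosh ‖z k (Function.update x k a) + s‖ ≤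
          Real.cosh ‖s‖ * (1 + ‖z k (Function.update x k a)‖ ^ 2) +
            Real.sinh ‖s‖ / ‖s‖ * inner ℝ s (z k (Function.update x k a)) := fun a => by
        rw [add_comm]
        exact cosh_norm_add_le _ _ (hb k _)
      refine (lintegral_ofReal_le_of_le_integral
        ((hi3.const_mul _).add (hi2.const_mul _))
        (ae_of_all _ fun a => (Real.cosh_pos _).le.trans (hle a))
        (ae_of_all _ hle)).trans (ENNReal.ofReal_le_ofReal ?_)
      have h1 : ∫ a, ((Real.cosh ‖s‖ * (1 + ‖z k (Function.update x k a)‖ ^ 2)) +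
            Real.sinh ‖s‖ / ‖s‖ * inner ℝ s (z k (Function.update x k a))) ∂μ k =
          Real.cosh ‖s‖ * (1 + ∫ a, ‖z k (Function.update x k a)‖ ^ 2 ∂μ k) := by
        rw [integral_add (hi3.const_mul _) (hi2.const_mul _),
          integral_const_mul, integral_const_mul, hmean k (Finset.mem_insert_self _ _),
          integral_add (integrable_const 1) hi1]
        simp
      refine (le_of_eq h1).trans ?_
      rw [mul_comm]
      refine mul_le_mul_of_nonneg_right ?_ (Real.cosh_pos _).le
      have := hvar k (Finset.mem_insert_self _ _) x
      linarith [Real.add_one_le_exp v]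
    refine step.trans ?_
    rw [lintegral_const_mul _ (hmcosh S), Finset.card_insert_of_notMem hk]
    refine (mul_le_mul_right ih _).trans ?_
    rw [← ENNReal.ofReal_mul (Real.exp_pos _).le, ← Real.exp_add]
    refine ENNReal.ofReal_le_ofReal (Real.exp_le_exp.2 (le_of_eq ?_))
    push_cast
    ring

/-- Bernstein-type tail bound in a Hilbert space, in the moderate deviation range. -/
theorem measure_norm_sum_ge_le {V : Type*} [NormedAddCommGroup V] [InnerProductSpace ℝ V]
    [MeasurableSpace V] [BorelSpace V] [SecondCountableTopology V] (S : Finset ι)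
    {z : ι → (ι → X) → V} {b v W L : ℝ} (hW : 0 < W) (hbW : b ≤ √W)
    (hvW : S.card * v ≤ W) (hz : ∀ k, Measurable (z k)) (hb : ∀ k x, ‖z k x‖ ≤ b)
    (hdep : ∀ k ∈ S, ∀ j ∈ S, j ≠ k → ∀ x a, z j (Function.update x k a) = z j x)
    (hmean : ∀ k ∈ S, ∀ x w, ∫ a, inner ℝ w (z k (Function.update x k a)) ∂μ k = 0)
    (hvar : ∀ k ∈ S, ∀ x, ∫ a, ‖z k (Function.update x k a)‖ ^ 2 ∂μ k ≤ v) (hL : 0 ≤ L) :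
    Measure.pi μ {x | √W * L ≤ ‖∑ k ∈ S, z k x‖} ≤ ENNReal.ofReal (2 * Real.exp (1 - L)) := by
  have hsW : 0 < √W := Real.sqrt_pos.2 hW
  set z' : ι → (ι → X) → V := fun k x => (√W)⁻¹ • z k x with hz'
  have hn : ∀ k x, ‖z' k x‖ = (√W)⁻¹ * ‖z k x‖ := fun k x => by
    rw [hz', norm_smul, Real.norm_eq_abs, abs_of_pos (inv_pos.2 hsW)]
  have hmz' : ∀ k, Measurable (z' k) := fun k => (hz k).const_smul _
  have h1 := lintegral_cosh_norm_sum_le (μ := μ) S (z := z') (v := v / W) hmz'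
    (fun k x => by
      rw [hn, inv_mul_le_iff₀ hsW, mul_one]
      exact (hb k x).trans hbW)
    (fun k hk j hj hjk x a => by simp only [hz', hdep k hk j hj hjk])
    (fun k hk x w => by
      simp only [hz', real_inner_smul_right]
      rw [integral_const_mul, hmean k hk, mul_zero])
    (fun k hk x => by
      simp only [hn, mul_pow]
      rw [integral_const_mul, inv_pow, Real.sq_sqrt hW.le, div_eq_inv_mul]
      exact mul_le_mul_of_nonneg_left (hvar k hk x) (inv_nonneg.2 hW.le))
  have h2 : ENNReal.ofReal (Real.exp (S.card * (v / W))) ≤ ENNReal.ofReal (Real.exp 1) := by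
    refine ENNReal.ofReal_le_ofReal (Real.exp_le_exp.2 ?_)
    rw [← mul_div_assoc]
    exact (div_le_one hW).2 hvW
  have hmeas : Measurable fun x => ENNReal.ofReal (Real.cosh ‖∑ k ∈ S, z' k x‖) :=
    ENNReal.measurable_ofReal.comp (Real.continuous_cosh.measurable.comp
      (Finset.measurable_sum _ fun j _ => hmz' j).norm)
  have h3 := (mul_meas_ge_le_lintegral (μ := Measure.pi μ) hmeas
    (ENNReal.ofReal (Real.exp L / 2))).trans (h1.trans h2)
  have hsub : {x | √W * L ≤ ‖∑ k ∈ S, z k x‖} ⊆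
      {x | ENNReal.ofReal (Real.exp L / 2) ≤ ENNReal.ofReal (Real.cosh ‖∑ k ∈ S, z' k x‖)} := by
    intro x hx
    refine ENNReal.ofReal_le_ofReal ?_
    have h4 : L ≤ ‖∑ k ∈ S, z' k x‖ := by
      rw [hz', ← Finset.smul_sum, norm_smul, Real.norm_eq_abs, abs_of_pos (inv_pos.2 hsW),
        le_inv_mul_iff₀ hsW]
      exact hx
    have h5 : Real.cosh L ≤ Real.cosh ‖∑ k ∈ S, z' k x‖ := by
      rw [Real.cosh_le_cosh, abs_of_nonneg hL, abs_norm]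
      exact h4
    refine le_trans ?_ h5
    rw [Real.cosh_eq]
    linarith [Real.exp_pos (-L)]
  have h6 : ENNReal.ofReal (2 * Real.exp (1 - L)) =
      ENNReal.ofReal (Real.exp 1) / ENNReal.ofReal (Real.exp L / 2) := by
    rw [← ENNReal.ofReal_div_of_pos (by positivity), Real.exp_sub]
    congr 1
    field_simp
  rw [h6, ENNReal.le_div_iff_mul_le (Or.inl (by positivity)) (Or.inl ENNReal.ofReal_ne_top),
    mul_comm]
  exact (mul_le_mul_right (measure_mono hsub) _).trans h3

/-- Second moment of a sum of real summands, each of which is centred in its own coordinate when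
the others are frozen. -/
theorem lintegral_sq_sum_le (S : Finset ι) {z : ι → (ι → X) → ℝ} {v : (ι → X) → ℝ}
    (hz : ∀ k, Measurable (z k)) (hv : Measurable v) (hv0 : ∀ x, 0 ≤ v x)
    (hdep : ∀ k ∈ S, ∀ j ∈ S, j ≠ k → ∀ x a, z j (Function.update x k a) = z j x)
    (hvdep : ∀ k ∈ S, ∀ x a, v (Function.update x k a) = v x)
    (hint : ∀ k ∈ S, ∀ x, MemLp (fun a => z k (Function.update x k a)) 2 (μ k))
    (hmean : ∀ k ∈ S, ∀ x, ∫ a, z k (Function.update x k a) ∂μ k = 0)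
    (hvar : ∀ k ∈ S, ∀ x, ∫ a, z k (Function.update x k a) ^ 2 ∂μ k ≤ v x) :
    ∫⁻ x, ENNReal.ofReal ((∑ k ∈ S, z k x) ^ 2) ∂Measure.pi μ ≤
      S.card * ∫⁻ x, ENNReal.ofReal (v x) ∂Measure.pi μ := by
  induction S using Finset.induction_on with
  | empty => simp
  | insert k S hk ih =>
    have ih := ih (fun k hk j hj => hdep k (Finset.mem_insert_of_mem hk) j
      (Finset.mem_insert_of_mem hj)) (fun k hk => hvdep k (Finset.mem_insert_of_mem hk))
      (fun k hk => hint k (Finset.mem_insert_of_mem hk))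
      (fun k hk => hmean k (Finset.mem_insert_of_mem hk))
      (fun k hk => hvar k (Finset.mem_insert_of_mem hk))
    have hms : ∀ T : Finset ι, Measurable fun x => ENNReal.ofReal ((∑ j ∈ T, z j x) ^ 2) :=
      fun T => ENNReal.measurable_ofReal.comp
        ((Finset.measurable_sum _ fun j _ => hz j).pow_const 2)
    have hmv : Measurable fun x => ENNReal.ofReal (v x) := ENNReal.measurable_ofReal.comp hv
    have step : ∫⁻ x, ENNReal.ofReal ((∑ j ∈ insert k S, z j x) ^ 2) ∂Measure.pi μ ≤
        ∫⁻ x, (ENNReal.ofReal ((∑ j ∈ S, z j x) ^ 2) + ENNReal.ofReal (v x))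
          ∂Measure.pi μ := by
      refine lintegral_pi_le_of_update (hms _) ((hms _).add hmv) k fun x => ?_
      have hfix : ∀ a, ∑ j ∈ S, z j (Function.update x k a) = ∑ j ∈ S, z j x := fun a =>
        Finset.sum_congr rfl fun j hj => hdep k (Finset.mem_insert_self _ _) j
          (Finset.mem_insert_of_mem hj) (ne_of_mem_of_not_mem hj hk) x a
      simp only [Finset.sum_insert hk, hfix, hvdep k (Finset.mem_insert_self _ _)]
      rw [lintegral_const, measure_univ, mul_one, ← ENNReal.ofReal_add (sq_nonneg _) (hv0 x)]
      set s := ∑ j ∈ S, z j x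
      have hL := hint k (Finset.mem_insert_self _ _) x
      have hi1 := hL.integrable one_le_two
      have hi2 := hL.integrable_sq
      have hi3 : Integrable (fun a => 2 * s * z k (Function.update x k a) + s ^ 2) (μ k) :=
        (hi1.const_mul (2 * s)).add (integrable_const (s ^ 2))
      have hexp : ∀ a, (z k (Function.update x k a) + s) ^ 2 =
          z k (Function.update x k a) ^ 2 + (2 * s * z k (Function.update x k a) + s ^ 2) :=
        fun a => by ring
      refine (lintegral_ofReal_le_of_le_integral
        (hi2.add hi3)
        (ae_of_all _ fun a => ?_) (ae_of_all _ fun a => (hexp a).le)).trans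
        (ENNReal.ofReal_le_ofReal ?_)
      · exact (sq_nonneg _).trans (hexp a).le
      · have h1 : ∫ a, (z k (Function.update x k a) ^ 2 +
            (2 * s * z k (Function.update x k a) + s ^ 2)) ∂μ k =
            ∫ a, z k (Function.update x k a) ^ 2 ∂μ k + s ^ 2 := by
          rw [integral_add hi2 hi3,
            integral_add (hi1.const_mul (2 * s)) (integrable_const (s ^ 2)), integral_const_mul,
            hmean k (Finset.mem_insert_self _ _)]
          simp
        refine (le_of_eq h1).trans ?_
        linarith [hvar k (Finset.mem_insert_self _ _) x]
    refine step.trans ?_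
    rw [lintegral_add_right _ hmv, Finset.card_insert_of_notMem hk]
    push_cast
    rw [add_mul, one_mul]
    gcongr

/-- Exponential supermartingale for labels that are centred given the inputs: the coefficients
`t k` may depend on all inputs. -/
theorem lintegral_exp_sum_le_one {ν : ι → Measure (X × ℝ)} [∀ i, IsProbabilityMeasure (ν i)]
    {η : X → ℝ} (hη : Measurable η) (hbdd : ∀ i, ∀ᵐ a ∂ν i, |a.2 - η a.1| ≤ 2)
    (hreg : ∀ i, ∀ h : X → ℝ, Measurable h → (∃ c, ∀ a, |h a| ≤ c) →
      ∫ a, h a.1 * (a.2 - η a.1) ∂ν i = 0)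
    {t : ι → (ι → X) → ℝ} (ht : ∀ k, Measurable (t k)) {c : ℝ} (htb : ∀ k x, |t k x| ≤ c)
    (S : Finset ι) :
    ∫⁻ x, ENNReal.ofReal (Real.exp (∑ k ∈ S, (t k (fun i => (x i).1) * ((x k).2 - η (x k).1) -
      4 * t k (fun i => (x i).1) ^ 2))) ∂Measure.pi ν ≤ 1 := by
  induction S using Finset.induction_on with
  | empty => simp
  | insert k S hk ih =>
    refine le_trans ?_ ih
    have hfst : Measurable fun x : ι → X × ℝ => fun i => (x i).1 :=
      measurable_pi_lambda _ fun i => measurable_fst.comp (measurable_pi_apply i)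
    have hmf : ∀ T : Finset ι, Measurable fun x : ι → X × ℝ => ENNReal.ofReal (Real.exp
        (∑ k ∈ T, (t k (fun i => (x i).1) * ((x k).2 - η (x k).1) -
          4 * t k (fun i => (x i).1) ^ 2))) := fun T => by
      refine ENNReal.measurable_ofReal.comp (Real.measurable_exp.comp
        (Finset.measurable_sum _ fun j _ => ?_))
      have h1 : Measurable fun x : ι → X × ℝ => t j (fun i => (x i).1) := (ht j).comp hfst
      have h2 : Measurable fun x : ι → X × ℝ => (x j).2 - η (x j).1 :=
        (measurable_snd.comp (measurable_pi_apply j)).sub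
          (hη.comp (measurable_fst.comp (measurable_pi_apply j)))
      exact (h1.mul h2).sub ((h1.pow_const 2).const_mul 4)
    refine lintegral_pi_le_of_update (hmf _) (hmf _) k fun x => ?_
    set x' : X → ι → X := fun a => Function.update (fun i => (x i).1) k a with hx'
    have hmx' : Measurable x' := measurable_update _
    have hupd : ∀ a : X × ℝ, (fun i => (Function.update x k a i).1) = x' a.1 := fun a => by
      funext i
      by_cases h : i = k
      · subst h; simp [hx']
      · simp [hx', h]
    have hother : ∀ j ∈ S, ∀ a : X × ℝ, Function.update x k a j = x j := fun j hj a =>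
      Function.update_of_ne (ne_of_mem_of_not_mem hj hk) _ _
    -- the factor that does not involve the label number `k`
    set g : X → ℝ := fun a => Real.exp (∑ j ∈ S, (t j (x' a) * ((x j).2 - η (x j).1) -
      4 * t j (x' a) ^ 2)) with hg
    have hmt : ∀ j, Measurable fun a => t j (x' a) := fun j => (ht j).comp hmx'
    have hmg : Measurable g := Real.measurable_exp.comp (Finset.measurable_sum _ fun j _ =>
      ((hmt j).mul_const _).sub (((hmt j).pow_const 2).const_mul 4))
    have hc : 0 ≤ c := (abs_nonneg _).trans (htb k fun i => (x i).1)
    have hgb : ∀ a, |g a| ≤ Real.exp (∑ j ∈ S, c * |(x j).2 - η (x j).1|) := fun a => by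
      rw [hg, abs_of_pos (Real.exp_pos _)]
      refine Real.exp_le_exp.2 (Finset.sum_le_sum fun j _ => ?_)
      have h1 : t j (x' a) * ((x j).2 - η (x j).1) ≤ c * |(x j).2 - η (x j).1| := by
        refine (le_abs_self _).trans ?_
        rw [abs_mul]
        exact mul_le_mul_of_nonneg_right (htb _ _) (abs_nonneg _)
      nlinarith [sq_nonneg (t j (x' a))]
    set h : X → ℝ := fun a => g a * Real.exp (-(4 * t k (x' a) ^ 2)) * t k (x' a) with hh
    have hmh : Measurable h := (hmg.mul (Real.measurable_exp.comp
      (((hmt k).pow_const 2).const_mul 4).neg)).mul (hmt k)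
    have hhb : ∀ a, |h a| ≤ Real.exp (∑ j ∈ S, c * |(x j).2 - η (x j).1|) * 1 * c := fun a => by
      rw [hh, abs_mul, abs_mul]
      gcongr
      · exact hgb a
      · rw [abs_of_pos (Real.exp_pos _), Real.exp_le_one_iff]
        nlinarith [sq_nonneg (t k (x' a))]
      · exact htb _ _
    have hL : ∀ a : X × ℝ, ∑ j ∈ insert k S, (t j (fun i => (Function.update x k a i).1) *
        ((Function.update x k a j).2 - η (Function.update x k a j).1) -
          4 * t j (fun i => (Function.update x k a i).1) ^ 2) =
        (t k (x' a.1) * (a.2 - η a.1) - 4 * t k (x' a.1) ^ 2) +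
        ∑ j ∈ S, (t j (x' a.1) * ((x j).2 - η (x j).1) - 4 * t j (x' a.1) ^ 2) := fun a => by
      rw [Finset.sum_insert hk, hupd a, Function.update_self]
      congr 1
      exact Finset.sum_congr rfl fun j hj => by rw [hother j hj a]
    have hR : ∀ a : X × ℝ, ∑ j ∈ S, (t j (fun i => (Function.update x k a i).1) *
        ((Function.update x k a j).2 - η (Function.update x k a j).1) -
          4 * t j (fun i => (Function.update x k a i).1) ^ 2) =
        ∑ j ∈ S, (t j (x' a.1) * ((x j).2 - η (x j).1) - 4 * t j (x' a.1) ^ 2) := fun a => by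
      rw [hupd a]
      exact Finset.sum_congr rfl fun j hj => by rw [hother j hj a]
    simp only [hL, hR, Real.exp_add]
    have hig : Integrable (fun a : X × ℝ => g a.1) (ν k) :=
      Integrable.of_bound (hmg.comp measurable_fst).aestronglyMeasurable _
        (ae_of_all _ fun a => hgb a.1)
    have hih : Integrable (fun a : X × ℝ => h a.1 * (a.2 - η a.1)) (ν k) := by
      refine Integrable.of_bound ((hmh.comp measurable_fst).mul
        (measurable_snd.sub (hη.comp measurable_fst))).aestronglyMeasurable
        (Real.exp (∑ j ∈ S, c * |(x j).2 - η (x j).1|) * 1 * c * 2) ?_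
      filter_upwards [hbdd k] with a ha
      rw [Real.norm_eq_abs, abs_mul]
      exact mul_le_mul (hhb _) ha (abs_nonneg _) ((abs_nonneg _).trans (hhb a.1))
    have hpt : ∀ᵐ a ∂ν k, Real.exp (t k (x' a.1) * (a.2 - η a.1) - 4 * t k (x' a.1) ^ 2) *
        g a.1 ≤ g a.1 + h a.1 * (a.2 - η a.1) := by
      filter_upwards [hbdd k] with a ha
      set τ := t k (x' a.1)
      have h1 := exp_le_add_exp_sq (τ * (a.2 - η a.1))
      have h2 : Real.exp ((τ * (a.2 - η a.1)) ^ 2) ≤ Real.exp (4 * τ ^ 2) := by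
        refine Real.exp_le_exp.2 ?_
        have : (a.2 - η a.1) ^ 2 ≤ 2 ^ 2 := by rw [← sq_abs]; gcongr
        rw [mul_pow]
        nlinarith [sq_nonneg τ]
      have h3 : Real.exp (-(4 * τ ^ 2)) * Real.exp (4 * τ ^ 2) = 1 := by
        rw [← Real.exp_add]; simp
      have h4 : Real.exp (τ * (a.2 - η a.1) - 4 * τ ^ 2) ≤
          Real.exp (-(4 * τ ^ 2)) * τ * (a.2 - η a.1) + 1 := by
        rw [sub_eq_neg_add, Real.exp_add]
        have := mul_le_mul_of_nonneg_left (h1.trans (add_le_add_right h2 _))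
          (Real.exp_pos (-(4 * τ ^ 2))).le
        rw [mul_add, h3] at this
        linarith
      have h5 := mul_le_mul_of_nonneg_right h4 (Real.exp_pos _ : 0 < g a.1).le
      refine h5.trans (le_of_eq ?_)
      simp only [hh]
      ring
    refine (lintegral_ofReal_le_of_le_integral (hig.add hih) ?_ hpt).trans ?_
    · filter_upwards [hpt] with a ha
      exact (mul_pos (Real.exp_pos _) (Real.exp_pos _)).le.trans ha
    · have h0 : ∫ a, (g a.1 + h a.1 * (a.2 - η a.1)) ∂ν k = ∫ a, g a.1 ∂ν k := by
        rw [integral_add hig hih, hreg k h hmh ⟨_, hhb⟩, add_zero]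
      refine (le_of_eq (congrArg ENNReal.ofReal h0)).trans ?_
      rw [ofReal_integral_eq_lintegral_ofReal hig (ae_of_all _ fun a => (Real.exp_pos _).le)]

end Tools

/-! ### The scatter matrix of a bounded isotropic feature map -/

section Gram

open Matrix

variable {J : Type*} [Fintype J]

lemma trace_transpose_mul_self_nonneg (C : Matrix J J ℝ) : 0 ≤ (Cᵀ * C).trace := by
  simp only [trace, diag_apply, mul_apply, transpose_apply]
  exact Finset.sum_nonneg fun i _ => Finset.sum_nonneg fun j _ => mul_self_nonneg _

variable [DecidableEq J]

/-- Expansion of the fourth moment of a sum of symmetric matrices. In the commutative case the terms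
are those of the binomial formula, the term `4 S H³` being absorbed into its two neighbours. -/
lemma trace_add_pow_four_le {S H : Matrix J J ℝ} (hS : Sᵀ = S) (hH : Hᵀ = H) :
    ((S + H) ^ 4).trace ≤ (S ^ 4).trace + 4 * (S ^ 3 * H).trace + 8 * (S ^ 2 * H ^ 2).trace +
      3 * (H ^ 4).trace := by
  have e1 : ((S + H) ^ 4).trace = (S ^ 4).trace + (H ^ 4).trace + 4 * (S ^ 3 * H).trace +
      4 * (S * H ^ 3).trace + 4 * (S ^ 2 * H ^ 2).trace + 2 * (S * H * (S * H)).trace := by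
    have h1 : (S + H) ^ 4 = S * S * S * S + S * S * S * H + S * S * H * S + S * S * H * H +
        S * H * S * S + S * H * S * H + S * H * H * S + S * H * H * H +
        H * S * S * S + H * S * S * H + H * S * H * S + H * S * H * H +
        H * H * S * S + H * H * S * H + H * H * H * S + H * H * H * H := by
      noncomm_ring
    rw [h1]
    simp only [trace_add]
    have c1 : (S * S * H * S).trace = (S * S * S * H).trace := by
      rw [trace_mul_comm (S * S * H) S]; simp only [Matrix.mul_assoc]
    have c2 : (S * H * S * S).trace = (S * S * S * H).trace := by
      rw [Matrix.mul_assoc (S * H), trace_mul_comm]; simp only [Matrix.mul_assoc]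
    have c3 : (H * S * S * S).trace = (S * S * S * H).trace := by
      rw [Matrix.mul_assoc H, Matrix.mul_assoc H, trace_mul_comm]
    have c4 : (S * H * H * S).trace = (S * S * H * H).trace := by
      rw [trace_mul_comm _ S]; simp only [Matrix.mul_assoc]
    have c5 : (H * S * S * H).trace = (S * S * H * H).trace := by
      rw [Matrix.mul_assoc H, Matrix.mul_assoc H, trace_mul_comm]
    have c6 : (H * H * S * S).trace = (S * S * H * H).trace := by
      rw [Matrix.mul_assoc (H * H), trace_mul_comm]; simp only [Matrix.mul_assoc]
    have c7 : (H * S * H * S).trace = (S * H * S * H).trace := by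
      rw [trace_mul_comm _ S]; simp only [Matrix.mul_assoc]
    have c8 : (H * S * H * H).trace = (S * H * H * H).trace := by
      rw [Matrix.mul_assoc H, Matrix.mul_assoc H, trace_mul_comm]
    have c9 : (H * H * S * H).trace = (S * H * H * H).trace := by
      rw [Matrix.mul_assoc (H * H), trace_mul_comm]; simp only [Matrix.mul_assoc]
    have c10 : (H * H * H * S).trace = (S * H * H * H).trace := by
      rw [trace_mul_comm _ S]; simp only [Matrix.mul_assoc]
    rw [c1, c2, c3, c4, c5, c6, c7, c8, c9, c10]
    simp only [pow_succ, pow_zero, Matrix.one_mul, Matrix.mul_assoc]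
    ring
  -- `S H S H` has smaller trace than `S² H²` since the commutator is antisymmetric
  have e2 : (S * H * (S * H)).trace ≤ (S ^ 2 * H ^ 2).trace := by
    have h1 := trace_transpose_mul_self_nonneg (S * H - H * S)
    rw [transpose_sub, transpose_mul, transpose_mul, hS, hH] at h1
    have h2 : (H * S - S * H) * (S * H - H * S) =
        H * S * S * H - H * S * H * S - S * H * (S * H) + S * H * H * S := by
      noncomm_ring
    have c5 : (H * S * S * H).trace = (S ^ 2 * H ^ 2).trace := by
      rw [Matrix.mul_assoc H, Matrix.mul_assoc H, trace_mul_comm]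
      simp only [pow_two, Matrix.mul_assoc]
    have c4 : (S * H * H * S).trace = (S ^ 2 * H ^ 2).trace := by
      rw [trace_mul_comm _ S]; simp only [pow_two, Matrix.mul_assoc]
    have c7 : (H * S * H * S).trace = (S * H * (S * H)).trace := by
      rw [trace_mul_comm _ S]; simp only [Matrix.mul_assoc]
    rw [h2, trace_add, trace_sub, trace_sub, c4, c5, c7] at h1
    linarith
  have e3 : 2 * (S * H ^ 3).trace ≤ (S ^ 2 * H ^ 2).trace + (H ^ 4).trace := by
    have h1 := trace_transpose_mul_self_nonneg (S * H - H * H)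
    rw [transpose_sub, transpose_mul, transpose_mul, hS, hH] at h1
    have h2 : (H * S - H * H) * (S * H - H * H) =
        H * S * S * H - H * S * H * H - H * H * S * H + H ^ 4 := by
      noncomm_ring
    have c5 : (H * S * S * H).trace = (S ^ 2 * H ^ 2).trace := by
      rw [Matrix.mul_assoc H, Matrix.mul_assoc H, trace_mul_comm]
      simp only [pow_two, Matrix.mul_assoc]
    have c8 : (H * S * H * H).trace = (S * H ^ 3).trace := by
      rw [Matrix.mul_assoc H, Matrix.mul_assoc H, trace_mul_comm]
      simp only [pow_succ, pow_zero, Matrix.one_mul, Matrix.mul_assoc]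
    have c9 : (H * H * S * H).trace = (S * H ^ 3).trace := by
      rw [Matrix.mul_assoc (H * H), trace_mul_comm]
      simp only [pow_succ, pow_zero, Matrix.one_mul, Matrix.mul_assoc]
    rw [h2, trace_add, trace_sub, trace_sub, c5, c8, c9] at h1
    linarith
  rw [e1]
  linarith

/-- The quadratic form of a symmetric matrix is controlled by the trace of the fourth power. -/
lemma dotProduct_mulVec_pow_four_le {S : Matrix J J ℝ} (hS : Sᵀ = S) (v : J → ℝ) :
    (v ⬝ᵥ S *ᵥ v) ^ 4 ≤ (S ^ 4).trace * (v ⬝ᵥ v) ^ 4 := by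
  have cs : ∀ u w : J → ℝ, (u ⬝ᵥ w) ^ 2 ≤ (u ⬝ᵥ u) * (w ⬝ᵥ w) := fun u w => by
    have := Finset.sum_mul_sq_le_sq_mul_sq Finset.univ u w
    simpa [dotProduct, pow_two] using this
  have nn : ∀ u : J → ℝ, 0 ≤ u ⬝ᵥ u := fun u =>
    Finset.sum_nonneg fun i _ => mul_self_nonneg _
  have sym : ∀ u w : J → ℝ, (S *ᵥ u) ⬝ᵥ w = u ⬝ᵥ (S *ᵥ w) := fun u w => by
    rw [dotProduct_mulVec, ← mulVec_transpose, hS]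
  set w := S *ᵥ (S *ᵥ v) with hw
  have h1 := cs v (S *ᵥ v)
  have h2 := cs v w
  have h3 : (S *ᵥ v) ⬝ᵥ (S *ᵥ v) = v ⬝ᵥ w := by rw [sym]
  have h4 : w ⬝ᵥ w ≤ (S ^ 4).trace * (v ⬝ᵥ v) := by
    have e1 : (S ^ 4).trace = ∑ i, (fun j => (S ^ 2) i j) ⬝ᵥ (fun j => (S ^ 2) i j) := by
      have : S ^ 4 = S ^ 2 * (S ^ 2)ᵀ := by
        rw [transpose_pow, hS, ← pow_add]
      rw [this]
      simp only [trace, diag_apply, mul_apply, transpose_apply, dotProduct]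
    have e2 : w = (S ^ 2) *ᵥ v := by rw [hw, mulVec_mulVec, pow_two]
    rw [e1, e2, Finset.sum_mul]
    refine Finset.sum_le_sum fun i _ => ?_
    have := cs (fun j => (S ^ 2) i j) v
    rw [pow_two] at this
    exact this
  have h5 : (v ⬝ᵥ w) ^ 2 ≤ (S ^ 4).trace * (v ⬝ᵥ v) ^ 2 := by
    nlinarith [nn v, mul_le_mul_of_nonneg_left h4 (nn v)]
  have h6 : ((v ⬝ᵥ S *ᵥ v) ^ 2) ^ 2 ≤ ((v ⬝ᵥ v) * (v ⬝ᵥ w)) ^ 2 := by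
    rw [h3] at h1
    exact pow_le_pow_left₀ (sq_nonneg _) h1 2
  calc (v ⬝ᵥ S *ᵥ v) ^ 4 = ((v ⬝ᵥ S *ᵥ v) ^ 2) ^ 2 := by ring
    _ ≤ (v ⬝ᵥ v) ^ 2 * (v ⬝ᵥ w) ^ 2 := by rw [← mul_pow]; exact h6
    _ ≤ (v ⬝ᵥ v) ^ 2 * ((S ^ 4).trace * (v ⬝ᵥ v) ^ 2) := by gcongr
    _ = _ := by ring

variable {X : Type*} [MeasurableSpace X]

/-- A bounded isotropic feature map: `‖φ‖² ≤ B` everywhere, and the second moment matrix of `φ`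
under `μ` is the identity. -/
structure IsBoundedIsotropic (μ : Measure X) (B : ℝ) (φ : X → EuclideanSpace ℝ J) : Prop where
  measurable : Measurable φ
  norm_sq_le : ∀ a, ‖φ a‖ ^ 2 ≤ B
  isotropic : ∀ i j, ∫ a, φ a i * φ a j ∂μ = if i = j then 1 else 0

/-- The centred rank-one matrix `φ φᵀ - 1`. -/
noncomputable def centredOuter (u : J → ℝ) : Matrix J J ℝ := vecMulVec u u - 1

omit [Fintype J] in
lemma transpose_centredOuter (u : J → ℝ) : (centredOuter u)ᵀ = centredOuter u := by
  simp [centredOuter, transpose_vecMulVec]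

lemma trace_mul_centredOuter (M : Matrix J J ℝ) (u : J → ℝ) :
    (M * centredOuter u).trace = (M *ᵥ u) ⬝ᵥ u - M.trace := by
  rw [centredOuter, mul_sub, mul_one, trace_sub, mul_vecMulVec, trace_vecMulVec]

lemma centredOuter_sq (u : J → ℝ) :
    centredOuter u ^ 2 = (u ⬝ᵥ u - 2) • vecMulVec u u + 1 := by
  rw [pow_two, centredOuter, mul_sub, sub_mul, vecMulVec_mul_vecMulVec, mul_one, one_mul,
    sub_smul, two_smul, vecMulVec_smul]
  abel

lemma trace_mul_centredOuter_sq (M : Matrix J J ℝ) (u : J → ℝ) :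
    (M * centredOuter u ^ 2).trace = (u ⬝ᵥ u - 2) * ((M *ᵥ u) ⬝ᵥ u) + M.trace := by
  rw [centredOuter_sq, mul_add, mul_one, trace_add, Matrix.mul_smul, trace_smul, mul_vecMulVec,
    trace_vecMulVec, smul_eq_mul]

lemma trace_centredOuter_sq (u : J → ℝ) :
    (centredOuter u ^ 2).trace = (u ⬝ᵥ u - 2) * (u ⬝ᵥ u) + Fintype.card J := by
  have := trace_mul_centredOuter_sq 1 u
  simpa using this

lemma trace_centredOuter_pow_four (u : J → ℝ) :
    (centredOuter u ^ 4).trace =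
      ((u ⬝ᵥ u - 2) * (u ⬝ᵥ u)) ^ 2 + 2 * ((u ⬝ᵥ u - 2) * (u ⬝ᵥ u)) + Fintype.card J := by
  have h : centredOuter u ^ 4 = centredOuter u ^ 2 * centredOuter u ^ 2 := by rw [← pow_add]
  rw [h, trace_mul_centredOuter_sq, trace_centredOuter_sq, centredOuter_sq, add_mulVec,
    smul_mulVec, vecMulVec_mulVec, one_mulVec, add_dotProduct, smul_dotProduct]
  simp
  ring

lemma abs_le_of_pow_four_le {a b : ℝ} (hb : 0 ≤ b) (h : a ^ 4 ≤ b ^ 4) : |a| ≤ b := by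
  have h1 : |a| ^ 4 ≤ b ^ 4 := by rwa [pow_abs, abs_of_nonneg (by positivity)]
  exact (pow_le_pow_iff_left₀ (abs_nonneg a) hb (by norm_num)).1 h1

omit [DecidableEq J] in
lemma inner_eq_dotProduct (u v : EuclideanSpace ℝ J) : inner ℝ u v = u.ofLp ⬝ᵥ v.ofLp := by
  rw [PiLp.inner_apply, dotProduct]
  exact Finset.sum_congr rfl fun i _ => by simp [mul_comm]

namespace IsBoundedIsotropic

variable {μ : Measure X} [IsProbabilityMeasure μ] {B : ℝ} {φ : X → EuclideanSpace ℝ J}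

omit [IsProbabilityMeasure μ] in
lemma dotProduct_self_le (h : IsBoundedIsotropic μ B φ) (a : X) :
    (φ a).ofLp ⬝ᵥ (φ a).ofLp ≤ B := by
  rw [← inner_eq_dotProduct, real_inner_self_eq_norm_sq]
  exact h.norm_sq_le a

omit [IsProbabilityMeasure μ] in
lemma measurable_apply (h : IsBoundedIsotropic μ B φ) (i : J) : Measurable fun a => φ a i :=
  (EuclideanSpace.proj (𝕜 := ℝ) i).continuous.measurable.comp h.measurable

lemma integrable_mul (h : IsBoundedIsotropic μ B φ) (i j : J) :
    Integrable (fun a => φ a i * φ a j) μ := by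
  refine Integrable.of_bound
    ((h.measurable_apply i).mul (h.measurable_apply j)).aestronglyMeasurable B
    (ae_of_all _ fun a => ?_)
  rw [norm_mul]
  calc ‖φ a i‖ * ‖φ a j‖ ≤ ‖φ a‖ * ‖φ a‖ := by
        gcongr <;> exact PiLp.norm_apply_le _ _
    _ ≤ B := by rw [← pow_two]; exact h.norm_sq_le a

omit [DecidableEq J] in
lemma mulVec_dotProduct_eq (M : Matrix J J ℝ) (u : J → ℝ) :
    (M *ᵥ u) ⬝ᵥ u = ∑ i, ∑ j, M i j * (u j * u i) := by
  simp only [dotProduct, mulVec, Finset.sum_mul, mul_assoc]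

lemma integrable_quadratic (h : IsBoundedIsotropic μ B φ) (M : Matrix J J ℝ) :
    Integrable (fun a => (M *ᵥ (φ a).ofLp) ⬝ᵥ (φ a).ofLp) μ := by
  simp only [mulVec_dotProduct_eq]
  exact integrable_finsetSum _ fun i _ => integrable_finsetSum _ fun j _ =>
    (h.integrable_mul j i).const_mul _

lemma integral_quadratic (h : IsBoundedIsotropic μ B φ) (M : Matrix J J ℝ) :
    ∫ a, (M *ᵥ (φ a).ofLp) ⬝ᵥ (φ a).ofLp ∂μ = M.trace := by
  have key : ∀ c : J → J → ℝ, ∫ a, ∑ i, ∑ j, c i j * (φ a j * φ a i) ∂μ = ∑ i, c i i := fun c => by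
    rw [integral_finsetSum _ fun i _ => integrable_finsetSum _ fun j _ =>
      (h.integrable_mul j i).const_mul _]
    refine Finset.sum_congr rfl fun i _ => ?_
    rw [integral_finsetSum _ fun j _ => (h.integrable_mul j i).const_mul _]
    simp only [integral_const_mul, h.isotropic]
    simp
  simp only [mulVec_dotProduct_eq]
  exact key fun i j => M i j

lemma integrable_inner_mul_inner (h : IsBoundedIsotropic μ B φ) (v w : EuclideanSpace ℝ J) :
    Integrable (fun a => inner ℝ v (φ a) * inner ℝ w (φ a)) μ := by
  have := h.integrable_quadratic (vecMulVec w.ofLp v.ofLp)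
  simpa [vecMulVec_mulVec, inner_eq_dotProduct, smul_dotProduct] using this

lemma integral_inner_mul_inner (h : IsBoundedIsotropic μ B φ) (v w : EuclideanSpace ℝ J) :
    ∫ a, inner ℝ v (φ a) * inner ℝ w (φ a) ∂μ = inner ℝ v w := by
  have := h.integral_quadratic (vecMulVec w.ofLp v.ofLp)
  rw [trace_vecMulVec, ← inner_eq_dotProduct, real_inner_comm] at this
  simpa [vecMulVec_mulVec, inner_eq_dotProduct, smul_dotProduct] using this

lemma card_le (h : IsBoundedIsotropic μ B φ) : (Fintype.card J : ℝ) ≤ B := by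
  have h1 := h.integral_quadratic 1
  have h2 := integral_mono (h.integrable_quadratic 1) (integrable_const B) fun a => by
    simpa using h.dotProduct_self_le a
  rw [h1] at h2
  simpa using h2

end IsBoundedIsotropic

variable {ι : Type*} [Fintype ι] [DecidableEq ι] {μ : Measure X} [IsProbabilityMeasure μ] {B : ℝ}
  {φ : X → EuclideanSpace ℝ J}

/-- The centred scatter matrix of the sample points with indices in `T`. -/
noncomputable def centredScatter (φ : X → EuclideanSpace ℝ J) (T : Finset ι) (x : ι → X) :
    Matrix J J ℝ :=
  ∑ k ∈ T, centredOuter (φ (x k)).ofLp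

omit [Fintype J] [MeasurableSpace X] [Fintype ι] [DecidableEq ι] in
lemma transpose_centredScatter (T : Finset ι) (x : ι → X) :
    (centredScatter φ T x)ᵀ = centredScatter φ T x := by
  simp [centredScatter, transpose_sum, transpose_centredOuter]

omit [DecidableEq ι] in
lemma measurable_trace_centredScatter_pow (hφ : Measurable φ) (T : Finset ι) (m : ℕ) :
    Measurable fun x : ι → X => (centredScatter φ T x ^ m).trace := by
  have hc : Continuous fun u : ι → EuclideanSpace ℝ J =>
      ((∑ k ∈ T, centredOuter (u k).ofLp) ^ m).trace := by
    refine Continuous.matrix_trace (Continuous.pow (continuous_finsetSum _ fun k _ => ?_) m)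
    unfold centredOuter
    refine Continuous.sub (Continuous.matrix_vecMulVec ?_ ?_) continuous_const <;> fun_prop
  exact hc.measurable.comp
    (measurable_pi_lambda _ fun k => hφ.comp (measurable_pi_apply k))

lemma trace_pow_even_nonneg {S : Matrix J J ℝ} (hS : Sᵀ = S) (m : ℕ) :
    0 ≤ (S ^ (m + m)).trace := by
  have := trace_transpose_mul_self_nonneg (S ^ m)
  rwa [transpose_pow, hS, ← pow_add] at this

omit [Fintype J] [MeasurableSpace X] [Fintype ι] in
lemma centredScatter_update {k : ι} {T : Finset ι} (hk : k ∉ T) (x : ι → X) (a : X) :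
    centredScatter φ (insert k T) (Function.update x k a) =
      centredScatter φ T x + centredOuter (φ a).ofLp := by
  rw [centredScatter, Finset.sum_insert hk, Function.update_self, add_comm, centredScatter]
  congr 1
  exact Finset.sum_congr rfl fun j hj => by
    rw [Function.update_of_ne (ne_of_mem_of_not_mem hj hk)]

omit [Fintype J] [MeasurableSpace X] [Fintype ι] in
lemma centredScatter_update_of_notMem {k : ι} {T : Finset ι} (hk : k ∉ T) (x : ι → X) (a : X) :
    centredScatter φ T (Function.update x k a) = centredScatter φ T x :=
  Finset.sum_congr rfl fun j hj => by
    rw [Function.update_of_ne (ne_of_mem_of_not_mem hj hk)]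

lemma lintegral_trace_sq_le (h : IsBoundedIsotropic μ B φ) (hB : 1 ≤ B) (T : Finset ι) :
    ∫⁻ x, ENNReal.ofReal (centredScatter φ T x ^ 2).trace ∂Measure.pi (fun _ : ι => μ) ≤
      ENNReal.ofReal (T.card * (2 * B ^ 2)) := by
  induction T using Finset.induction_on with
  | empty => simp [centredScatter]
  | insert k T hk ih =>
    have hm : ∀ T : Finset ι, Measurable fun x : ι → X =>
        ENNReal.ofReal (centredScatter φ T x ^ 2).trace := fun T =>
      ENNReal.measurable_ofReal.comp (measurable_trace_centredScatter_pow h.measurable T 2)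
    have step : ∫⁻ x, ENNReal.ofReal (centredScatter φ (insert k T) x ^ 2).trace
          ∂Measure.pi (fun _ : ι => μ) ≤
        ∫⁻ x, (ENNReal.ofReal (centredScatter φ T x ^ 2).trace + ENNReal.ofReal (2 * B ^ 2))
          ∂Measure.pi (fun _ : ι => μ) := by
      refine lintegral_pi_le_of_update (hm _) ((hm _).add_const _) k fun x => ?_
      simp only [centredScatter_update hk, centredScatter_update_of_notMem hk]
      have hS := transpose_centredScatter (φ := φ) T x
      set S := centredScatter φ T x
      have hS2 : 0 ≤ (S ^ 2).trace := trace_pow_even_nonneg hS 1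
      rw [lintegral_const, measure_univ, mul_one, ← ENNReal.ofReal_add hS2 (by positivity)]
      have hpt : ∀ a, ((S + centredOuter (φ a).ofLp) ^ 2).trace ≤
          (S ^ 2).trace + 2 * B ^ 2 - 2 * S.trace +
            2 * ((S *ᵥ (φ a).ofLp) ⬝ᵥ (φ a).ofLp) := fun a => by
        have e : (S + centredOuter (φ a).ofLp) ^ 2 = S ^ 2 + S * centredOuter (φ a).ofLp +
            centredOuter (φ a).ofLp * S + centredOuter (φ a).ofLp ^ 2 := by noncomm_ring
        rw [e, trace_add, trace_add, trace_add, trace_mul_comm (centredOuter _) S,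
          trace_mul_centredOuter, trace_centredOuter_sq]
        have h1 := h.dotProduct_self_le a
        have h2 := h.card_le
        have h3 : 0 ≤ (φ a).ofLp ⬝ᵥ (φ a).ofLp :=
          Finset.sum_nonneg fun i _ => mul_self_nonneg _
        nlinarith
      have hi := (h.integrable_quadratic S).const_mul 2
      refine (lintegral_ofReal_le_of_le_integral ((integrable_const _).add hi)
        (ae_of_all _ fun a => ?_) (ae_of_all _ hpt)).trans (ENNReal.ofReal_le_ofReal ?_)
      · exact (trace_pow_even_nonneg (by
          rw [transpose_add, hS, transpose_centredOuter]) 1).trans (hpt a)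
      · refine (integral_add (integrable_const _) hi).le.trans ?_
        rw [integral_const_mul, h.integral_quadratic]
        simp
    refine step.trans ?_
    rw [lintegral_add_right _ measurable_const, Finset.card_insert_of_notMem hk]
    simp only [lintegral_const, measure_univ, mul_one]
    refine (add_le_add_left ih _).trans ?_
    rw [← ENNReal.ofReal_add (by positivity) (by positivity)]
    refine ENNReal.ofReal_le_ofReal (le_of_eq ?_)
    push_cast
    ring

/-- The fourth moment of the centred scatter matrix: `n² B³` up to a constant, the order
predicted by the central limit theorem. -/
lemma lintegral_trace_pow_four_le (h : IsBoundedIsotropic μ B φ) (hB : 1 ≤ B) (T : Finset ι) :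
    ∫⁻ x, ENNReal.ofReal (centredScatter φ T x ^ 4).trace ∂Measure.pi (fun _ : ι => μ) ≤
      ENNReal.ofReal (T.card * (16 * B ^ 3 * Fintype.card ι + 12 * B ^ 4)) := by
  induction T using Finset.induction_on with
  | empty => simp [centredScatter]
  | insert k T hk ih =>
    have hm : ∀ (T : Finset ι) (m : ℕ), Measurable fun x : ι → X =>
        ENNReal.ofReal (centredScatter φ T x ^ m).trace := fun T m =>
      ENNReal.measurable_ofReal.comp (measurable_trace_centredScatter_pow h.measurable T m)
    have step : ∫⁻ x, ENNReal.ofReal (centredScatter φ (insert k T) x ^ 4).trace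
          ∂Measure.pi (fun _ : ι => μ) ≤
        ∫⁻ x, (ENNReal.ofReal (centredScatter φ T x ^ 4).trace +
          (ENNReal.ofReal (8 * B) * ENNReal.ofReal (centredScatter φ T x ^ 2).trace +
            ENNReal.ofReal (12 * B ^ 4))) ∂Measure.pi (fun _ : ι => μ) := by
      refine lintegral_pi_le_of_update (hm _ 4)
        ((hm _ 4).add (((hm _ 2).const_mul _).add_const _)) k fun x => ?_
      simp only [centredScatter_update hk, centredScatter_update_of_notMem hk]
      have hS := transpose_centredScatter (φ := φ) T x
      set S := centredScatter φ T x
      have hS2 : 0 ≤ (S ^ 2).trace := trace_pow_even_nonneg hS 1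
      have hS4 : 0 ≤ (S ^ 4).trace := trace_pow_even_nonneg hS 2
      rw [lintegral_const, measure_univ, mul_one, ← ENNReal.ofReal_mul (by positivity),
        ← ENNReal.ofReal_add (by positivity) (by positivity),
        ← ENNReal.ofReal_add (by positivity) (by positivity)]
      have hpt : ∀ a, ((S + centredOuter (φ a).ofLp) ^ 4).trace ≤
          ((S ^ 4).trace - 4 * (S ^ 3).trace + 8 * (S ^ 2).trace + 12 * B ^ 4) +
            (4 * ((S ^ 3 *ᵥ (φ a).ofLp) ⬝ᵥ (φ a).ofLp) +
              8 * (B - 2) * ((S ^ 2 *ᵥ (φ a).ofLp) ⬝ᵥ (φ a).ofLp)) := fun a => by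
        refine (trace_add_pow_four_le hS (transpose_centredOuter _)).trans ?_
        rw [trace_mul_centredOuter, trace_mul_centredOuter_sq, trace_centredOuter_pow_four]
        have h1 := h.dotProduct_self_le a
        have h2 := h.card_le
        set u := (φ a).ofLp
        have h3 : 0 ≤ u ⬝ᵥ u := Finset.sum_nonneg fun i _ => mul_self_nonneg _
        have h4 : 0 ≤ (S ^ 2 *ᵥ u) ⬝ᵥ u := by
          have : (S ^ 2 *ᵥ u) ⬝ᵥ u = (S *ᵥ u) ⬝ᵥ (S *ᵥ u) := by
            rw [pow_two, ← mulVec_mulVec, dotProduct_mulVec (S *ᵥ u), ← mulVec_transpose, hS]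
          rw [this]
          exact Finset.sum_nonneg fun i _ => mul_self_nonneg _
        have h5 : (u ⬝ᵥ u - 2) * ((S ^ 2 *ᵥ u) ⬝ᵥ u) ≤ (B - 2) * ((S ^ 2 *ᵥ u) ⬝ᵥ u) := by
          gcongr
        have h6 : (u ⬝ᵥ u - 2) * (u ⬝ᵥ u) ≤ B ^ 2 := by nlinarith
        have h7 : -B ^ 2 ≤ (u ⬝ᵥ u - 2) * (u ⬝ᵥ u) := by nlinarith [sq_nonneg (u ⬝ᵥ u - 1)]
        have h8 : ((u ⬝ᵥ u - 2) * (u ⬝ᵥ u)) ^ 2 ≤ (B ^ 2) ^ 2 := sq_le_sq' h7 h6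
        have h9 : B ^ 2 ≤ B ^ 4 := pow_le_pow_right₀ hB (by norm_num)
        have h10 : B ≤ B ^ 4 := le_self_pow₀ hB (by norm_num)
        nlinarith
      have hi3 := (h.integrable_quadratic (S ^ 3)).const_mul 4
      have hi2 := (h.integrable_quadratic (S ^ 2)).const_mul (8 * (B - 2))
      refine (lintegral_ofReal_le_of_le_integral ((integrable_const _).add (hi3.add hi2))
        (ae_of_all _ fun a => ?_) (ae_of_all _ hpt)).trans (ENNReal.ofReal_le_ofReal ?_)
      · exact (trace_pow_even_nonneg (by
          rw [transpose_add, hS, transpose_centredOuter]) 2).trans (hpt a)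
      · refine (integral_add (integrable_const _) (hi3.add hi2)).le.trans ?_
        have e := integral_add hi3 hi2
        rw [integral_const_mul, integral_const_mul, h.integral_quadratic,
          h.integral_quadratic] at e
        refine (add_le_add_right e.le _).trans ?_
        simp only [integral_const, probReal_univ, one_smul]
        nlinarith
    refine step.trans ?_
    rw [lintegral_add_left (hm _ 4), lintegral_add_right _ measurable_const,
      lintegral_const_mul _ (hm _ 2), Finset.card_insert_of_notMem hk]
    simp only [lintegral_const, measure_univ, mul_one]
    have hcard : (T.card : ℝ) ≤ Fintype.card ι := by exact_mod_cast Finset.card_le_univ T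
    refine (add_le_add ih (add_le_add_left
      (mul_le_mul_right (lintegral_trace_sq_le h hB T) _) _)).trans ?_
    rw [← ENNReal.ofReal_mul (by positivity), ← ENNReal.ofReal_add (by positivity) (by positivity),
      ← ENNReal.ofReal_add (by positivity) (by positivity)]
    refine ENNReal.ofReal_le_ofReal ?_
    push_cast
    have : 8 * B * (T.card * (2 * B ^ 2)) ≤ 16 * B ^ 3 * Fintype.card ι := by
      calc 8 * B * (T.card * (2 * B ^ 2)) = 16 * B ^ 3 * T.card := by ring
        _ ≤ _ := by gcongr
    linarith

/-- The scatter operator fails to be bounded below by half its mean with a probability that is small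
when `B³ ≪ n²`. -/
theorem measure_scatter_lt_le (h : IsBoundedIsotropic μ B φ) (hB : 1 ≤ B)
    (hBn : B ≤ Fintype.card ι) :
    Measure.pi (fun _ : ι => μ) {x | ¬ ∀ v, (Fintype.card ι / 2 : ℝ) * ‖v‖ ^ 2 ≤
      ∑ j, inner ℝ (φ (x j)) v ^ 2} ≤ ENNReal.ofReal (448 * B ^ 3 / Fintype.card ι ^ 2) := by
  set n : ℝ := (Fintype.card ι : ℝ) with hn
  have hn0 : 0 < n := by linarith
  have hm : Measurable fun x : ι → X =>
      ENNReal.ofReal (centredScatter φ Finset.univ x ^ 4).trace :=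
    ENNReal.measurable_ofReal.comp (measurable_trace_centredScatter_pow h.measurable _ 4)
  have h1 := (mul_meas_ge_le_lintegral (μ := Measure.pi fun _ : ι => μ) hm
    (ENNReal.ofReal ((n / 2) ^ 4))).trans (lintegral_trace_pow_four_le h hB Finset.univ)
  have h2 : ENNReal.ofReal ((Finset.univ : Finset ι).card *
      (16 * B ^ 3 * Fintype.card ι + 12 * B ^ 4)) ≤ ENNReal.ofReal (28 * B ^ 3 * n ^ 2) := by
    refine ENNReal.ofReal_le_ofReal ?_
    rw [Finset.card_univ, ← hn]
    have : B ^ 3 * B ≤ B ^ 3 * n := by gcongr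
    nlinarith
  have h3 : ENNReal.ofReal (448 * B ^ 3 / n ^ 2) =
      ENNReal.ofReal (28 * B ^ 3 * n ^ 2) / ENNReal.ofReal ((n / 2) ^ 4) := by
    rw [← ENNReal.ofReal_div_of_pos (by positivity)]
    congr 1
    field_simp
    norm_num
  rw [h3, ENNReal.le_div_iff_mul_le (Or.inl (by positivity)) (Or.inl ENNReal.ofReal_ne_top),
    mul_comm]
  refine le_trans (mul_le_mul_right (measure_mono fun x hx => ?_) _) (h1.trans h2)
  rw [Set.mem_ofPred_eq] at hx ⊢
  by_contra hlt
  rw [not_le, ENNReal.ofReal_lt_ofReal_iff (by positivity)] at hlt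
  refine hx fun v => ?_
  set S := centredScatter φ Finset.univ x with hS
  have h4 : ∑ j, inner ℝ (φ (x j)) v ^ 2 = v.ofLp ⬝ᵥ S *ᵥ v.ofLp + n * ‖v‖ ^ 2 := by
    have : ∀ j, v.ofLp ⬝ᵥ centredOuter (φ (x j)).ofLp *ᵥ v.ofLp =
        inner ℝ (φ (x j)) v ^ 2 - ‖v‖ ^ 2 := fun j => by
      rw [centredOuter, sub_mulVec, one_mulVec, dotProduct_sub, vecMulVec_mulVec,
        ← real_inner_self_eq_norm_sq, inner_eq_dotProduct, inner_eq_dotProduct]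
      simp [dotProduct_comm, pow_two]
    rw [hS, centredScatter, sum_mulVec, dotProduct_sum]
    simp only [this, Finset.sum_sub_distrib, Finset.sum_const, Finset.card_univ, nsmul_eq_mul]
    ring
  have h5 := dotProduct_mulVec_pow_four_le (transpose_centredScatter (φ := φ) Finset.univ x)
    v.ofLp
  rw [← inner_eq_dotProduct v v, real_inner_self_eq_norm_sq, ← hS] at h5
  have h6 : (v.ofLp ⬝ᵥ S *ᵥ v.ofLp) ^ 4 ≤ (n / 2 * ‖v‖ ^ 2) ^ 4 := by
    rw [mul_pow]
    exact h5.trans (by gcongr)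
  have h7 := (abs_le.1 (abs_le_of_pow_four_le (by positivity) h6)).1
  rw [h4]
  linarith

end Gram

/-! ### Bias and noise of ridge regression at a random design -/

section Design

variable {ι X : Type*} [Fintype ι] [DecidableEq ι] [MeasurableSpace X]

/-- The tail bound for the sum over all sample points but one of a kernel that is centred in its
second argument, the point left out entering as first argument. -/
lemma measure_norm_sum_erase_ge_le {μ : Measure X} [IsProbabilityMeasure μ]
    {V : Type*} [NormedAddCommGroup V] [InnerProductSpace ℝ V]
    [MeasurableSpace V] [BorelSpace V] [SecondCountableTopology V] (i : ι) {ψ : X → X → V}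
    {b v W L : ℝ} (hv : 0 ≤ v) (hW : 0 < W) (hbW : b ^ 2 ≤ W) (hvW : Fintype.card ι * v ≤ W)
    (hψ : Measurable (Function.uncurry ψ)) (hb : ∀ c a, ‖ψ c a‖ ≤ b)
    (hmean : ∀ c w, ∫ a, inner ℝ w (ψ c a) ∂μ = 0) (hvar : ∀ c, ∫ a, ‖ψ c a‖ ^ 2 ∂μ ≤ v)
    (hL : 0 ≤ L) :
    Measure.pi (fun _ : ι => μ) {x | √W * L ≤ ‖∑ k ∈ Finset.univ.erase i, ψ (x i) (x k)‖} ≤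
      ENNReal.ofReal (2 * Real.exp (1 - L)) := by
  have hne : ∀ k ∈ Finset.univ.erase i, i ≠ k := fun k hk => (Finset.ne_of_mem_erase hk).symm
  refine measure_norm_sum_ge_le (μ := fun _ : ι => μ) (Finset.univ.erase i)
    (z := fun k x => ψ (x i) (x k)) (v := v) hW (Real.le_sqrt_of_sq_le hbW) ?_
    (fun k => hψ.comp (g := Function.uncurry ψ) (f := fun x : ι → X => (x i, x k))
      ((measurable_pi_apply i).prodMk (measurable_pi_apply k)))
    (fun k x => hb _ _) (fun k hk j hj hjk x a => ?_) (fun k hk x w => ?_) (fun k hk x => ?_) hL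
  · refine le_trans ?_ hvW
    gcongr
    exact Finset.card_le_univ _
  · rw [Function.update_of_ne (hne k hk), Function.update_of_ne hjk]
  · simp only [Function.update_of_ne (hne k hk), Function.update_self]
    exact hmean _ _
  · simp only [Function.update_of_ne (hne k hk), Function.update_self]
    exact hvar _

lemma measurable_inner_smul_sub {V Y : Type*} [NormedAddCommGroup V] [InnerProductSpace ℝ V]
    [MeasurableSpace V] [BorelSpace V] [SecondCountableTopology V] [MeasurableSpace Y]
    {f g : Y → V} (hf : Measurable f) (hg : Measurable g) :
    Measurable fun a => (inner ℝ (f a) (g a) : ℝ) • g a - f a :=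
  ((hf.inner hg).smul hg).sub hf

variable {J : Type*} [Fintype J] [DecidableEq J] {μ : Measure X} [IsProbabilityMeasure μ] {B : ℝ}
  {φ : X → EuclideanSpace ℝ J}

namespace IsBoundedIsotropic

omit [IsProbabilityMeasure μ] in
lemma norm_le (h : IsBoundedIsotropic μ B φ) (a : X) : ‖φ a‖ ≤ √B :=
  Real.le_sqrt_of_sq_le (h.norm_sq_le a)

lemma integrable_inner_sq (h : IsBoundedIsotropic μ B φ) (w : EuclideanSpace ℝ J) :
    Integrable (fun a => inner ℝ w (φ a) ^ 2) μ := by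
  simpa [pow_two] using h.integrable_inner_mul_inner w w

lemma integral_inner_sq (h : IsBoundedIsotropic μ B φ) (w : EuclideanSpace ℝ J) :
    ∫ a, inner ℝ w (φ a) ^ 2 ∂μ = ‖w‖ ^ 2 := by
  have := h.integral_inner_mul_inner w w
  rw [real_inner_self_eq_norm_sq] at this
  simpa [pow_two] using this

lemma norm_le_one (h : IsBoundedIsotropic μ B φ) {θ : EuclideanSpace ℝ J}
    (hθ : ∀ a, |inner ℝ θ (φ a)| ≤ 1) : ‖θ‖ ≤ 1 := by
  have h1 := integral_mono (h.integrable_inner_sq θ) (integrable_const 1) fun a => by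
    show inner ℝ θ (φ a) ^ 2 ≤ 1
    rw [← sq_abs]
    exact pow_le_one₀ (abs_nonneg _) (hθ a)
  rw [h.integral_inner_sq] at h1
  simp only [integral_const, probReal_univ, one_smul] at h1
  nlinarith [norm_nonneg θ]

/-- The score of the linear function `θ` at a sample point, centred. -/
lemma norm_score_le (h : IsBoundedIsotropic μ B φ) (hB : 1 ≤ B) {θ : EuclideanSpace ℝ J}
    (hθ : ∀ a, |inner ℝ θ (φ a)| ≤ 1) (a : X) :
    ‖(inner ℝ θ (φ a) : ℝ) • φ a - θ‖ ≤ 2 * √B := by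
  have h1 : 1 ≤ √B := Real.one_le_sqrt.2 hB
  calc ‖(inner ℝ θ (φ a) : ℝ) • φ a - θ‖ ≤ |inner ℝ θ (φ a)| * ‖φ a‖ + ‖θ‖ := by
        refine (norm_sub_le _ _).trans ?_
        rw [norm_smul, Real.norm_eq_abs]
    _ ≤ 1 * √B + 1 := by
        gcongr
        · exact hθ a
        · exact h.norm_le a
        · exact h.norm_le_one hθ
    _ ≤ _ := by linarith

lemma integral_inner_score (h : IsBoundedIsotropic μ B φ) (θ w : EuclideanSpace ℝ J) :
    ∫ a, inner ℝ w ((inner ℝ θ (φ a) : ℝ) • φ a - θ) ∂μ = 0 := by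
  simp only [inner_sub_right, real_inner_smul_right]
  rw [integral_sub (h.integrable_inner_mul_inner θ w) (integrable_const _),
    h.integral_inner_mul_inner, real_inner_comm]
  simp

/-- Deviation of the empirical score from its mean. -/
lemma measure_norm_sum_score_ge_le (h : IsBoundedIsotropic μ B φ) (hB : 1 ≤ B)
    (hBn : B ≤ Fintype.card ι) {θ : EuclideanSpace ℝ J} (hθ : ∀ a, |inner ℝ θ (φ a)| ≤ 1)
    {L : ℝ} (hL : 0 ≤ L) :
    Measure.pi (fun _ : ι => μ) {x | √(4 * (B * Fintype.card ι)) * L ≤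
      ‖∑ k, ((inner ℝ θ (φ (x k)) : ℝ) • φ (x k) - θ)‖} ≤
      ENNReal.ofReal (2 * Real.exp (1 - L)) := by
  have hmeas : Measurable fun a => (inner ℝ θ (φ a) : ℝ) • φ a - θ :=
    measurable_inner_smul_sub measurable_const h.measurable
  have hsq : ∀ a, ‖(inner ℝ θ (φ a) : ℝ) • φ a - θ‖ ^ 2 ≤ 4 * B := fun a => by
    calc _ ≤ (2 * √B) ^ 2 := by gcongr; exact h.norm_score_le hB hθ a
      _ = 4 * B := by rw [mul_pow, Real.sq_sqrt (by linarith)]; norm_num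
  have hnorm := h.norm_score_le hB hθ
  have hmean := h.integral_inner_score θ
  obtain ⟨ζ, hζ⟩ : ∃ ζ : X → EuclideanSpace ℝ J,
    ζ = fun a => (inner ℝ θ (φ a) : ℝ) • φ a - θ := ⟨_, rfl⟩
  have hζ' : ∀ a, (inner ℝ θ (φ a) : ℝ) • φ a - θ = ζ a := fun a => by rw [hζ]
  rw [← hζ] at hmeas
  simp only [hζ'] at hsq hnorm hmean ⊢
  refine measure_norm_sum_ge_le (μ := fun _ : ι => μ) Finset.univ
    (z := fun k x => ζ (x k)) (b := 2 * √B) (v := 4 * B)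
    (by nlinarith) (Real.le_sqrt_of_sq_le ?_) ?_
    (fun k => hmeas.comp (measurable_pi_apply k))
    (fun k x => hnorm _) (fun k _ j _ hjk x a => ?_) (fun k _ x w => ?_)
    (fun k _ x => ?_) hL
  · rw [mul_pow, Real.sq_sqrt (by linarith)]
    nlinarith
  · rw [Finset.card_univ]
    linarith
  · rw [Function.update_of_ne hjk]
  · simp only [Function.update_self]
    exact hmean w
  · simp only [Function.update_self]
    refine (integral_mono_of_nonneg (ae_of_all _ fun a => by positivity)
      (integrable_const (4 * B)) (ae_of_all _ hsq)).trans ?_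
    simp

/-- Deviation of the empirical score, seen from a sample point that is left out. -/
lemma measure_inner_sum_score_ge_le (h : IsBoundedIsotropic μ B φ) (hB : 1 ≤ B)
    (hBn : B ≤ Fintype.card ι) {θ : EuclideanSpace ℝ J} (hθ : ∀ a, |inner ℝ θ (φ a)| ≤ 1)
    {L : ℝ} (hL : 0 ≤ L) (i : ι) :
    Measure.pi (fun _ : ι => μ) {x | √(4 * (B * Fintype.card ι)) * L ≤
      ‖∑ k ∈ Finset.univ.erase i,
        (inner ℝ (φ (x i)) ((inner ℝ θ (φ (x k)) : ℝ) • φ (x k) - θ) : ℝ)‖} ≤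
      ENNReal.ofReal (2 * Real.exp (1 - L)) := by
  have hB0 : 0 ≤ B := by linarith
  obtain ⟨ψ, hψ⟩ : ∃ ψ : X → X → ℝ,
    ∀ c a, inner ℝ (φ c) ((inner ℝ θ (φ a) : ℝ) • φ a - θ) = ψ c a := ⟨_, fun _ _ => rfl⟩
  simp only [hψ]
  refine measure_norm_sum_erase_ge_le i (ψ := ψ)
    (b := 2 * B) (v := 4 * B) (by positivity) (by nlinarith) (by nlinarith) (by linarith) ?_
    (fun c a => ?_) (fun c w => ?_) (fun c => ?_) hL
  · have e : Function.uncurry ψ = fun q : X × X =>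
        (inner ℝ (φ q.1) ((inner ℝ θ (φ q.2) : ℝ) • φ q.2 - θ) : ℝ) := by
      funext q
      exact (hψ q.1 q.2).symm
    rw [e]
    exact (h.measurable.comp measurable_fst).inner
      (measurable_inner_smul_sub measurable_const (h.measurable.comp measurable_snd))
  · rw [← hψ]
    calc _ ≤ ‖φ c‖ * ‖(inner ℝ θ (φ a) : ℝ) • φ a - θ‖ := norm_inner_le_norm _ _
      _ ≤ √B * (2 * √B) := by gcongr; exacts [h.norm_le c, h.norm_score_le hB hθ a]
      _ = 2 * B := by rw [← mul_assoc, mul_comm √B, mul_assoc, Real.mul_self_sqrt hB0]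
  · have e : ∀ a, inner ℝ w (ψ c a) =
        w * inner ℝ (φ c) ((inner ℝ θ (φ a) : ℝ) • φ a - θ) := fun a => by
      rw [hψ]
      simp [mul_comm]
    simp only [e]
    rw [integral_const_mul, h.integral_inner_score, mul_zero]
  · have hle : ∀ a, ‖ψ c a‖ ^ 2 ≤
        2 * inner ℝ (φ c) (φ a) ^ 2 + 2 := fun a => by
      rw [← hψ, Real.norm_eq_abs, sq_abs, inner_sub_right, real_inner_smul_right, real_inner_comm θ]
      have h1 : inner ℝ θ (φ a) ^ 2 ≤ 1 := by
        rw [← sq_abs]; exact pow_le_one₀ (abs_nonneg _) (hθ a)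
      have h2 : inner ℝ θ (φ c) ^ 2 ≤ 1 := by
        rw [← sq_abs]; exact pow_le_one₀ (abs_nonneg _) (hθ c)
      nlinarith [sq_nonneg (inner ℝ θ (φ a) * inner ℝ (φ c) (φ a) + inner ℝ θ (φ c)),
        mul_le_mul_of_nonneg_right h1 (sq_nonneg (inner ℝ (φ c) (φ a) : ℝ))]
    have hi := (h.integrable_inner_sq (φ c)).const_mul 2
    refine (integral_mono_of_nonneg (ae_of_all _ fun a => by positivity)
      (hi.add (integrable_const 2)) (ae_of_all _ hle)).trans ?_
    refine (integral_add hi (integrable_const 2)).le.trans ?_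
    rw [integral_const_mul, h.integral_inner_sq]
    have := h.norm_sq_le c
    simp only [integral_const, probReal_univ, one_smul]
    linarith

/-- Deviation of the scatter operator applied to a sample point that is left out. -/
lemma measure_norm_sum_scatter_ge_le (h : IsBoundedIsotropic μ B φ) (hB : 1 ≤ B)
    (hBn : B ≤ Fintype.card ι) {L : ℝ} (hL : 0 ≤ L) (i : ι) :
    Measure.pi (fun _ : ι => μ) {x | √(4 * (B ^ 2 * Fintype.card ι)) * L ≤
      ‖∑ k ∈ Finset.univ.erase i, ((inner ℝ (φ (x k)) (φ (x i)) : ℝ) • φ (x k) - φ (x i))‖} ≤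
      ENNReal.ofReal (2 * Real.exp (1 - L)) := by
  have hB0 : 0 ≤ B := by linarith
  have hsB : √B ^ 2 = B := Real.sq_sqrt hB0
  have hin : ∀ c a, |inner ℝ (φ a) (φ c)| ≤ B := fun c a => by
    calc |inner ℝ (φ a) (φ c)| ≤ ‖φ a‖ * ‖φ c‖ := abs_real_inner_le_norm _ _
      _ ≤ √B * √B := by gcongr <;> exact h.norm_le _
      _ = B := Real.mul_self_sqrt hB0
  obtain ⟨ψ, hψ⟩ : ∃ ψ : X → X → EuclideanSpace ℝ J,
    ∀ c a, (inner ℝ (φ c) (φ a) : ℝ) • φ a - φ c = ψ c a := ⟨_, fun _ _ => rfl⟩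
  have hsymm : ∀ c a, (inner ℝ (φ a) (φ c) : ℝ) = inner ℝ (φ c) (φ a) := fun c a =>
    real_inner_comm _ _
  have hrw : ∀ (x : ι → X) k, (inner ℝ (φ (x k)) (φ (x i)) : ℝ) • φ (x k) - φ (x i) =
      ψ (x i) (x k) := fun x k => by rw [hsymm, hψ]
  simp only [hrw]
  refine measure_norm_sum_erase_ge_le i (ψ := ψ)
    (b := 2 * B * √B) (v := 4 * B ^ 2) (by positivity) (by nlinarith [pow_pos (by linarith : 0 < B) 2])
    ?_ (by nlinarith) ?_ (fun c a => ?_) (fun c w => ?_) (fun c => ?_) hL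
  · rw [mul_pow, hsB, mul_pow]
    nlinarith [sq_nonneg B]
  · have e : Function.uncurry ψ = fun q : X × X =>
        (inner ℝ (φ q.1) (φ q.2) : ℝ) • φ q.2 - φ q.1 := by
      funext q
      exact (hψ q.1 q.2).symm
    rw [e]
    exact measurable_inner_smul_sub (h.measurable.comp measurable_fst)
      (h.measurable.comp measurable_snd)
  · rw [← hψ]
    calc _ ≤ |inner ℝ (φ c) (φ a)| * ‖φ a‖ + ‖φ c‖ := by
          refine (norm_sub_le _ _).trans ?_
          rw [norm_smul, Real.norm_eq_abs]
      _ ≤ B * √B + √B := by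
          gcongr
          exacts [hin a c, h.norm_le a, h.norm_le c]
      _ ≤ _ := by nlinarith [Real.sqrt_nonneg B]
  · simp only [← hψ]
    exact h.integral_inner_score (φ c) w
  · have hle : ∀ a, ‖ψ c a‖ ^ 2 ≤
        2 * B * inner ℝ (φ c) (φ a) ^ 2 + 2 * B := fun a => by
      rw [← hψ]
      have h1 : ‖(inner ℝ (φ c) (φ a) : ℝ) • φ a - φ c‖ ≤
          |inner ℝ (φ c) (φ a)| * ‖φ a‖ + ‖φ c‖ := by
        refine (norm_sub_le _ _).trans ?_
        rw [norm_smul, Real.norm_eq_abs]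
      have h2 := h.norm_sq_le a
      have h3 := h.norm_sq_le c
      calc _ ≤ (|inner ℝ (φ c) (φ a)| * ‖φ a‖ + ‖φ c‖) ^ 2 := by gcongr
        _ ≤ 2 * (|inner ℝ (φ c) (φ a)| * ‖φ a‖) ^ 2 + 2 * ‖φ c‖ ^ 2 := by
            nlinarith [sq_nonneg (|inner ℝ (φ c) (φ a)| * ‖φ a‖ - ‖φ c‖)]
        _ = 2 * ‖φ a‖ ^ 2 * inner ℝ (φ c) (φ a) ^ 2 + 2 * ‖φ c‖ ^ 2 := by
            rw [mul_pow, sq_abs]; ring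
        _ ≤ _ := by gcongr
    have hi := (h.integrable_inner_sq (φ c)).const_mul (2 * B)
    refine (integral_mono_of_nonneg (ae_of_all _ fun a => by positivity)
      (hi.add (integrable_const (2 * B))) (ae_of_all _ hle)).trans ?_
    refine (integral_add hi (integrable_const (2 * B))).le.trans ?_
    rw [integral_const_mul, h.integral_inner_sq]
    have := h.norm_sq_le c
    simp only [integral_const, probReal_univ, one_smul]
    nlinarith

end IsBoundedIsotropic

/-- The sample is well conditioned: the scatter operator is bounded below by half its mean, and
ridge regression with any penalty `s` fits the linear function `θ` with bias at most `δ` after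
shrinkage. -/
def IsGoodDesign (φ : X → EuclideanSpace ℝ J) (θ : EuclideanSpace ℝ J) (δ : ℝ) (x : ι → X) :
    Prop :=
  (∀ v, (Fintype.card ι / 2 : ℝ) * ‖v‖ ^ 2 ≤ ∑ j, inner ℝ (φ (x j)) v ^ 2) ∧
    ∀ s : ℝ, 0 < s → ∀ i, |inner ℝ (φ (x i)) (Ring.inverse (ridgeOp s (fun j => φ (x j)))
      (∑ j, (inner ℝ θ (φ (x j)) : ℝ) • φ (x j) - (Fintype.card ι : ℝ) • θ))| ≤ δ

/-- Random designs are good with high probability. The second term of the bias bound is the second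
order of the Neumann series of the inverse scatter operator, of size `B^{3/2} / n`. -/
theorem measure_not_isGoodDesign_le (h : IsBoundedIsotropic μ B φ) (hB : 1 ≤ B)
    (hBn : B ≤ Fintype.card ι) {θ : EuclideanSpace ℝ J} (hθ : ∀ a, |inner ℝ θ (φ a)| ≤ 1)
    {L : ℝ} (hL : 1 ≤ L) :
    Measure.pi (fun _ : ι => μ) {x | ¬ IsGoodDesign φ θ
      ((4 * √(B * Fintype.card ι) * L + 16 * B * √B * L ^ 2) / Fintype.card ι) x} ≤
      ENNReal.ofReal (448 * B ^ 3 / Fintype.card ι ^ 2) +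
        (2 * Fintype.card ι + 1) * ENNReal.ofReal (2 * Real.exp (1 - L)) := by
  set n : ℝ := (Fintype.card ι : ℝ) with hn
  have hL0 : 0 ≤ L := by linarith
  have hB0 : 0 ≤ B := by linarith
  have hn0 : 0 < n := by linarith
  set A0 : Set (ι → X) := {x | ¬ ∀ v, (n / 2 : ℝ) * ‖v‖ ^ 2 ≤ ∑ j, inner ℝ (φ (x j)) v ^ 2}
  set A1 : Set (ι → X) := {x | √(4 * (B * n)) * L ≤
    ‖∑ k, ((inner ℝ θ (φ (x k)) : ℝ) • φ (x k) - θ)‖}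
  set A2 : ι → Set (ι → X) := fun i => {x | √(4 * (B * n)) * L ≤
    ‖∑ k ∈ Finset.univ.erase i,
      (inner ℝ (φ (x i)) ((inner ℝ θ (φ (x k)) : ℝ) • φ (x k) - θ) : ℝ)‖}
  set A3 : ι → Set (ι → X) := fun i => {x | √(4 * (B ^ 2 * n)) * L ≤
    ‖∑ k ∈ Finset.univ.erase i, ((inner ℝ (φ (x k)) (φ (x i)) : ℝ) • φ (x k) - φ (x i))‖}
  have hsub : {x : ι → X | ¬ IsGoodDesign φ θ ((4 * √(B * n) * L + 16 * B * √B * L ^ 2) / n) x} ⊆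
      A0 ∪ (A1 ∪ ((⋃ i, A2 i) ∪ ⋃ i, A3 i)) := by
    intro x hx
    by_contra hc
    simp only [Set.mem_union, Set.mem_iUnion, not_or, not_exists] at hc
    obtain ⟨c0, c1, c2, c3⟩ := hc
    have c0 : ∀ v, (n / 2 : ℝ) * ‖v‖ ^ 2 ≤ ∑ j, inner ℝ (φ (x j)) v ^ 2 := not_not.1 c0
    have c1 : ‖∑ k, ((inner ℝ θ (φ (x k)) : ℝ) • φ (x k) - θ)‖ < √(4 * (B * n)) * L :=
      not_le.1 c1
    refine hx ⟨c0, fun s hs i => ?_⟩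
    have c2 : ‖∑ k ∈ Finset.univ.erase i,
      (inner ℝ (φ (x i)) ((inner ℝ θ (φ (x k)) : ℝ) • φ (x k) - θ) : ℝ)‖ < √(4 * (B * n)) * L :=
      not_le.1 (c2 i)
    have c3 : ‖∑ k ∈ Finset.univ.erase i,
      ((inner ℝ (φ (x k)) (φ (x i)) : ℝ) • φ (x k) - φ (x i))‖ < √(4 * (B ^ 2 * n)) * L :=
      not_le.1 (c3 i)
    have hr1 : √(4 * (B * n)) = 2 * √(B * n) := by
      rw [Real.sqrt_mul (by norm_num), show (4 : ℝ) = 2 ^ 2 by norm_num,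
        Real.sqrt_sq (by norm_num)]
    have hr2 : √(4 * (B ^ 2 * n)) = 2 * B * √n := by
      rw [Real.sqrt_mul (by norm_num), Real.sqrt_mul (by positivity), Real.sqrt_sq hB0,
        show (4 : ℝ) = 2 ^ 2 by norm_num, Real.sqrt_sq (by norm_num), mul_assoc]
    rw [hr1] at c1 c2
    rw [hr2] at c3
    have hBs : B ≤ √(B * n) := Real.le_sqrt_of_sq_le (by nlinarith)
    have hsn : √B ≤ √n := Real.sqrt_le_sqrt hBn
    set u := ∑ j, (inner ℝ θ (φ (x j)) : ℝ) • φ (x j) - n • θ with hu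
    have hu' : u = ∑ k, ((inner ℝ θ (φ (x k)) : ℝ) • φ (x k) - θ) := by
      rw [hu, Finset.sum_sub_distrib, Finset.sum_const, Finset.card_univ, hn, Nat.cast_smul_eq_nsmul]
    have hun : ‖u‖ ≤ 2 * √(B * n) * L := by rw [hu']; exact c1.le
    have hin : |inner ℝ (φ (x i)) u| ≤ 4 * √(B * n) * L := by
      rw [hu', inner_sum, ← Finset.add_sum_erase _ _ (Finset.mem_univ i)]
      refine (abs_add_le _ _).trans ?_
      have h1 : |inner ℝ (φ (x i)) ((inner ℝ θ (φ (x i)) : ℝ) • φ (x i) - θ)| ≤ 2 * B := by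
        calc _ ≤ ‖φ (x i)‖ * ‖(inner ℝ θ (φ (x i)) : ℝ) • φ (x i) - θ‖ :=
              abs_real_inner_le_norm _ _
          _ ≤ √B * (2 * √B) := by gcongr; exacts [h.norm_le _, h.norm_score_le hB hθ _]
          _ = 2 * B := by rw [← mul_assoc, mul_comm √B, mul_assoc, Real.mul_self_sqrt hB0]
      have h2 : 2 * B ≤ 2 * √(B * n) * L := by nlinarith
      have h3 := c2.le
      rw [Real.norm_eq_abs] at h3
      linarith
    have hsc : ‖∑ j, (inner ℝ (φ (x j)) (φ (x i)) : ℝ) • φ (x j) - n • φ (x i)‖ ≤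
        4 * B * √n * L := by
      have e : ∑ j, (inner ℝ (φ (x j)) (φ (x i)) : ℝ) • φ (x j) - n • φ (x i) =
          ∑ j, ((inner ℝ (φ (x j)) (φ (x i)) : ℝ) • φ (x j) - φ (x i)) := by
        rw [Finset.sum_sub_distrib, Finset.sum_const, Finset.card_univ, hn, Nat.cast_smul_eq_nsmul]
      rw [e, ← Finset.add_sum_erase _ _ (Finset.mem_univ i)]
      refine (norm_add_le _ _).trans ?_
      have h1 : ‖(inner ℝ (φ (x i)) (φ (x i)) : ℝ) • φ (x i) - φ (x i)‖ ≤ 2 * B * √n := by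
        calc _ ≤ ‖φ (x i)‖ ^ 2 * ‖φ (x i)‖ + ‖φ (x i)‖ := by
              refine (norm_sub_le _ _).trans ?_
              rw [norm_smul, real_inner_self_eq_norm_sq, Real.norm_eq_abs,
                abs_of_nonneg (by positivity)]
          _ ≤ B * √B + √B := by
              gcongr
              exacts [h.norm_sq_le _, h.norm_le _, h.norm_le _]
          _ ≤ 2 * B * √B := by nlinarith [Real.sqrt_nonneg B]
          _ ≤ _ := by gcongr
      have h2 : 2 * B * √n * 1 ≤ 2 * B * √n * L := by gcongr
      linarith [c3.le]
    have hcoer : ∀ v, ((n + s) / 2 - s) * ‖v‖ ^ 2 ≤ ∑ j, inner ℝ (φ (x j)) v ^ 2 := fun v => by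
      have := c0 v
      nlinarith [sq_nonneg ‖v‖]
    refine (abs_inner_inverse_ridgeOp_le hs hn0.le (by positivity : 0 < (n + s) / 2) hcoer
      (φ (x i)) u).trans ?_
    have hns : n ≤ n + s := by linarith
    have h1 : ‖u‖ / ((n + s) / 2) ≤ 2 * √(B * n) * L / (n / 2) := by gcongr
    calc _ ≤ (4 * √(B * n) * L + 4 * B * √n * L * (2 * √(B * n) * L / (n / 2))) / n := by gcongr
      _ = _ := by
        have : √n * √(B * n) = √B * n := by
          rw [Real.sqrt_mul hB0, mul_comm √n, mul_assoc, Real.mul_self_sqrt hn0.le]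
        congr 2
        calc 4 * B * √n * L * (2 * √(B * n) * L / (n / 2)) =
            16 * B * L ^ 2 * (√n * √(B * n)) / n := by ring
          _ = 16 * B * √B * L ^ 2 := by rw [this]; field_simp
  refine (measure_mono hsub).trans ((measure_union_le _ _).trans (add_le_add ?_ ?_))
  · exact measure_scatter_lt_le h hB hBn
  · have h1 := h.measure_norm_sum_score_ge_le hB hBn hθ hL0
    have h2 : Measure.pi (fun _ : ι => μ) (⋃ i, A2 i) ≤
        Fintype.card ι * ENNReal.ofReal (2 * Real.exp (1 - L)) := by
      refine (measure_iUnion_fintype_le _ _).trans ((Finset.sum_le_sum fun i _ =>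
        h.measure_inner_sum_score_ge_le hB hBn hθ hL0 i).trans (le_of_eq ?_))
      simp
    have h3 : Measure.pi (fun _ : ι => μ) (⋃ i, A3 i) ≤
        Fintype.card ι * ENNReal.ofReal (2 * Real.exp (1 - L)) := by
      refine (measure_iUnion_fintype_le _ _).trans ((Finset.sum_le_sum fun i _ =>
        h.measure_norm_sum_scatter_ge_le hB hBn hL0 i).trans (le_of_eq ?_))
      simp
    refine (measure_union_le _ _).trans ((add_le_add h1 ((measure_union_le _ _).trans
      (add_le_add h2 h3))).trans (le_of_eq ?_))
    ring

omit [DecidableEq ι] [DecidableEq J] in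
lemma measurable_ridgeWeight {s : ℝ} (hs : 0 < s) (hφ : Measurable φ) (i j : ι) :
    Measurable fun x : ι → X => ridgeWeight s (fun k => φ (x k)) i j := by
  have hop : Continuous fun u : ι → EuclideanSpace ℝ J => ridgeOp s u := by
    unfold ridgeOp
    refine continuous_const.add (continuous_finsetSum _ fun k _ => ?_)
    have h1 : Continuous fun u : ι → EuclideanSpace ℝ J => u k := continuous_apply k
    exact ((ContinuousLinearMap.smulRightL ℝ (EuclideanSpace ℝ J)
      (EuclideanSpace ℝ J)).continuous.comp ((innerSL ℝ).continuous.comp h1)).clm_apply h1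
  have hc : Continuous fun u : ι → EuclideanSpace ℝ J => ridgeWeight s u i j := by
    unfold ridgeWeight
    refine (continuous_apply i).inner (Continuous.clm_apply ?_ (continuous_apply j))
    refine continuous_iff_continuousAt.2 fun u => ?_
    obtain ⟨a, ha⟩ := isUnit_ridgeOp hs u
    have h1 := NormedRing.inverse_continuousAt a
    rw [ha] at h1
    exact ContinuousAt.comp (f := fun u => ridgeOp s u) h1 hop.continuousAt
  exact hc.measurable.comp (measurable_pi_lambda _ fun k => hφ.comp (measurable_pi_apply k))

omit [IsProbabilityMeasure μ] in
/-- With high probability either the scatter operator is too small or the ridge fit of the label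
noise is small at all sample points. -/
theorem measure_noise_ge_le (h : IsBoundedIsotropic μ B φ) (hB : 1 ≤ B)
    {ν : ι → Measure (X × ℝ)} [∀ i, IsProbabilityMeasure (ν i)]
    {η : X → ℝ} (hη : Measurable η) (hbdd : ∀ i, ∀ᵐ a ∂ν i, |a.2 - η a.1| ≤ 2)
    (hreg : ∀ i, ∀ h : X → ℝ, Measurable h → (∃ c, ∀ a, |h a| ≤ c) →
      ∫ a, h a.1 * (a.2 - η a.1) ∂ν i = 0) {s : ℝ} (hs : 0 < s) (L : ℝ) :
    Measure.pi ν {x | (∀ v, (Fintype.card ι / 2 : ℝ) * ‖v‖ ^ 2 ≤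
        ∑ j, inner ℝ (φ (x j).1) v ^ 2) ∧
      ∃ i, √(2 * B / (Fintype.card ι + s)) * L ≤
        |∑ j, ridgeWeight s (fun k => φ (x k).1) i j * ((x j).2 - η (x j).1)|} ≤
      2 * Fintype.card ι * ENNReal.ofReal (Real.exp (4 - L)) := by
  set n : ℝ := (Fintype.card ι : ℝ) with hn
  have hn0 : 0 ≤ n := by positivity
  set V := 2 * B / (n + s) with hV
  have hV0 : 0 < V := by positivity
  have hsV : 0 < √V := Real.sqrt_pos.2 hV0
  -- one point and one sign
  have key : ∀ (i : ι) (σ : ℝ), σ ^ 2 = 1 → Measure.pi ν {x | (∀ v, (n / 2 : ℝ) * ‖v‖ ^ 2 ≤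
        ∑ j, inner ℝ (φ (x j).1) v ^ 2) ∧
      √V * L ≤ σ * ∑ j, ridgeWeight s (fun k => φ (x k).1) i j * ((x j).2 - η (x j).1)} ≤
      ENNReal.ofReal (Real.exp (4 - L)) := by
    intro i σ hσ
    have hσ1 : |σ| = 1 := by
      rw [← abs_one, ← sq_eq_sq_iff_abs_eq_abs, hσ, one_pow]
    set t : ι → (ι → X) → ℝ := fun j x => σ * (√V)⁻¹ * ridgeWeight s (fun k => φ (x k)) i j
    have hmt : ∀ j, Measurable (t j) := fun j =>
      (measurable_ridgeWeight hs h.measurable i j).const_mul _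
    have hw : ∀ (j : ι) (x : ι → X), |ridgeWeight s (fun k => φ (x k)) i j| ≤ √(B / s) := by
      intro j x
      refine Real.abs_le_sqrt ?_
      refine (Finset.single_le_sum (f := fun j => ridgeWeight s (fun k => φ (x k)) i j ^ 2)
        (fun _ _ => sq_nonneg _) (Finset.mem_univ j)).trans
        ((sum_ridgeWeight_sq_le hs hs (fun v => ?_) i).trans ?_)
      · rw [sub_self, zero_mul]
        exact Finset.sum_nonneg fun _ _ => sq_nonneg _
      · gcongr
        exact h.norm_sq_le _
    have h1 := lintegral_exp_sum_le_one hη hbdd hreg hmt (c := (√V)⁻¹ * √(B / s))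
      (fun j x => by
        rw [abs_mul, abs_mul, hσ1, one_mul, abs_of_pos (inv_pos.2 hsV)]
        exact mul_le_mul_of_nonneg_left (hw j x) (inv_nonneg.2 hsV.le)) Finset.univ
    have hfst : Measurable fun x : ι → X × ℝ => fun i => (x i).1 :=
      measurable_pi_lambda _ fun i => measurable_fst.comp (measurable_pi_apply i)
    have hmeas : Measurable fun x : ι → X × ℝ => ENNReal.ofReal (Real.exp
        (∑ k, (t k (fun i => (x i).1) * ((x k).2 - η (x k).1) -
          4 * t k (fun i => (x i).1) ^ 2))) := by
      refine ENNReal.measurable_ofReal.comp (Real.measurable_exp.comp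
        (Finset.measurable_sum _ fun j _ => ?_))
      have h1 : Measurable fun x : ι → X × ℝ => t j (fun i => (x i).1) := (hmt j).comp hfst
      have h2 : Measurable fun x : ι → X × ℝ => (x j).2 - η (x j).1 :=
        (measurable_snd.comp (measurable_pi_apply j)).sub
          (hη.comp (measurable_fst.comp (measurable_pi_apply j)))
      exact (h1.mul h2).sub ((h1.pow_const 2).const_mul 4)
    have h2 := (mul_meas_ge_le_lintegral (μ := Measure.pi ν) hmeas
      (ENNReal.ofReal (Real.exp (L - 4)))).trans h1
    have h3 : ENNReal.ofReal (Real.exp (4 - L)) = 1 / ENNReal.ofReal (Real.exp (L - 4)) := by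
      rw [one_div, ← ENNReal.ofReal_inv_of_pos (Real.exp_pos _), ← Real.exp_neg, neg_sub]
    rw [h3, ENNReal.le_div_iff_mul_le (Or.inl (by positivity)) (Or.inl ENNReal.ofReal_ne_top),
      mul_comm]
    refine le_trans (mul_le_mul_right (measure_mono ?_) _) h2
    rintro x ⟨hx1, hx2⟩
    refine ENNReal.ofReal_le_ofReal (Real.exp_le_exp.2 ?_)
    have hcoer : ∀ v, ((n + s) / 2 - s) * ‖v‖ ^ 2 ≤ ∑ j, inner ℝ (φ (x j).1) v ^ 2 := fun v => by
      have := hx1 v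
      nlinarith [sq_nonneg ‖v‖]
    have hlev : ∑ j, ridgeWeight s (fun k => φ (x k).1) i j ^ 2 ≤ V := by
      refine (sum_ridgeWeight_sq_le hs (by positivity : 0 < (n + s) / 2) hcoer i).trans ?_
      rw [hV, div_le_div_iff₀ (by positivity) (by positivity)]
      have := h.norm_sq_le (x i).1
      nlinarith
    have e1 : ∑ k, (t k (fun i => (x i).1) * ((x k).2 - η (x k).1) -
          4 * t k (fun i => (x i).1) ^ 2) =
        (√V)⁻¹ * (σ * ∑ j, ridgeWeight s (fun k => φ (x k).1) i j * ((x j).2 - η (x j).1)) -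
          4 * (V⁻¹ * ∑ j, ridgeWeight s (fun k => φ (x k).1) i j ^ 2) := by
      rw [Finset.sum_sub_distrib]
      simp only [Finset.mul_sum]
      congr 1
      · exact Finset.sum_congr rfl fun j _ => by simp only [t]; ring
      · refine Finset.sum_congr rfl fun j _ => ?_
        simp only [t]
        rw [mul_pow, mul_pow, hσ, inv_pow, Real.sq_sqrt hV0.le, one_mul]
    rw [e1]
    have h4 : L ≤ (√V)⁻¹ * (σ * ∑ j, ridgeWeight s (fun k => φ (x k).1) i j *
        ((x j).2 - η (x j).1)) := by
      rw [le_inv_mul_iff₀ hsV]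
      exact hx2
    have h5 : V⁻¹ * ∑ j, ridgeWeight s (fun k => φ (x k).1) i j ^ 2 ≤ 1 := by
      rw [inv_mul_le_iff₀ hV0, mul_one]
      exact hlev
    linarith
  refine (measure_mono (t := ⋃ i, ({x | (∀ v, (n / 2 : ℝ) * ‖v‖ ^ 2 ≤
        ∑ j, inner ℝ (φ (x j).1) v ^ 2) ∧
      √V * L ≤ 1 * ∑ j, ridgeWeight s (fun k => φ (x k).1) i j * ((x j).2 - η (x j).1)} ∪
      {x | (∀ v, (n / 2 : ℝ) * ‖v‖ ^ 2 ≤ ∑ j, inner ℝ (φ (x j).1) v ^ 2) ∧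
      √V * L ≤ -1 * ∑ j, ridgeWeight s (fun k => φ (x k).1) i j * ((x j).2 - η (x j).1)})
      ) ?_).trans ?_
  · rintro x ⟨hx, i, hi⟩
    refine Set.mem_iUnion.2 ⟨i, ?_⟩
    rcases le_abs.1 hi with h1 | h1
    · exact Or.inl ⟨hx, by rwa [one_mul]⟩
    · exact Or.inr ⟨hx, by rwa [neg_one_mul]⟩
  · refine (measure_iUnion_fintype_le _ _).trans ((Finset.sum_le_sum fun i _ =>
      (measure_union_le _ _).trans (add_le_add (key i 1 (by norm_num))
        (key i (-1) (by norm_num)))).trans (le_of_eq ?_))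
    rw [Finset.sum_const, Finset.card_univ, nsmul_eq_mul, ← two_mul]
    ring

end Design

/-! ### The kernel matrix of an orthonormal family -/

section Tail

variable {X K : Type*} [MeasurableSpace X] [Fintype K] {μ : Measure X}

/-- The kernel `∑ ℓ, v ℓ a * v ℓ b` of a finite family of features. -/
noncomputable def featureKernel (v : K → X → ℝ) (a b : X) : ℝ := ∑ ℓ, v ℓ a * v ℓ b

omit [MeasurableSpace X] in
lemma featureKernel_self_nonneg (v : K → X → ℝ) (a : X) : 0 ≤ featureKernel v a a :=
  Finset.sum_nonneg fun _ _ => mul_self_nonneg _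

lemma measurable_featureKernel {v : K → X → ℝ} (hv : ∀ ℓ, Measurable (v ℓ)) :
    Measurable (Function.uncurry (featureKernel v)) :=
  Finset.measurable_sum _ fun ℓ _ =>
    ((hv ℓ).comp measurable_fst).mul ((hv ℓ).comp measurable_snd)

variable [DecidableEq K]

omit [Fintype K] in
lemma memLp_two_of_orthonormal {v : K → X → ℝ} (hv : ∀ ℓ, Measurable (v ℓ))
    (ho : ∀ ℓ m, ∫ a, v ℓ a * v m a ∂μ = if ℓ = m then 1 else 0) (ℓ : K) :
    MemLp (v ℓ) 2 μ := by
  rw [memLp_two_iff_integrable_sq (hv ℓ).aestronglyMeasurable]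
  -- a Bochner integral that does not vanish is one of an integrable function
  by_contra hc
  have h1 := ho ℓ ℓ
  simp only [← pow_two] at h1
  rw [integral_undef hc] at h1
  simp at h1

lemma memLp_featureKernel {v : K → X → ℝ} (hv : ∀ ℓ, Measurable (v ℓ))
    (ho : ∀ ℓ m, ∫ a, v ℓ a * v m a ∂μ = if ℓ = m then 1 else 0) (c : X) :
    MemLp (featureKernel v c) 2 μ :=
  memLp_finsetSum _ fun ℓ _ => (memLp_two_of_orthonormal hv ho ℓ).const_mul _

/-- The reproducing property of the kernel of an orthonormal family. -/
lemma integral_featureKernel_sq {v : K → X → ℝ} (hv : ∀ ℓ, Measurable (v ℓ))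
    (ho : ∀ ℓ m, ∫ a, v ℓ a * v m a ∂μ = if ℓ = m then 1 else 0) (c : X) :
    ∫ a, featureKernel v c a ^ 2 ∂μ = featureKernel v c c := by
  have hi : ∀ ℓ m, Integrable (fun a => v ℓ a * v m a) μ := fun ℓ m =>
    (memLp_two_of_orthonormal hv ho ℓ).integrable_mul (memLp_two_of_orthonormal hv ho m)
  have e : ∀ a, featureKernel v c a ^ 2 =
      ∑ ℓ, ∑ m, (v ℓ c * v m c) * (v ℓ a * v m a) := fun a => by
    rw [pow_two, featureKernel, Finset.sum_mul_sum]
    exact Finset.sum_congr rfl fun ℓ _ => Finset.sum_congr rfl fun m _ => by ring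
  simp only [e]
  rw [integral_finsetSum _ fun ℓ _ => integrable_finsetSum _ fun m _ => (hi ℓ m).const_mul _]
  refine Finset.sum_congr rfl fun ℓ _ => ?_
  rw [integral_finsetSum _ fun m _ => (hi ℓ m).const_mul _]
  simp only [integral_const_mul, ho]
  simp

lemma lintegral_featureKernel_self {v : K → X → ℝ} (hv : ∀ ℓ, Measurable (v ℓ))
    (ho : ∀ ℓ m, ∫ a, v ℓ a * v m a ∂μ = if ℓ = m then 1 else 0) :
    ∫⁻ a, ENNReal.ofReal (featureKernel v a a) ∂μ = ENNReal.ofReal (Fintype.card K) := by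
  have hi : ∀ ℓ, Integrable (fun a => v ℓ a * v ℓ a) μ := fun ℓ =>
    (memLp_two_of_orthonormal hv ho ℓ).integrable_mul (memLp_two_of_orthonormal hv ho ℓ)
  have his : Integrable (fun a => featureKernel v a a) μ := integrable_finsetSum _ fun ℓ _ => hi ℓ
  rw [← ofReal_integral_eq_lintegral_ofReal his
    (ae_of_all _ fun a => featureKernel_self_nonneg v a)]
  simp only [featureKernel]
  rw [integral_finsetSum _ fun ℓ _ => hi ℓ]
  simp [ho]

variable {ι : Type*} [Fintype ι] [DecidableEq ι] [IsProbabilityMeasure μ]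

/-- Row sums of the absolute off-diagonal entries of the kernel matrix of an orthonormal family.
Each row is centred conditionally on its own sample point, so that a union bound over the rows
costs no more than the fluctuations of a whole row. -/
theorem measure_row_sum_ge_le {v : K → X → ℝ} (hv : ∀ ℓ, Measurable (v ℓ))
    (ho : ∀ ℓ m, ∫ a, v ℓ a * v m a ∂μ = if ℓ = m then 1 else 0) {t : ℝ} (ht : 0 < t) :
    Measure.pi (fun _ : ι => μ) {x | ∃ i, Fintype.card ι * √(featureKernel v (x i) (x i)) + t ≤
      ∑ k ∈ Finset.univ.erase i, |featureKernel v (x i) (x k)|} ≤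
      ENNReal.ofReal (Fintype.card ι ^ 2 * Fintype.card K / t ^ 2) := by
  have hmk := measurable_featureKernel hv
  set m : X → ℝ := fun c => ∫ a, |featureKernel v c a| ∂μ with hm
  have hmm : Measurable m :=
    (StronglyMeasurable.integral_prod_right
      (f := fun c a => |featureKernel v c a|) hmk.abs.stronglyMeasurable).measurable
  have hL2 : ∀ c, MemLp (fun a => |featureKernel v c a|) 2 μ := fun c =>
    (memLp_featureKernel hv ho c).abs
  have hi1 : ∀ c, Integrable (fun a => |featureKernel v c a|) μ := fun c =>
    (hL2 c).integrable one_le_two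
  have hi2 : ∀ c, Integrable (fun a => featureKernel v c a ^ 2) μ := fun c =>
    (memLp_featureKernel hv ho c).integrable_sq
  have hvar : ∀ c, ∫ a, (|featureKernel v c a| - m c) ^ 2 ∂μ =
      featureKernel v c c - m c ^ 2 := fun c => by
    have e : ∀ a, (|featureKernel v c a| - m c) ^ 2 =
        featureKernel v c a ^ 2 + (-(2 * m c) * |featureKernel v c a| + m c ^ 2) := fun a => by
      rw [← sq_abs (featureKernel v c a)]; ring
    have hi3 : Integrable (fun a => -(2 * m c) * |featureKernel v c a| + m c ^ 2) μ :=
      ((hi1 c).const_mul _).add (integrable_const _)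
    simp only [e]
    rw [integral_add (hi2 c) hi3, integral_add ((hi1 c).const_mul _) (integrable_const _),
      integral_const_mul, integral_featureKernel_sq hv ho]
    simp only [integral_const, probReal_univ, one_smul]
    change featureKernel v c c + (-(2 * m c) * m c + m c ^ 2) = _
    ring
  have hmle : ∀ c, m c ≤ √(featureKernel v c c) := fun c => by
    refine Real.le_sqrt_of_sq_le ?_
    have : 0 ≤ ∫ a, (|featureKernel v c a| - m c) ^ 2 ∂μ := integral_nonneg fun a => sq_nonneg _
    rw [hvar] at this
    linarith
  have hm0 : ∀ c, 0 ≤ m c := fun c => integral_nonneg fun a => abs_nonneg _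
  set n : ℝ := (Fintype.card ι : ℝ) with hn
  set z : ι → ι → (ι → X) → ℝ := fun i k x => |featureKernel v (x i) (x k)| - m (x i) with hz
  have hmz : ∀ i k, Measurable (z i k) := fun i k =>
    (hmk.comp (g := Function.uncurry (featureKernel v)) (f := fun x : ι → X => (x i, x k))
      ((measurable_pi_apply i).prodMk (measurable_pi_apply k))).abs.sub
      (hmm.comp (measurable_pi_apply i))
  have key : ∀ i, Measure.pi (fun _ : ι => μ) {x | t ≤ ∑ k ∈ Finset.univ.erase i, z i k x} ≤
      ENNReal.ofReal (n * Fintype.card K / t ^ 2) := by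
    intro i
    have hne : ∀ k ∈ Finset.univ.erase i, i ≠ k := fun k hk => (Finset.ne_of_mem_erase hk).symm
    have h1 := lintegral_sq_sum_le (μ := fun _ : ι => μ) (Finset.univ.erase i) (z := z i)
      (v := fun x => featureKernel v (x i) (x i)) (hmz i)
      (hmk.comp (g := Function.uncurry (featureKernel v)) (f := fun x : ι → X => (x i, x i))
        ((measurable_pi_apply i).prodMk (measurable_pi_apply i)))
      (fun x => featureKernel_self_nonneg v _)
      (fun k hk j hj hjk x a => by
        simp only [hz]
        rw [Function.update_of_ne (hne k hk), Function.update_of_ne hjk])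
      (fun k hk x a => by simp only [Function.update_of_ne (hne k hk)])
      (fun k hk x => by
        simp only [hz, Function.update_of_ne (hne k hk), Function.update_self]
        exact (hL2 _).sub (memLp_const _))
      (fun k hk x => by
        simp only [hz, Function.update_of_ne (hne k hk), Function.update_self]
        rw [integral_sub (hi1 _) (integrable_const _)]
        simp [hm])
      (fun k hk x => by
        simp only [hz, Function.update_of_ne (hne k hk), Function.update_self]
        rw [hvar]
        linarith [sq_nonneg (m (x i))])
    have h2 : ∫⁻ x, ENNReal.ofReal (featureKernel v (x i) (x i)) ∂Measure.pi (fun _ : ι => μ) =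
        ENNReal.ofReal (Fintype.card K) := by
      rw [← lintegral_featureKernel_self hv ho]
      exact (measurePreserving_eval (fun _ : ι => μ) i).lintegral_comp
        (ENNReal.measurable_ofReal.comp (hmk.comp (measurable_id.prodMk measurable_id)))
    have hcard : ((Finset.univ.erase i).card : ENNReal) ≤ ENNReal.ofReal n := by
      rw [hn, ENNReal.ofReal_natCast]
      exact_mod_cast Finset.card_le_univ _
    rw [h2] at h1
    have h3 := h1.trans (mul_le_mul_left hcard _)
    rw [← ENNReal.ofReal_mul (by positivity)] at h3
    have hms : Measurable fun x => ENNReal.ofReal ((∑ k ∈ Finset.univ.erase i, z i k x) ^ 2) :=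
      ENNReal.measurable_ofReal.comp ((Finset.measurable_sum _ fun k _ => hmz i k).pow_const 2)
    have h4 := (mul_meas_ge_le_lintegral (μ := Measure.pi fun _ : ι => μ) hms
      (ENNReal.ofReal (t ^ 2))).trans h3
    rw [ENNReal.ofReal_div_of_pos (by positivity), ENNReal.le_div_iff_mul_le
      (Or.inl (by positivity)) (Or.inl ENNReal.ofReal_ne_top), mul_comm]
    refine le_trans (mul_le_mul_right (measure_mono fun x hx => ?_) _) h4
    exact ENNReal.ofReal_le_ofReal (pow_le_pow_left₀ ht.le hx 2)
  refine (measure_mono (t := ⋃ i, {x | t ≤ ∑ k ∈ Finset.univ.erase i, z i k x}) ?_).trans ?_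
  · rintro x ⟨i, hi⟩
    refine Set.mem_iUnion.2 ⟨i, ?_⟩
    change t ≤ ∑ k ∈ Finset.univ.erase i, z i k x
    simp only [hz]
    rw [Finset.sum_sub_distrib, Finset.sum_const, nsmul_eq_mul]
    have hcard : ((Finset.univ.erase i).card : ℝ) ≤ n := by
      rw [hn]
      exact_mod_cast Finset.card_le_univ _
    have : ((Finset.univ.erase i).card : ℝ) * m (x i) ≤ n * √(featureKernel v (x i) (x i)) := by
      exact mul_le_mul hcard (hmle _) (hm0 _) (by positivity)
    linarith
  · refine (measure_iUnion_fintype_le _ _).trans ((Finset.sum_le_sum fun i _ => key i).trans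
      (le_of_eq ?_))
    rw [Finset.sum_const, Finset.card_univ, nsmul_eq_mul, ← ENNReal.ofReal_natCast, ← hn,
      ← ENNReal.ofReal_mul (by positivity)]
    congr 1
    ring

end Tail

/-! ### Labelled samples -/

section Sample

variable {Ω X : Type*} [MeasurableSpace Ω] [MeasurableSpace X] {P : Measure Ω} {μ : Measure X}
  {η : X → ℝ} {n : ℕ} {x : Fin n → Ω → X} {y : Fin n → Ω → ℝ}

namespace IsLabeledSample

lemma congr_regression (h : IsLabeledSample P μ η x y) {η' : X → ℝ} (hη : η =ᵐ[μ] η') :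
    IsLabeledSample P μ η' x y where
  measurable_x := h.measurable_x
  measurable_y := h.measurable_y
  indep := h.indep
  law_x := h.law_x
  label := h.label
  regression i := by
    have h1 : ∀ᵐ ω ∂P, η (x i ω) = η' (x i ω) :=
      ae_of_ae_map (h.measurable_x i).aemeasurable (by rw [h.law_x i]; exact hη)
    exact (h.regression i).trans h1

lemma measurable_pair (h : IsLabeledSample P μ η x y) (i : Fin n) :
    Measurable fun ω => (x i ω, y i ω) :=
  (h.measurable_x i).prodMk (h.measurable_y i)

lemma ae_sample (h : IsLabeledSample P μ η x y) {p : X → Prop} (hp : ∀ᵐ a ∂μ, p a) :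
    ∀ᵐ ω ∂P, ∀ i, p (x i ω) :=
  ae_all_iff.2 fun i => ae_of_ae_map (h.measurable_x i).aemeasurable (by rw [h.law_x i]; exact hp)

variable [IsProbabilityMeasure P]

lemma map_pairs (h : IsLabeledSample P μ η x y) :
    P.map (fun ω i => (x i ω, y i ω)) = Measure.pi fun i => P.map fun ω => (x i ω, y i ω) :=
  (iIndepFun_iff_map_fun_eq_pi_map fun i => (h.measurable_pair i).aemeasurable).1 h.indep

lemma map_inputs (h : IsLabeledSample P μ η x y) :
    P.map (fun ω i => x i ω) = Measure.pi fun _ => μ := by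
  have h1 : iIndepFun (fun i ω => x i ω) P := h.indep.comp (fun _ => Prod.fst)
    fun _ => measurable_fst
  rw [(iIndepFun_iff_map_fun_eq_pi_map fun i => (h.measurable_x i).aemeasurable).1 h1]
  simp only [h.law_x]

omit [IsProbabilityMeasure P] in
lemma ae_abs_regression_le_one (h : IsLabeledSample P μ η x y) (hn : 0 < n)
    (hη : Measurable η) : ∀ᵐ a ∂μ, |η a| ≤ 1 := by
  let i : Fin n := ⟨0, hn⟩
  have h1 : ∀ᵐ ω ∂P, |y i ω| ≤ 1 := by
    filter_upwards [h.label i] with ω hω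
    rcases hω with e | e <;> rw [e] <;> simp
  have h2 := ae_bdd_abs_condExp_of_ae_bdd_abs (m := MeasurableSpace.comap (x i) inferInstance) h1
  rw [← h.law_x i, ae_map_iff (h.measurable_x i).aemeasurable
    (measurableSet_le hη.abs measurable_const)]
  filter_upwards [h2, h.regression i] with ω h3 h4
  rw [h4] at h3
  simpa using h3

lemma integral_mul_label (h : IsLabeledSample P μ η x y) (hη : Measurable η)
    (hb : ∀ᵐ a ∂μ, |η a| ≤ 1) (i : Fin n) {g : X → ℝ} (hg : Measurable g) {c : ℝ}
    (hgc : ∀ a, |g a| ≤ c) :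
    ∫ a, g a.1 * (a.2 - η a.1) ∂(P.map fun ω => (x i ω, y i ω)) = 0 := by
  have hx := h.measurable_x i
  have hle : MeasurableSpace.comap (x i) inferInstance ≤ (inferInstance : MeasurableSpace Ω) :=
    hx.comap_le
  have hmeas : Measurable fun a : X × ℝ => g a.1 * (a.2 - η a.1) :=
    (hg.comp measurable_fst).mul (measurable_snd.sub (hη.comp measurable_fst))
  rw [integral_map (h.measurable_pair i).aemeasurable hmeas.aestronglyMeasurable]
  have hiy : Integrable (y i) P := by
    refine Integrable.of_bound (h.measurable_y i).aestronglyMeasurable 1 ?_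
    filter_upwards [h.label i] with ω hω
    rcases hω with e | e <;> rw [e] <;> simp
  have hgm : Measurable[MeasurableSpace.comap (x i) inferInstance] fun ω => g (x i ω) :=
    hg.comp (comap_measurable (x i))
  have higy : Integrable (fun ω => g (x i ω) * y i ω) P :=
    hiy.bdd_mul (c := c) (hg.comp hx).aestronglyMeasurable (ae_of_all _ fun ω => hgc _)
  have hige : Integrable (fun ω => g (x i ω) * η (x i ω)) P := by
    refine Integrable.bdd_mul (c := c) ?_ (hg.comp hx).aestronglyMeasurable
      (ae_of_all _ fun ω => hgc _)
    refine Integrable.of_bound (hη.comp hx).aestronglyMeasurable 1 ?_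
    have := ae_of_ae_map hx.aemeasurable (p := fun a => |η a| ≤ 1) (by rw [h.law_x i]; exact hb)
    filter_upwards [this] with ω hω using hω
  have h1 : P[fun ω => g (x i ω) * y i ω|MeasurableSpace.comap (x i) inferInstance] =ᵐ[P]
      fun ω => g (x i ω) * η (x i ω) := by
    have h2 := condExp_mul_of_stronglyMeasurable_left (m := MeasurableSpace.comap (x i) inferInstance)
      hgm.stronglyMeasurable higy hiy
    filter_upwards [h2, h.regression i] with ω h3 h4
    have h5 : P[fun ω => g (x i ω) * y i ω|MeasurableSpace.comap (x i) inferInstance] ω =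
      g (x i ω) * P[y i|MeasurableSpace.comap (x i) inferInstance] ω := h3
    rw [h5, h4]
  simp only [mul_sub]
  rw [integral_sub higy hige, ← integral_condExp hle, integral_congr_ae h1, sub_self]

end IsLabeledSample

end Sample

/-! ### The failure probability for a fixed sample size -/

section Nonasymptotic

variable {Ω X : Type*} [MeasurableSpace Ω] [MeasurableSpace X] {P : Measure Ω}
  [IsProbabilityMeasure P] {μ : Measure X} [IsProbabilityMeasure μ] {n : ℕ}
  {x : Fin n → Ω → X} {y : Fin n → Ω → ℝ}
  {J K : Type*} [Fintype J] [DecidableEq J] [Fintype K] [DecidableEq K]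
  {B : ℝ} {φ : X → EuclideanSpace ℝ J} {θ : EuclideanSpace ℝ J} {v : K → X → ℝ}
  {H : Type*} [NormedAddCommGroup H] [InnerProductSpace ℝ H] [CompleteSpace H] [RKHS ℝ H X ℝ]

/-- Support vector proliferation fails with small probability for a kernel `⟪φ, φ⟫ + τ R` whose
leading part is bounded and isotropic and whose tail `R` comes from an orthonormal family with
nearly constant diagonal. The hypotheses `hbias`, `hnoise` and `hpert` compare the three sources of
error with the shrinkage `s / (n + s)` of ridge regression with penalty `s = τ |K|`. -/
theorem measure_not_supportVectorProliferation_le (h : IsBoundedIsotropic μ B φ) (hB : 1 ≤ B)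
    (hBn : B ≤ n) (hθ : ∀ a, |inner ℝ θ (φ a)| ≤ 1) (hv : ∀ ℓ, Measurable (v ℓ))
    (ho : ∀ ℓ m, ∫ a, v ℓ a * v m a ∂μ = if ℓ = m then 1 else 0)
    {T : ℝ} (hT : ∀ᵐ a ∂μ, |featureKernel v a a - Fintype.card K| ≤ T)
    (hxy : IsLabeledSample P μ (fun a => inner ℝ θ (φ a)) x y)
    {φ₀ : X → EuclideanSpace ℝ J} (hφ₀ : φ₀ =ᵐ[μ] φ) {τ s : ℝ} (hs : 0 < s)
    (hK : 0 < Fintype.card K) (hτ : s = τ * Fintype.card K)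
    (hH : ∀ a b, RKHS.kernel H a b 1 = inner ℝ (φ₀ a) (φ₀ b) + τ * featureKernel v a b)
    {L t : ℝ} (hL : 1 ≤ L) (ht : 0 < t)
    (hbias : (4 * √(B * n) * L + 16 * B * √B * L ^ 2) / n ≤ 1 / 4)
    (hnoise : √(2 * B / (n + s)) * L ≤ s / (4 * (n + s)))
    (hpert : (1 + √(2 * B)) * ((n * √(Fintype.card K + T) + t + T) / Fintype.card K) ≤
      s / (12 * (n + s))) :
    P {ω | ¬ SupportVectorProliferation H (fun i => x i ω) (fun i => y i ω)} ≤
      (ENNReal.ofReal (448 * B ^ 3 / n ^ 2) +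
        (2 * n + 1) * ENNReal.ofReal (2 * Real.exp (1 - L))) +
      (2 * n * ENNReal.ofReal (Real.exp (4 - L)) +
        ENNReal.ofReal (n ^ 2 * Fintype.card K / t ^ 2)) := by
  set D : ℝ := (Fintype.card K : ℝ) with hD
  have hD0 : 0 < D := by rw [hD]; exact_mod_cast hK
  have hη : Measurable fun a => (inner ℝ θ (φ a) : ℝ) := h.measurable.const_inner
  have hn : Fintype.card (Fin n) = n := Fintype.card_fin n
  -- the three exceptional events
  have hA1 := measure_not_isGoodDesign_le (ι := Fin n) h hB (by rwa [hn]) hθ hL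
  have hprob : ∀ i, IsProbabilityMeasure (P.map fun ω => (x i ω, y i ω)) := fun i =>
    Measure.isProbabilityMeasure_map (hxy.measurable_pair i).aemeasurable
  have hA2 := measure_noise_ge_le (ν := fun i => P.map fun ω => (x i ω, y i ω)) h hB hη
    (fun i => by
      have hm : Measurable fun a : X × ℝ => a.2 - inner ℝ θ (φ a.1) :=
        measurable_snd.sub (hη.comp measurable_fst)
      rw [ae_map_iff (hxy.measurable_pair i).aemeasurable
        (measurableSet_le hm.abs measurable_const)]
      filter_upwards [hxy.label i] with ω hω
      have h1 := abs_le.1 (hθ (x i ω))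
      rcases hω with e | e <;> rw [e, abs_le] <;> constructor <;> linarith)
    (fun i g hg ⟨c, hc⟩ => hxy.integral_mul_label hη (ae_of_all _ hθ) i hg hc) hs L
  have hA3 := measure_row_sum_ge_le (ι := Fin n) hv ho ht
  rw [hn] at hA1 hA2 hA3
  set A1 : Set (Fin n → X) := {x | ¬ IsGoodDesign φ θ
    ((4 * √(B * n) * L + 16 * B * √B * L ^ 2) / n) x}
  set A2 : Set (Fin n → X × ℝ) := {x | (∀ v, (n / 2 : ℝ) * ‖v‖ ^ 2 ≤
      ∑ j, inner ℝ (φ (x j).1) v ^ 2) ∧ ∃ i, √(2 * B / (n + s)) * L ≤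
        |∑ j, ridgeWeight s (fun k => φ (x k).1) i j * ((x j).2 - inner ℝ θ (φ (x j).1))|}
  set A3 : Set (Fin n → X) := {x | ∃ i, n * √(featureKernel v (x i) (x i)) + t ≤
      ∑ k ∈ Finset.univ.erase i, |featureKernel v (x i) (x k)|}
  have hmx : Measurable fun ω i => x i ω := measurable_pi_lambda _ hxy.measurable_x
  have hmp : Measurable fun ω i => (x i ω, y i ω) := measurable_pi_lambda _ hxy.measurable_pair
  have hae : ∀ᵐ ω ∂P, ω ∈ {ω | ¬ SupportVectorProliferation H (fun i => x i ω) (fun i => y i ω)} →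
      ω ∈ ((fun ω i => x i ω) ⁻¹' A1) ∪ (((fun ω i => (x i ω, y i ω)) ⁻¹' A2) ∪
        ((fun ω i => x i ω) ⁻¹' A3)) := by
    filter_upwards [ae_all_iff.2 hxy.label, hxy.ae_sample hT, hxy.ae_sample hφ₀] with ω h1 h2 h3
    intro hω
    by_contra hc
    simp only [Set.mem_union, not_or] at hc
    obtain ⟨c1, c2, c3⟩ := hc
    have c1 : IsGoodDesign φ θ ((4 * √(B * n) * L + 16 * B * √B * L ^ 2) / n) fun i => x i ω :=
      not_not.1 c1
    obtain ⟨c1a, c1b⟩ := c1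
    rw [hn] at c1a c1b
    have c2 : ∀ i, |∑ j, ridgeWeight s (fun k => φ (x k ω)) i j *
        (y j ω - inner ℝ θ (φ (x j ω)))| ≤ √(2 * B / (n + s)) * L := fun i => by
      by_contra hlt
      exact c2 ⟨c1a, i, (not_le.1 hlt).le⟩
    have c3 : ∀ i, ∑ k ∈ Finset.univ.erase i, |featureKernel v (x i ω) (x k ω)| ≤
        n * √(featureKernel v (x i ω) (x i ω)) + t := fun i => by
      by_contra hlt
      exact c3 ⟨i, (not_le.1 hlt).le⟩
    obtain ⟨α, hα, hpos⟩ := exists_dual_sign (κ := Fin n) hs (by linarith : 0 ≤ B)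
      (φ := fun i => φ (x i ω)) (θ := θ) (y := fun i => y i ω)
      (N := fun i j => (featureKernel v (x i ω) (x j ω) - if j = i then D else 0) / D)
      (ρ := (n * √(D + T) + t + T) / D) h1 (fun i => hθ _)
      (fun i => h.norm_sq_le _) (by rw [hn]; exact c1a)
      (fun i => by rw [hn]; exact (c1b s hs i).trans hbias)
      (fun i => by rw [hn]; exact (c2 i).trans hnoise)
      (fun i => by
        rw [← Finset.add_sum_erase _ _ (Finset.mem_univ i)]
        have e1 : ∑ j ∈ Finset.univ.erase i,
            |(featureKernel v (x i ω) (x j ω) - if j = i then D else 0) / D| =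
            (∑ j ∈ Finset.univ.erase i, |featureKernel v (x i ω) (x j ω)|) / D := by
          rw [Finset.sum_div]
          refine Finset.sum_congr rfl fun j hj => ?_
          rw [if_neg (Finset.ne_of_mem_erase hj), sub_zero, abs_div, abs_of_pos hD0]
        rw [e1, if_pos rfl, abs_div, abs_of_pos hD0, ← add_div]
        have h4 : √(featureKernel v (x i ω) (x i ω)) ≤ √(D + T) :=
          Real.sqrt_le_sqrt (by linarith [(abs_le.1 (h2 i)).2])
        have h5 : (n : ℝ) * √(featureKernel v (x i ω) (x i ω)) ≤ n * √(D + T) := by gcongr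
        refine div_le_div_of_nonneg_right ?_ hD0.le
        linarith [c3 i, h2 i])
      (by rw [hn]; exact hpert)
    refine hω (supportVectorProliferation_of_dual (α := α) h1 (fun i => ?_) hpos)
    rw [← hα i]
    have e2 : ∀ j, RKHS.kernel H (x i ω) (x j ω) 1 * α j =
        (inner ℝ (φ (x i ω)) (φ (x j ω)) +
          s * ((featureKernel v (x i ω) (x j ω) - if j = i then D else 0) / D)) * α j +
          if j = i then s * α i else 0 := fun j => by
      have h4 : τ = s / D := by rw [hτ]; field_simp
      rw [hH, h3 i, h3 j, h4]
      by_cases hj : j = i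
      · subst hj
        simp only [if_pos]
        field_simp
        ring
      · simp only [if_neg hj]
        field_simp
        ring
    rw [Finset.sum_congr rfl fun j _ => e2 j, Finset.sum_add_distrib, Finset.sum_ite_eq']
    simp
  refine (measure_mono_ae hae).trans ((measure_union_le _ _).trans (add_le_add ?_
    ((measure_union_le _ _).trans (add_le_add ?_ ?_))))
  · refine (Measure.le_map_apply hmx.aemeasurable A1).trans ?_
    rw [hxy.map_inputs]
    exact hA1
  · refine (Measure.le_map_apply hmp.aemeasurable A2).trans ?_
    rw [hxy.map_pairs]
    exact hA2
  · refine (Measure.le_map_apply hmx.aemeasurable A3).trans ?_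
    rw [hxy.map_inputs]
    exact hA3

end Nonasymptotic

/-! ### The two blocks of a bi-level ensemble -/

namespace BilevelEnsemble

variable {n : ℕ} {β q r : ℝ} {X : Type*} [MeasurableSpace X] {μ : Measure X}

/-- The indices of the leading features. -/
abbrev Leading (E : BilevelEnsemble n β q r μ) : Type := {ℓ : Fin E.d // (ℓ : ℕ) < E.p}

/-- The indices of the remaining features. -/
abbrev Trailing (E : BilevelEnsemble n β q r μ) : Type := {ℓ : Fin E.d // ¬ (ℓ : ℕ) < E.p}

/-- The vector of the leading features. -/
noncomputable def leadingMap (E : BilevelEnsemble n β q r μ) (a : X) :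
    EuclideanSpace ℝ E.Leading :=
  WithLp.toLp 2 fun ℓ => E.v ℓ a

lemma kernel_eq (E : BilevelEnsemble n β q r μ) (a b : X) :
    E.kernel a b = inner ℝ (E.leadingMap a) (E.leadingMap b) +
      (n : ℝ) ^ (-β + r + q) * featureKernel (fun ℓ : E.Trailing => E.v ℓ) a b := by
  rw [kernel, ← Fintype.sum_subtype_add_sum_subtype (fun ℓ : Fin E.d => (ℓ : ℕ) < E.p),
    PiLp.inner_apply, featureKernel, Finset.mul_sum]
  congr 1
  · exact Finset.sum_congr rfl fun ℓ _ => by simp [eigenvalue, leadingMap, ℓ.2, mul_comm]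
  · exact Finset.sum_congr rfl fun ℓ _ => by simp [eigenvalue, ℓ.2, mul_assoc]

lemma measurable_leadingMap (E : BilevelEnsemble n β q r μ) : Measurable E.leadingMap :=
  (PiLp.continuous_toLp 2 _).measurable.comp
    (measurable_pi_lambda _ fun ℓ : E.Leading => E.measurable_v ℓ)

lemma norm_leadingMap_sq (E : BilevelEnsemble n β q r μ) (a : X) :
    ‖E.leadingMap a‖ ^ 2 =
      ∑ ℓ ∈ Finset.univ.filter (fun ℓ : Fin E.d => (ℓ : ℕ) < E.p), E.v ℓ a ^ 2 := by
  rw [EuclideanSpace.norm_sq_eq, Finset.sum_subtype (F := inferInstanceAs (Fintype E.Leading))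
    (p := fun ℓ : Fin E.d => (ℓ : ℕ) < E.p) _ (by simp)]
  simp [leadingMap]

lemma exists_eq_inner_of_mem_G (E : BilevelEnsemble n β q r μ) {η : X → ℝ} (hη : η ∈ E.G) :
    ∃ θ : EuclideanSpace ℝ E.Leading, ∀ a, η a = inner ℝ θ (E.leadingMap a) := by
  have h1 : E.v '' {ℓ : Fin E.d | (ℓ : ℕ) < E.p} = Set.range fun ℓ : E.Leading => E.v ℓ := by
    ext f
    simp
  rw [G, h1, Submodule.mem_span_range_iff_exists_fun] at hη
  obtain ⟨c, hc⟩ := hη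
  refine ⟨WithLp.toLp 2 c, fun a => ?_⟩
  rw [← hc, PiLp.inner_apply]
  simp [leadingMap, mul_comm]

lemma featureKernel_trailing_sub (E : BilevelEnsemble n β q r μ) (a : X) :
    featureKernel (fun ℓ : E.Trailing => E.v ℓ) a a - Fintype.card E.Trailing =
      ∑ ℓ ∈ Finset.univ.filter (fun ℓ : Fin E.d => E.p ≤ (ℓ : ℕ)), (E.v ℓ a ^ 2 - 1) := by
  rw [Finset.sum_subtype (F := inferInstanceAs (Fintype E.Trailing))
    (p := fun ℓ : Fin E.d => ¬ (ℓ : ℕ) < E.p) _ (by simp), featureKernel,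
    Finset.sum_sub_distrib, Finset.sum_const, Finset.card_univ, nsmul_one]
  simp only [pow_two]

lemma card_trailing (E : BilevelEnsemble n β q r μ) (h : E.p ≤ E.d) :
    Fintype.card E.Trailing = E.d - E.p := by
  rw [Fintype.card_subtype_compl, Fintype.card_fin]
  congr 1
  rw [Fintype.card_subtype]
  have : Finset.univ.filter (fun ℓ : Fin E.d => (ℓ : ℕ) < E.p) =
      Finset.univ.map (Fin.castLEEmb h) := by
    ext ℓ
    simp only [Finset.mem_filter, Finset.mem_univ, true_and, Finset.mem_map]
    constructor
    · intro hl
      exact ⟨⟨ℓ, hl⟩, by ext; simp⟩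
    · rintro ⟨m, rfl⟩
      simp
  rw [this, Finset.card_map, Finset.card_univ, Fintype.card_fin]

/-- The leading features, cut off on a null set so that all bounds hold everywhere, are bounded and
isotropic. -/
lemma exists_isBoundedIsotropic [IsProbabilityMeasure μ] (E : BilevelEnsemble n β q r μ) {C : ℝ}
    (hC : E.IsBOS C) (hB : 0 ≤ C * E.p) (θ : EuclideanSpace ℝ E.Leading)
    (hθ : ∀ᵐ a ∂μ, |inner ℝ θ (E.leadingMap a)| ≤ 1) :
    ∃ φ : X → EuclideanSpace ℝ E.Leading, E.leadingMap =ᵐ[μ] φ ∧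
      IsBoundedIsotropic μ (C * E.p) φ ∧ ∀ a, |inner ℝ θ (φ a)| ≤ 1 := by
  classical
  have hmeas := E.measurable_leadingMap
  set S : Set X := {a | ‖E.leadingMap a‖ ^ 2 ≤ C * E.p ∧ |inner ℝ θ (E.leadingMap a)| ≤ 1}
  have hS : MeasurableSet S := by
    have e : S = {a | ‖E.leadingMap a‖ ^ 2 ≤ C * E.p} ∩
      {a | |inner ℝ θ (E.leadingMap a)| ≤ 1} := rfl
    rw [e]
    exact (measurableSet_le (hmeas.norm.pow_const 2) measurable_const).inter
      (measurableSet_le (hmeas.const_inner (c := θ)).abs measurable_const)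
  have hae : E.leadingMap =ᵐ[μ] S.indicator E.leadingMap := by
    filter_upwards [hC, hθ] with a h1 h2
    rw [Set.indicator_of_mem]
    exact ⟨by rw [norm_leadingMap_sq]; exact h1, h2⟩
  refine ⟨S.indicator E.leadingMap, hae, ⟨hmeas.indicator hS, fun a => ?_, fun i j => ?_⟩,
    fun a => ?_⟩
  · by_cases ha : a ∈ S
    · rw [Set.indicator_of_mem ha]; exact ha.1
    · rw [Set.indicator_of_notMem ha]; simpa using hB
  · have h1 : ∫ a, S.indicator E.leadingMap a i * S.indicator E.leadingMap a j ∂μ =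
        ∫ a, E.v i a * E.v j a ∂μ := by
      refine integral_congr_ae ?_
      filter_upwards [hae] with a ha
      rw [← ha]
      simp [leadingMap]
    rw [h1, E.orthonormal_v]
    simp [Subtype.ext_iff]
  · by_cases ha : a ∈ S
    · rw [Set.indicator_of_mem ha]; exact ha.2
    · rw [Set.indicator_of_notMem ha]; simp

end BilevelEnsemble

/-! ### The exponents -/

section Asymptotics

lemma eventually_mul_rpow_le {a : ℝ} (ha : a < 0) (c : ℝ) {ε : ℝ} (hε : 0 < ε) :
    ∀ᶠ n : ℕ in atTop, c * (n : ℝ) ^ a ≤ ε := by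
  have h1 : Tendsto (fun x : ℝ => x ^ a) atTop (𝓝 0) := by
    have := tendsto_rpow_neg_atTop (neg_pos.2 ha)
    simpa using this
  have h2 := (h1.comp tendsto_natCast_atTop_atTop).const_mul c
  rw [mul_zero] at h2
  exact h2.eventually (ge_mem_nhds hε)

lemma sqrt_mul_rpow {n : ℝ} (hn : 0 ≤ n) {b : ℝ} (hb : 0 ≤ b) (a : ℝ) :
    √(b * n ^ a) = √b * n ^ (a / 2) := by
  rw [Real.sqrt_mul hb, Real.sqrt_eq_rpow (n ^ a), ← Real.rpow_mul hn]
  ring_nf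

lemma sqrt_div_mul_le {B N s L : ℝ} (hB : 0 ≤ B) (hN : 0 ≤ N) (hs : 0 < s)
    (h₁ : 64 * (B * L ^ 2) * N ≤ s ^ 2) (h₂ : 64 * (B * L ^ 2) ≤ s) :
    √(2 * B / (N + s)) * L ≤ s / (4 * (N + s)) := by
  have hNs : 0 < N + s := by linarith
  have h₃ : 32 * (B * L ^ 2) * (N + s) ≤ s ^ 2 := by
    have := mul_le_mul_of_nonneg_right h₂ hs.le
    linarith
  refine le_of_sq_le_sq ?_ (by positivity)
  rw [mul_pow, Real.sq_sqrt (by positivity), div_pow, div_mul_eq_mul_div,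
    div_le_div_iff₀ (by positivity) (by positivity)]
  have := mul_le_mul_of_nonneg_right h₃ hNs.le
  linarith

/-- The exponents: there is room for an extra factor `n ^ δ` in each of the three comparisons of an
error with the shrinkage `s / (n + s)`. The leading terms ask for `r < 2 / 3` in the bias, for
`q > (1 - r) / 2` in the noise and, with that, for `β > 3` in the perturbation. -/
lemma exists_eventually_bounds {β q r : ℝ} (hβ : 3 < β) (hr₀ : 0 < r) (hr : r < 2 / 3)
    (hq : (1 - r) / 2 < q) {b c : ℝ} (hb : 0 ≤ b) (hc : 0 ≤ c) :
    ∃ δ : ℝ, 0 < δ ∧ ∀ᶠ n : ℕ in atTop, ∀ B D s : ℝ, 1 ≤ B → B ≤ b * (n : ℝ) ^ r →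
      (n : ℝ) ^ β / 2 ≤ D → D ≤ 2 * (n : ℝ) ^ β → s = (n : ℝ) ^ (-β + r + q) * D →
      B ≤ n ∧
      (4 * √(B * n) * (n : ℝ) ^ δ + 16 * B * √B * ((n : ℝ) ^ δ) ^ 2) / n ≤ 1 / 4 ∧
      √(2 * B / (n + s)) * (n : ℝ) ^ δ ≤ s / (4 * (n + s)) ∧
      (1 + √(2 * B)) * ((n * √(D + c * (n : ℝ) ^ (β / 2 + 1)) + (n : ℝ) ^ (1 + β / 2 + δ) +
        c * (n : ℝ) ^ (β / 2 + 1)) / D) ≤ s / (12 * (n + s)) := by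
  obtain ⟨δ, hδ, h1, h2, h3⟩ : ∃ δ : ℝ, 0 < δ ∧ 8 * δ ≤ 1 - 3 / 2 * r ∧
      8 * δ ≤ 2 * q + r - 1 ∧ 8 * δ ≤ β - 3 := by
    refine ⟨min (1 - 3 / 2 * r) (min (2 * q + r - 1) (β - 3)) / 8, ?_, ?_, ?_, ?_⟩
    · refine div_pos (lt_min (by linarith) (lt_min (by linarith) (by linarith))) (by norm_num)
    · linarith [min_le_left (1 - 3 / 2 * r) (min (2 * q + r - 1) (β - 3))]
    · linarith [min_le_right (1 - 3 / 2 * r) (min (2 * q + r - 1) (β - 3)),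
        min_le_left (2 * q + r - 1) (β - 3)]
    · linarith [min_le_right (1 - 3 / 2 * r) (min (2 * q + r - 1) (β - 3)),
        min_le_right (2 * q + r - 1) (β - 3)]
  refine ⟨δ, hδ, ?_⟩
  set c₁ : ℝ := √(2 + c) + 1 + c with hc₁
  have hc₁0 : 0 ≤ c₁ := by positivity
  set c₂ : ℝ := 6 * √b * c₁ with hc₂
  filter_upwards [eventually_ge_atTop 1,
    eventually_mul_rpow_le (by linarith : r - 1 < 0) b one_pos,
    eventually_mul_rpow_le (by linarith : (r + 1) / 2 + δ - 1 < 0) (4 * √b)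
      (by norm_num : (0 : ℝ) < 1 / 8),
    eventually_mul_rpow_le (by linarith : r + r / 2 + 2 * δ - 1 < 0) (16 * b * √b)
      (by norm_num : (0 : ℝ) < 1 / 8),
    eventually_mul_rpow_le (by linarith : r + 2 * δ + 1 - 2 * (r + q) < 0) (256 * b) one_pos,
    eventually_mul_rpow_le (by linarith : r + 2 * δ - (r + q) < 0) (128 * b) one_pos,
    eventually_mul_rpow_le (by linarith : r / 2 + (1 - β / 2 + δ) + 1 - (r + q) < 0) (48 * c₂)
      one_pos,
    eventually_mul_rpow_le (by linarith : r / 2 + (1 - β / 2 + δ) < 0) (24 * c₂) one_pos]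
    with n hn e1 e2 e3 e4 e5 e6 e7
  intro B D s hB hBb hD1 hD2 hs
  have hn1 : (1 : ℝ) ≤ n := by exact_mod_cast hn
  set N : ℝ := (n : ℝ) with hN
  have hn0 : 0 < N := by linarith
  have hB0 : 0 ≤ B := by linarith
  have hp : ∀ a : ℝ, 0 < N ^ a := fun a => Real.rpow_pos_of_pos hn0 a
  -- a power inequality with a negative gap in the exponents, cleared of denominators
  have clear : ∀ {k a a' : ℝ}, k * N ^ (a - a') ≤ 1 → k * N ^ a ≤ N ^ a' := fun {k a a'} hk => by
    rw [Real.rpow_sub hn0, ← mul_div_assoc] at hk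
    exact (div_le_one (hp _)).1 hk
  have hD0 : 0 < D := lt_of_lt_of_le (by have := hp β; positivity) hD1
  have hs1 : N ^ (r + q) / 2 ≤ s := by
    rw [hs]
    calc N ^ (r + q) / 2 = N ^ (-β + r + q) * (N ^ β / 2) := by
          rw [← mul_div_assoc, ← Real.rpow_add hn0]; ring_nf
      _ ≤ _ := mul_le_mul_of_nonneg_left hD1 (hp _).le
  have hs0 : 0 < s := lt_of_lt_of_le (by have := hp (r + q); positivity) hs1
  have hsB : √B ≤ √b * N ^ (r / 2) := by
    rw [← sqrt_mul_rpow hn0.le hb]; exact Real.sqrt_le_sqrt hBb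
  refine ⟨?_, ?_, ?_, ?_⟩
  · have := clear e1
    rw [Real.rpow_one] at this
    exact hBb.trans this
  · have g1 : √(B * N) ≤ √b * N ^ ((r + 1) / 2) := by
      rw [← sqrt_mul_rpow hn0.le hb, Real.rpow_add hn0, Real.rpow_one, ← mul_assoc]
      exact Real.sqrt_le_sqrt (by gcongr)
    have g2 : B * √B ≤ b * √b * N ^ (r + r / 2) := by
      calc B * √B ≤ (b * N ^ r) * (√b * N ^ (r / 2)) := by gcongr
        _ = _ := by rw [Real.rpow_add hn0]; ring
    have g3 : (N ^ δ) ^ 2 = N ^ (2 * δ) := by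
      rw [← Real.rpow_natCast, ← Real.rpow_mul hn0.le]; ring_nf
    rw [add_div]
    have i1 : 4 * √(B * N) * N ^ δ / N ≤ 1 / 8 := by
      refine le_trans ?_ e2
      rw [Real.rpow_sub hn0, Real.rpow_one, Real.rpow_add hn0, ← mul_div_assoc]
      refine div_le_div_of_nonneg_right ?_ hn0.le
      calc 4 * √(B * N) * N ^ δ ≤ 4 * (√b * N ^ ((r + 1) / 2)) * N ^ δ := by
            have := (hp δ).le
            gcongr
        _ = _ := by ring
    have i2 : 16 * B * √B * (N ^ δ) ^ 2 / N ≤ 1 / 8 := by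
      refine le_trans ?_ e3
      rw [g3, Real.rpow_sub hn0, Real.rpow_one, Real.rpow_add hn0 (r + r / 2), ← mul_div_assoc]
      refine div_le_div_of_nonneg_right ?_ hn0.le
      calc 16 * B * √B * N ^ (2 * δ) = 16 * (B * √B) * N ^ (2 * δ) := by ring
        _ ≤ 16 * (b * √b * N ^ (r + r / 2)) * N ^ (2 * δ) := by
            have := (hp (2 * δ)).le
            gcongr
        _ = _ := by ring
    linarith
  · have g3 : (N ^ δ) ^ 2 = N ^ (2 * δ) := by
      rw [← Real.rpow_natCast, ← Real.rpow_mul hn0.le]; ring_nf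
    have g4 : B * (N ^ δ) ^ 2 ≤ b * N ^ (r + 2 * δ) := by
      rw [g3, Real.rpow_add hn0, ← mul_assoc]
      exact mul_le_mul_of_nonneg_right hBb (hp _).le
    have k2 : (N ^ (r + q)) ^ 2 ≤ 4 * s ^ 2 := by
      calc (N ^ (r + q)) ^ 2 ≤ (2 * s) ^ 2 := pow_le_pow_left₀ (hp _).le (by linarith) 2
        _ = 4 * s ^ 2 := by ring
    refine sqrt_div_mul_le hB0 hn0.le hs0 ?_ ?_
    · have k1 := clear e4
      have k3 : N ^ (2 * (r + q)) = (N ^ (r + q)) ^ 2 := by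
        rw [← Real.rpow_natCast, ← Real.rpow_mul hn0.le]; ring_nf
      rw [k3, Real.rpow_add hn0, Real.rpow_one] at k1
      have k4 : B * (N ^ δ) ^ 2 * N ≤ b * N ^ (r + 2 * δ) * N :=
        mul_le_mul_of_nonneg_right g4 hn0.le
      linarith
    · have k1 := clear e5
      linarith
  · have g5 : 1 + √(2 * B) ≤ 3 * (√b * N ^ (r / 2)) := by
      have k1 : 1 ≤ √B := Real.one_le_sqrt.2 hB
      have k2 : √(2 * B) ≤ 2 * √B := by
        rw [Real.sqrt_mul (by norm_num)]
        gcongr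
        rw [Real.sqrt_le_left (by norm_num)]
        norm_num
      linarith
    have g6 : N ^ (β / 2 + 1) ≤ N ^ (1 + β / 2 + δ) :=
      Real.rpow_le_rpow_of_exponent_le hn1 (by linarith)
    have g7 : N * √(D + c * N ^ (β / 2 + 1)) ≤ √(2 + c) * N ^ (1 + β / 2 + δ) := by
      have k1 : N ^ (β / 2 + 1) ≤ N ^ β :=
        Real.rpow_le_rpow_of_exponent_le hn1 (by linarith)
      have k2 : √(D + c * N ^ (β / 2 + 1)) ≤ √(2 + c) * N ^ (β / 2) := by
        rw [← sqrt_mul_rpow hn0.le (by positivity)]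
        refine Real.sqrt_le_sqrt ?_
        have : c * N ^ (β / 2 + 1) ≤ c * N ^ β := by gcongr
        linarith
      calc N * √(D + c * N ^ (β / 2 + 1)) ≤ N * (√(2 + c) * N ^ (β / 2)) := by gcongr
        _ = √(2 + c) * N ^ (β / 2 + 1) := by rw [Real.rpow_add hn0, Real.rpow_one]; ring
        _ ≤ _ := by gcongr
    have g8 : (N * √(D + c * N ^ (β / 2 + 1)) + N ^ (1 + β / 2 + δ) + c * N ^ (β / 2 + 1)) / D ≤
        2 * c₁ * N ^ (1 - β / 2 + δ) := by
      have k1 : c * N ^ (β / 2 + 1) ≤ c * N ^ (1 + β / 2 + δ) := by gcongr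
      have k2 : N ^ (1 + β / 2 + δ) = N ^ (1 - β / 2 + δ) * N ^ β := by
        rw [← Real.rpow_add hn0]; ring_nf
      rw [div_le_iff₀ hD0]
      calc _ ≤ c₁ * N ^ (1 + β / 2 + δ) := by rw [hc₁]; linarith
        _ = 2 * c₁ * N ^ (1 - β / 2 + δ) * (N ^ β / 2) := by rw [k2]; ring
        _ ≤ _ := by
            have := (hp (1 - β / 2 + δ)).le
            gcongr
    have g9 : (1 + √(2 * B)) * ((N * √(D + c * N ^ (β / 2 + 1)) + N ^ (1 + β / 2 + δ) +
        c * N ^ (β / 2 + 1)) / D) ≤ c₂ * N ^ (r / 2 + (1 - β / 2 + δ)) := by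
      have := (hp (r / 2)).le
      have := (hp (1 + β / 2 + δ)).le
      have := (hp (β / 2 + 1)).le
      calc _ ≤ 3 * (√b * N ^ (r / 2)) * (2 * c₁ * N ^ (1 - β / 2 + δ)) := by gcongr
        _ = _ := by rw [Real.rpow_add hn0 (r / 2), hc₂]; ring
    refine g9.trans ?_
    rw [le_div_iff₀ (by positivity)]
    have k1 := clear e6
    rw [Real.rpow_add hn0 _ 1, Real.rpow_one] at k1
    set w := c₂ * N ^ (r / 2 + (1 - β / 2 + δ))
    have k2 : 24 * w ≤ 1 := by simpa [w, mul_assoc] using e7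
    have k3 : 48 * (w * N) ≤ N ^ (r + q) := by
      refine le_trans (le_of_eq ?_) k1
      simp only [w]; ring
    have k4 := mul_le_mul_of_nonneg_right k2 hs0.le
    linarith

/-- The bound on the failure probability at `B = b n ^ r`, `L = n ^ δ` and `t = n ^ (1 + β / 2 + δ)`
tends to `0`. The power `3 r - 2` comes from the lower bound on the scatter operator. -/
lemma tendsto_failure {r δ : ℝ} (hr : r < 2 / 3) (hδ : 0 < δ) (b : ℝ) :
    Tendsto (fun n : ℕ => 448 * b ^ 3 * (n : ℝ) ^ (3 * r - 2) +
      (2 * n + 1) * (2 * Real.exp (1 - (n : ℝ) ^ δ)) + 2 * n * Real.exp (4 - (n : ℝ) ^ δ) +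
      2 * (n : ℝ) ^ (-(2 * δ))) atTop (𝓝 0) := by
  have hneg : ∀ a : ℝ, a < 0 → Tendsto (fun n : ℕ => (n : ℝ) ^ a) atTop (𝓝 0) := fun a ha => by
    have := (tendsto_rpow_neg_atTop (neg_pos.2 ha)).comp tendsto_natCast_atTop_atTop
    simpa [Function.comp_def] using this
  have hpow : Tendsto (fun n : ℕ => (n : ℝ) ^ δ) atTop atTop :=
    (tendsto_rpow_atTop hδ).comp tendsto_natCast_atTop_atTop
  have hexp : Tendsto (fun n : ℕ => Real.exp (-(n : ℝ) ^ δ)) atTop (𝓝 0) :=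
    Real.tendsto_exp_neg_atTop_nhds_zero.comp hpow
  have hnexp : Tendsto (fun n : ℕ => (n : ℝ) * Real.exp (-(n : ℝ) ^ δ)) atTop (𝓝 0) := by
    have h1 := (tendsto_rpow_mul_exp_neg_mul_atTop_nhds_zero (1 / δ) 1 one_pos).comp hpow
    refine h1.congr fun n => ?_
    simp only [Function.comp]
    rw [← Real.rpow_mul (Nat.cast_nonneg n), mul_one_div_cancel hδ.ne', Real.rpow_one, neg_one_mul]
  have h1 := (hneg (3 * r - 2) (by linarith)).const_mul (448 * b ^ 3)
  have h2 := (hnexp.const_mul (4 * Real.exp 1)).add (hexp.const_mul (2 * Real.exp 1))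
  have h3 := hnexp.const_mul (2 * Real.exp 4)
  have h4 := (hneg (-(2 * δ)) (by linarith)).const_mul 2
  have h5 := ((h1.add h2).add h3).add h4
  simp only [mul_zero, add_zero] at h5
  refine h5.congr fun n => ?_
  rw [sub_eq_add_neg 1, sub_eq_add_neg 4, Real.exp_add, Real.exp_add]
  ring

end Asymptotics

/-! ### The failure probability of a bi-level ensemble -/

namespace BilevelEnsemble

variable {n : ℕ} {β q r : ℝ}

lemma IsBOS.mono {X : Type*} [MeasurableSpace X] {μ : Measure X} {E : BilevelEnsemble n β q r μ}
    {C C' : ℝ} (h : E.IsBOS C) (hC : C ≤ C') : E.IsBOS C' := by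
  filter_upwards [h] with a ha
  exact ha.trans (mul_le_mul_of_nonneg_right hC (Nat.cast_nonneg _))

/-- The non-asymptotic bound for a bi-level ensemble, with all error terms real. -/
theorem measure_not_supportVectorProliferation_le {Ω X : Type*} [MeasurableSpace Ω]
    [MeasurableSpace X] {P : Measure Ω} [IsProbabilityMeasure P] {μ : Measure X}
    [IsProbabilityMeasure μ] (E : BilevelEnsemble n β q r μ) {H : Type*} [NormedAddCommGroup H]
    [InnerProductSpace ℝ H] [CompleteSpace H] [RKHS ℝ H X ℝ]
    (hH : ∀ a b, RKHS.kernel H a b 1 = E.kernel a b) {η : X → ℝ} (hη : η ∈ E.G)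
    {x : Fin n → Ω → X} {y : Fin n → Ω → ℝ} (hxy : IsLabeledSample P μ η x y) (hn : 0 < n)
    {B C D T s L t : ℝ} (hBOS : E.IsBOS C) (hshell : ∀ᵐ a ∂μ,
      |∑ ℓ ∈ Finset.univ.filter (fun ℓ : Fin E.d => E.p ≤ (ℓ : ℕ)), (E.v ℓ a ^ 2 - 1)| ≤ T)
    (hBC : B = C * E.p) (hD : D = E.d - E.p) (hD0 : 0 < D) (hs : s = (n : ℝ) ^ (-β + r + q) * D)
    (hB : 1 ≤ B) (hBn : B ≤ n) (hL : 1 ≤ L) (ht : 0 < t)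
    (hbias : (4 * √(B * n) * L + 16 * B * √B * L ^ 2) / n ≤ 1 / 4)
    (hnoise : √(2 * B / (n + s)) * L ≤ s / (4 * (n + s)))
    (hpert : (1 + √(2 * B)) * ((n * √(D + T) + t + T) / D) ≤ s / (12 * (n + s))) :
    P {ω | ¬ SupportVectorProliferation H (fun i => x i ω) (fun i => y i ω)} ≤
      ENNReal.ofReal (448 * B ^ 3 / n ^ 2 + (2 * n + 1) * (2 * Real.exp (1 - L)) +
        2 * n * Real.exp (4 - L) + n ^ 2 * D / t ^ 2) := by
  have hpd : E.p ≤ E.d := by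
    have : (E.p : ℝ) ≤ E.d := by linarith
    exact_mod_cast this
  have hcard : (Fintype.card E.Trailing : ℝ) = D := by
    rw [E.card_trailing hpd, Nat.cast_sub hpd, hD]
  obtain ⟨θ, hθ⟩ := E.exists_eq_inner_of_mem_G hη
  have hηm : Measurable η := by
    rw [show η = fun a => inner ℝ θ (E.leadingMap a) from funext hθ]
    exact E.measurable_leadingMap.const_inner
  have hη1 : ∀ᵐ a ∂μ, |inner ℝ θ (E.leadingMap a)| ≤ 1 := by
    filter_upwards [hxy.ae_abs_regression_le_one hn hηm] with a ha
    rwa [← hθ]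
  obtain ⟨φ, hae, hφ, hθφ⟩ := E.exists_isBoundedIsotropic hBOS (by linarith) θ hη1
  rw [← hBC] at hφ
  have hxy' : IsLabeledSample P μ (fun a => inner ℝ θ (φ a)) x y := by
    refine hxy.congr_regression ?_
    filter_upwards [hae] with a ha
    rw [hθ, ha]
  have hs0 : 0 < s := by
    rw [hs]
    exact mul_pos (Real.rpow_pos_of_pos (by exact_mod_cast hn) _) hD0
  refine (_root_.measure_not_supportVectorProliferation_le (v := fun ℓ : E.Trailing => E.v ℓ)
    (T := T) (τ := (n : ℝ) ^ (-β + r + q)) hφ hB hBn hθφ (fun ℓ => E.measurable_v ℓ)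
    (fun ℓ m => ?_) ?_ hxy' hae hs0 ?_ (by rw [hcard, hs]) (fun a b => by rw [hH, E.kernel_eq])
    hL ht hbias hnoise (by rwa [hcard])).trans (le_of_eq ?_)
  · rw [E.orthonormal_v]
    simp [Subtype.ext_iff]
  · filter_upwards [hshell] with a ha
    rwa [featureKernel_trailing_sub]
  · have : (0 : ℝ) < Fintype.card E.Trailing := by rwa [hcard]
    exact_mod_cast this
  · have e1 := (Real.exp_pos (1 - L)).le
    have e2 := (Real.exp_pos (4 - L)).le
    have e3 : (2 * n + 1 : ENNReal) = ENNReal.ofReal (2 * n + 1) := by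
      rw [ENNReal.ofReal_add (by positivity) zero_le_one, ENNReal.ofReal_mul zero_le_two]
      simp
    have e4 : (2 * n : ENNReal) = ENNReal.ofReal (2 * n) := by
      rw [ENNReal.ofReal_mul zero_le_two]
      simp
    have hB0 : 0 ≤ B := by linarith
    rw [hcard, e3, e4, ← ENNReal.ofReal_mul (by positivity), ← ENNReal.ofReal_mul (by positivity),
      ← ENNReal.ofReal_add (by positivity) (by positivity),
      ← ENNReal.ofReal_add (by positivity) (by positivity),
      ← ENNReal.ofReal_add (by positivity) (by positivity)]
    congr 1
    ring

end BilevelEnsemble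

theorem corollary1 {β q r : ℝ} (hβ : 3 < β) (hr₀ : 0 < r) (hr : r < 2 / 3)
    (hq : (1 - r) / 2 < q) (hqβ : q ≤ β - r)
    -- for every `n`: a probability space, a bi-level ensemble over it, and its RKHS
    {X : ℕ → Type*} [∀ n, MeasurableSpace (X n)] (μ : ∀ n, Measure (X n))
    [∀ n, IsProbabilityMeasure (μ n)] (E : ∀ n, BilevelEnsemble n β q r (μ n))
    (hBOS : ∃ C : ℝ, ∀ n, (E n).IsBOS C) (hshell : ∃ C : ℝ, ∀ n, (E n).ThinShell C)
    (H : ℕ → Type*) [∀ n, NormedAddCommGroup (H n)] [∀ n, InnerProductSpace ℝ (H n)]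
    [∀ n, CompleteSpace (H n)] [∀ n, RKHS ℝ (H n) (X n) ℝ]
    (hH : ∀ n x x', RKHS.kernel (H n) x x' 1 = (E n).kernel x x')
    -- the regression function and the training data
    (η : ∀ n, X n → ℝ) (hη : ∀ n, η n ∈ (E n).G)
    {Ω : ℕ → Type*} [∀ n, MeasurableSpace (Ω n)] (P : ∀ n, Measure (Ω n))
    [∀ n, IsProbabilityMeasure (P n)]
    (x : ∀ n, Fin n → Ω n → X n) (y : ∀ n, Fin n → Ω n → ℝ)
    (hxy : ∀ n, IsLabeledSample (P n) (μ n) (η n) (x n) (y n)) :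
    Tendsto (fun n => P n {ω | SupportVectorProliferation (H n)
      (fun i => x n i ω) (fun i => y n i ω)}) atTop (𝓝 1) := by
  obtain ⟨C₀, hC₀⟩ := hBOS
  obtain ⟨c₀, hc₀⟩ := hshell
  set C : ℝ := max C₀ 1 with hC
  set c : ℝ := max c₀ 0 with hc
  have hC1 : 1 ≤ C := le_max_right _ _
  have hc0 : 0 ≤ c := le_max_right _ _
  -- `C ≥ 1` makes `B = C p` at least `1`, and `B ≤ 2 C n ^ r` whichever way `p` is rounded
  obtain ⟨δ, hδ, hev⟩ := exists_eventually_bounds hβ hr₀ hr hq (b := 2 * C) (c := c)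
    (by linarith) hc0
  have hG := tendsto_failure hr hδ (2 * C)
  set G : ℕ → ℝ := fun n => 448 * (2 * C) ^ 3 * (n : ℝ) ^ (3 * r - 2) +
    (2 * n + 1) * (2 * Real.exp (1 - (n : ℝ) ^ δ)) + 2 * n * Real.exp (4 - (n : ℝ) ^ δ) +
    2 * (n : ℝ) ^ (-(2 * δ)) with hGdef
  suffices hfail : ∀ᶠ n : ℕ in atTop, P n {ω | ¬ SupportVectorProliferation (H n)
      (fun i => x n i ω) (fun i => y n i ω)} ≤ ENNReal.ofReal (G n) by
    have hlow : Tendsto (fun n => 1 - ENNReal.ofReal (G n)) atTop (𝓝 1) := by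
      have h1 := ENNReal.Tendsto.sub (tendsto_const_nhds (x := (1 : ENNReal)))
        (ENNReal.tendsto_ofReal hG) (Or.inl ENNReal.one_ne_top)
      simpa using h1
    refine tendsto_of_tendsto_of_tendsto_of_le_of_le' hlow tendsto_const_nhds ?_
      (Eventually.of_forall fun n => prob_le_one)
    filter_upwards [hfail] with n hn
    rw [tsub_le_iff_right]
    -- only subadditivity is needed, so the event may be non-measurable
    calc (1 : ENNReal) = P n Set.univ := measure_univ.symm
      _ ≤ P n ({ω | SupportVectorProliferation (H n) (fun i => x n i ω) (fun i => y n i ω)} ∪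
          {ω | ¬ SupportVectorProliferation (H n) (fun i => x n i ω) (fun i => y n i ω)}) :=
        measure_mono fun ω _ => em _
      _ ≤ _ := (measure_union_le _ _).trans (by gcongr)
  -- for large `n` the rounded numbers satisfy `n ^ β / 2 ≤ d - p ≤ 2 n ^ β`
  filter_upwards [hev, eventually_ge_atTop 1,
    eventually_mul_rpow_le (by linarith : r - β < 0) 2 (by norm_num : (0 : ℝ) < 1 / 4),
    eventually_mul_rpow_le (by linarith : -β < 0) 1 (by norm_num : (0 : ℝ) < 1 / 8)]
    with n hbd hn e1 e2
  have hn1 : (1 : ℝ) ≤ n := by exact_mod_cast hn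
  have hn0 : (0 : ℝ) < n := by linarith
  have hr1 : 1 ≤ (n : ℝ) ^ r := Real.one_le_rpow hn1 hr₀.le
  have hδ1 : 1 ≤ (n : ℝ) ^ δ := Real.one_le_rpow hn1 hδ.le
  have hp1 : (1 : ℝ) ≤ (E n).p := by
    have h1 : (0 : ℝ) < (E n).p := by linarith [(abs_lt.1 (E n).p_round).1]
    exact_mod_cast (by exact_mod_cast h1 : 0 < (E n).p)
  have hp2 : ((E n).p : ℝ) ≤ 2 * (n : ℝ) ^ r := by linarith [(abs_lt.1 (E n).p_round).2]
  obtain ⟨hd1, hd2⟩ := abs_lt.1 (E n).d_round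
  have hβ0 : 0 < (n : ℝ) ^ β := Real.rpow_pos_of_pos hn0 _
  have f1 : 2 * (n : ℝ) ^ r ≤ (n : ℝ) ^ β / 4 := by
    rw [Real.rpow_sub hn0, ← mul_div_assoc, div_le_iff₀ hβ0] at e1
    linarith
  have f2 : 1 ≤ (n : ℝ) ^ β / 8 := by
    rw [Real.rpow_neg hn0.le, one_mul, inv_le_comm₀ hβ0 (by norm_num)] at e2
    linarith
  have hB1 : 1 ≤ C * (E n).p := by nlinarith
  have hBb : C * (E n).p ≤ 2 * C * (n : ℝ) ^ r := by
    calc C * (E n).p ≤ C * (2 * (n : ℝ) ^ r) := by gcongr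
      _ = _ := by ring
  set D : ℝ := (E n).d - (E n).p with hD
  have hD1 : (n : ℝ) ^ β / 2 ≤ D := by linarith
  have hD2 : D ≤ 2 * (n : ℝ) ^ β := by linarith
  obtain ⟨b1, b2, b3, b4⟩ := hbd (C * (E n).p) D _ hB1 hBb hD1 hD2 rfl
  refine ((E n).measure_not_supportVectorProliferation_le (hH n) (hη n) (hxy n) hn
    ((hC₀ n).mono (le_max_left _ _)) (T := c * (n : ℝ) ^ (β / 2 + 1)) ?_ rfl hD (by linarith) rfl
    hB1 b1 hδ1 (Real.rpow_pos_of_pos hn0 (1 + β / 2 + δ)) b2 b3 b4).trans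
    (ENNReal.ofReal_le_ofReal ?_)
  · filter_upwards [hc₀ n] with a ha
    exact ha.trans (mul_le_mul_of_nonneg_right (le_max_left _ _) (Real.rpow_nonneg hn0.le _))
  · have g1 : 448 * (C * (E n).p) ^ 3 / (n : ℝ) ^ 2 ≤
        448 * (2 * C) ^ 3 * (n : ℝ) ^ (3 * r - 2) := by
      rw [Real.rpow_sub hn0, Real.rpow_two, ← mul_div_assoc]
      refine div_le_div_of_nonneg_right ?_ (by positivity)
      calc 448 * (C * (E n).p) ^ 3 ≤ 448 * (2 * C * (n : ℝ) ^ r) ^ 3 := by gcongr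
        _ = _ := by
          rw [mul_pow, ← Real.rpow_natCast, ← Real.rpow_natCast, ← Real.rpow_mul hn0.le]
          norm_num
          ring_nf
    have g2 : (n : ℝ) ^ 2 * D / ((n : ℝ) ^ (1 + β / 2 + δ)) ^ 2 ≤ 2 * (n : ℝ) ^ (-(2 * δ)) := by
      rw [div_le_iff₀ (by positivity)]
      calc (n : ℝ) ^ 2 * D ≤ (n : ℝ) ^ 2 * (2 * (n : ℝ) ^ β) := by gcongr
        _ = _ := by
          rw [← Real.rpow_natCast, ← Real.rpow_natCast, ← Real.rpow_mul hn0.le, mul_assoc,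
            mul_left_comm, ← Real.rpow_add hn0, ← Real.rpow_add hn0]
          push_cast
          ring_nf
    simp only [hGdef]
    linarith
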